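/- **Setting.** Let $d\ge 2$, $\mathbb T^d=\mathbb R^d/\mathbb Z^d$; functions on $\mathbb T^d$ are identified with $\mathbb Z^d$-periodic functions on $\mathbb R^d$. Fix a smooth $\varphi:\mathbb R^d\to\mathbb R$ supported in $\{3/4\le|\xi|\le 8/3\}$ with $\sum_{j\in\mathbb Z}\varphi(2^{-j}\xi)=1$ for $\xi\ne0$. For a distribution $u$ on $\mathbb T^d$ with Fourier coefficients $\widehat u_k$, put $\dot\Delta_ju(x)=\sum_{k\in\mathbb Z^d}\varphi(2^{-j}k)\,\widehat u_k\,e^{2\pi i k\cdot x}$ and $\|u\|_{\dot B^s_{p,r}}=\big\|2^{js}\|\dot\Delta_ju\|_{L^p(\mathbb T^d)}\big\|_{\ell^r(\mathbb Z)}$; $\dot B^s_{p,r}$ is the set of distributions for which this is finite. For a matrix field, $\|\cdot\|_{\dot B^{s}_{p,r}}$ is the maximum over the entries. Let $T>0$ and let $v\in L^1(0,T;W^{1,\infty}(\mathbb T^d;\mathbb R^d))$ be divergence free, with flow $X_v$ given by $\frac{d}{dt}X_v(t,y)=v(t,X_v(t,y))$, $X_v(0,y)=y$, and put $\underline v(t,y)=v(t,X_v(t,y))$.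 We say that $\underline v$ is small at time $t\in[0,T]$ if $$\int_0^t\|\nabla_y\underline v(\tau,\cdot)\|_{\dot B^{d/q}_{q,1}}\,d\tau\le\frac12\qquad\text{for some } q\in[1,\infty).$$ For $0<s<2$ let $K^s(z)=c_{d,s}|z|^{-d-s}$, with $c_{d,s}=\frac{2^s\Gamma((d+s)/2)}{\pi^{d/2}|\Gamma(-s/2)|}$, be the kernel of $\Lambda^s=(-\Delta)^{s/2}$, and define, for an integrable function $w$ on $\mathbb T^d$ and at a fixed time $t$, $$\Lambda^{s}_{\underline v}w(y)=\mathrm{p.v.}\int_{\mathbb R^d}(w(y)-w(z))\,K^s\big(X_v(t,y)-X_v(t,z)\big)\,dz,$$ where the principal value (the limit $\varepsilon\to0^+$ of the integrals over $|y-z|>\varepsilon$) is taken in the sense of distributions on $\mathbb T^d$. **Lemma.** Let $0<s_1<1$, $s_1<s_2<1+s_1$ and $p,r\in[1,\infty]$. There is a constant $C$, depending only on $d,\varphi,s_1,s_2,p,r$, such that the following holds for all $T>0$, all $t\in[0,T]$ and all $w\in\dot B^{s_2-s_1}_{p,r}$ (such a $w$ is an integrable function). 1. If $v$ is as above and $\underline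 v$ is small at time $t$, then $\Lambda^{s_2}_{\underline v}w$ exists as a distribution, has mean zero, and $$\|\Lambda^{s_2}_{\underline v}w\|_{\dot B^{-s_1}_{p,r}}\le C\,\|w\|_{\dot B^{s_2-s_1}_{p,r}}.$$ 2. If $v_1,v_2$ are as above, $\underline{v_1},\underline{v_2}$ are small at time $t$, and $\delta\underline v=\underline{v_1}-\underline{v_2}$, then $$\|(\Lambda^{s_2}_{\underline{v_1}}-\Lambda^{s_2}_{\underline{v_2}})w\|_{\dot B^{-s_1}_{p,r}}\le C\,\|w\|_{\dot B^{s_2-s_1}_{p,r}}\,\|\delta\underline v\|_{L^1(0,T;W^{1,\infty})}.$$ -/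

import Mathlib

open MeasureTheory Filter Topology Set
open scoped ENNReal NNReal

noncomputable section

namespace LagFrac

/-- The space `ℝ^d` with its Euclidean norm. Functions on the torus `ℝ^d / ℤ^d` are treated as
`ℤ^d`-periodic functions on this space. -/
abbrev Sp (d : ℕ) : Type := EuclideanSpace ℝ (Fin d)

/-- The point of `ℝ^d` with integer coordinates `k`. -/
def lat {d : ℕ} (k : Fin d → ℤ) : Sp d := WithLp.toLp 2 (fun i => (k i : ℝ))

/-- `ℤ^d`-periodicity, i.e. being a function on the torus. -/
def Periodic {d : ℕ} {F : Type*} (f : Sp d → F) : Prop :=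
  ∀ (k : Fin d → ℤ) (x : Sp d), f (x + lat k) = f x

/-- A fundamental domain of the torus, of volume one. -/
def cube (d : ℕ) : Set (Sp d) := {x | ∀ i, x i ∈ Set.Ico (0 : ℝ) 1}

/-! ### Test functions and distributions on the torus -/

/-- Smooth complex-valued functions on the torus. -/
def Test (d : ℕ) : Submodule ℂ (Sp d → ℂ) where
  carrier := {f | ContDiff ℝ ((⊤ : ℕ∞) : WithTop ℕ∞) f ∧ Periodic f}
  add_mem' := by
    rintro f g ⟨hf, hf'⟩ ⟨hg, hg'⟩
    refine ⟨hf.add hg, fun k x => ?_⟩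
    simp only [Pi.add_apply, hf' k x, hg' k x]
  zero_mem' := ⟨contDiff_const, fun _ _ => rfl⟩
  smul_mem' := by
    rintro c f ⟨hf, hf'⟩
    refine ⟨contDiff_const.smul hf, fun k x => ?_⟩
    simp only [Pi.smul_apply, hf' k x]

/-- Distributions on the torus: linear functionals on smooth functions that are continuous, i.e.
bounded by a multiple of finitely many of the sup norms of derivatives. -/
def Distr (d : ℕ) : Submodule ℂ (Test d →ₗ[ℂ] ℂ) where
  carrier := {u | ∃ (N : ℕ) (C : ℝ), 0 ≤ C ∧ ∀ (f : Test d) (M : ℝ),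
    (∀ n ≤ N, ∀ x, ‖iteratedFDeriv ℝ n (f : Sp d → ℂ) x‖ ≤ M) → ‖u f‖ ≤ C * M}
  add_mem' := by
    rintro u v ⟨N, C, hC, h⟩ ⟨N', C', hC', h'⟩
    refine ⟨max N N', C + C', by positivity, fun f M hM => ?_⟩
    have h1 := h f M (fun n hn x => hM n (le_max_of_le_left hn) x)
    have h2 := h' f M (fun n hn x => hM n (le_max_of_le_right hn) x)
    calc ‖(u + v) f‖ ≤ ‖u f‖ + ‖v f‖ := norm_add_le _ _
      _ ≤ C * M + C' * M := add_le_add h1 h2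
      _ = (C + C') * M := by ring
  zero_mem' := ⟨0, 0, le_refl _, fun f M _ => by simp⟩
  smul_mem' := by
    rintro c u ⟨N, C, hC, h⟩
    refine ⟨N, ‖c‖ * C, by positivity, fun f M hM => ?_⟩
    rw [LinearMap.smul_apply, norm_smul, mul_assoc]
    exact mul_le_mul_of_nonneg_left (h f M hM) (norm_nonneg c)

/-- The function `x ↦ exp (2 π i k · x)`. -/
def expo {d : ℕ} (k : Fin d → ℤ) (x : Sp d) : ℂ :=
  Complex.exp (2 * Real.pi * Complex.I * ((∑ i, (k i : ℝ) * x i : ℝ) : ℂ))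

theorem expo_mem {d : ℕ} (k : Fin d → ℤ) : expo k ∈ Test d := by
  constructor
  · have h1 : ContDiff ℝ ((⊤ : ℕ∞) : WithTop ℕ∞)
        (fun x : Sp d => ∑ i, (k i : ℝ) * x i) := by fun_prop
    have h2 : ContDiff ℝ ((⊤ : ℕ∞) : WithTop ℕ∞)
        (fun x : Sp d => ((∑ i, (k i : ℝ) * x i : ℝ) : ℂ)) :=
      Complex.ofRealCLM.contDiff.comp h1
    exact (contDiff_const.mul h2).cexp
  · intro m x
    have h : (∑ i, (k i : ℝ) * (x + lat m) i : ℝ)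
        = (∑ i, (k i : ℝ) * x i) + ((∑ i, k i * m i : ℤ) : ℝ) := by
      push_cast
      rw [← Finset.sum_add_distrib]
      refine Finset.sum_congr rfl fun i _ => ?_
      simp only [PiLp.add_apply, lat]
      ring
    unfold expo
    rw [h, Complex.exp_eq_exp_iff_exists_int]
    refine ⟨∑ i, k i * m i, ?_⟩
    push_cast
    ring

/-- Fourier coefficients of a distribution on the torus. -/
def coeff {d : ℕ} (u : Distr d) (k : Fin d → ℤ) : ℂ := u.1 ⟨expo (-k), expo_mem (-k)⟩

/-- Fourier coefficients of an integrable function on the torus. -/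
def funCoeff {d : ℕ} (w : Sp d → ℂ) (k : Fin d → ℤ) : ℂ := ∫ x in cube d, w x * expo (-k) x

/-- The distribution `u` is the integrable function `w`. -/
def Represents {d : ℕ} (w : Sp d → ℂ) (u : Distr d) : Prop :=
  Periodic w ∧ IntegrableOn w (cube d) ∧
    ∀ f : Test d, u.1 f = ∫ x in cube d, w x * (f : Sp d → ℂ) x

/-! ### Homogeneous Besov norms -/

/-- The functions `φ` used in a homogeneous Littlewood-Paley decomposition. -/
structure IsCutoff {d : ℕ} (φ : Sp d → ℝ) : Prop where
  smooth : ContDiff ℝ ((⊤ : ℕ∞) : WithTop ℕ∞) φ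
  supp : ∀ ξ, φ ξ ≠ 0 → 3 / 4 ≤ ‖ξ‖ ∧ ‖ξ‖ ≤ 8 / 3
  partition : ∀ ξ, ξ ≠ 0 → HasSum (fun j : ℤ => φ ((2 : ℝ) ^ (-j) • ξ)) 1

/-- The dyadic block `∑_k φ(2^{-j} k) c_k e^{2 π i k · x}` (a finite sum) of the distribution with
Fourier coefficients `c`. -/
def block {d : ℕ} (φ : Sp d → ℝ) (j : ℤ) (c : (Fin d → ℤ) → ℂ) (x : Sp d) : ℂ :=
  ∑' k : Fin d → ℤ, (φ ((2 : ℝ) ^ (-j) • lat k) : ℂ) * c k * expo k x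

/-- The norm of the homogeneous Besov space `Ḃ^s_{p,r}` of the torus, as a function of the Fourier
coefficients; a distribution belongs to the space when the value is finite. -/
def besov {d : ℕ} (φ : Sp d → ℝ) (s : ℝ) (p r : ℝ≥0∞) (c : (Fin d → ℤ) → ℂ) : ℝ≥0∞ :=
  if r = ⊤ then
    ⨆ j : ℤ, (2 : ℝ≥0∞) ^ ((j : ℝ) * s) * eLpNorm (block φ j c) p (volume.restrict (cube d))
  else
    (∑' j : ℤ, ((2 : ℝ≥0∞) ^ ((j : ℝ) * s) *
      eLpNorm (block φ j c) p (volume.restrict (cube d))) ^ r.toReal) ^ (1 / r.toReal)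

/-! ### Velocity fields, flows and Lagrangian coordinates -/

/-- The norm of `W^{1,∞}`, for continuous representatives: the sup norm plus the sup norm of the
gradient, the latter being the best Lipschitz constant. It is `∞` off `W^{1,∞}`. -/
def wOneInf {d : ℕ} (f : Sp d → Sp d) : ℝ≥0∞ :=
  (⨆ x, ‖f x‖ₑ) + ⨆ x, ⨆ y, edist (f x) (f y) / edist x y

/-- The norm of `L^1(0,T; W^{1,∞})`. -/
def lOneWOneInf {d : ℕ} (T : ℝ) (v : ℝ → Sp d → Sp d) : ℝ≥0∞ :=
  ∫⁻ τ in Set.Ioc 0 T, wOneInf (v τ)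

/-- Divergence-free vector fields on the torus of class `L^1(0,T; W^{1,∞})`. By Rademacher's
theorem, a field in `W^{1,∞}` is differentiable almost everywhere, so that its divergence is the
trace of its derivative. -/
structure IsVelocity {d : ℕ} (T : ℝ) (v : ℝ → Sp d → Sp d) : Prop where
  periodic : ∀ τ, Periodic (v τ)
  meas : ∀ x, AEStronglyMeasurable (fun τ => v τ x) (volume.restrict (Set.Ioc 0 T))
  lip : ∀ᵐ τ ∂(volume.restrict (Set.Ioc 0 T)), wOneInf (v τ) < ⊤
  integrable : lOneWOneInf T v < ⊤
  div_free : ∀ᵐ τ ∂(volume.restrict (Set.Ioc 0 T)), ∀ᵐ x : Sp d,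
    LinearMap.trace ℝ (Sp d) (fderiv ℝ (v τ) x : Sp d →ₗ[ℝ] Sp d) = 0

/-- `X` is the flow of `v` on `[0,T]` (lifted to `ℝ^d`):
`dX/dt = v(t, X)`, `X(0,y) = y`, in integrated form. -/
def IsFlow {d : ℕ} (T : ℝ) (v X : ℝ → Sp d → Sp d) : Prop :=
  ∀ y, ContinuousOn (fun τ => X τ y) (Set.Icc 0 T) ∧
    ∀ t ∈ Set.Icc 0 T, X t y = y + ∫ τ in (0 : ℝ)..t, v τ (X τ y)

/-- The field `v` in Lagrangian coordinates, `(t,y) ↦ v(t, X(t,y))`. -/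
def lagr {d : ℕ} (v X : ℝ → Sp d → Sp d) : ℝ → Sp d → Sp d := fun τ y => v τ (X τ y)

/-- The norm in `Ḃ^s_{p,r}` of the gradient of a Lipschitz vector field, as the maximum over its
components `∂_i V^l`. -/
def gradBesov {d : ℕ} (φ : Sp d → ℝ) (s : ℝ) (p r : ℝ≥0∞) (V : Sp d → Sp d) : ℝ≥0∞ :=
  ⨆ i : Fin d, ⨆ l : Fin d, besov φ s p r
    (funCoeff fun x => ((fderiv ℝ V x (EuclideanSpace.single i (1 : ℝ)) l : ℝ) : ℂ))

/-- The smallness condition `∫_0^t ‖∇V(τ)‖_{Ḃ^{d/q}_{q,1}} dτ ≤ 1/2` for some `q ∈ [1,∞)`. -/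
def IsSmall {d : ℕ} (φ : Sp d → ℝ) (t : ℝ) (V : ℝ → Sp d → Sp d) : Prop :=
  ∃ q : ℝ, 1 ≤ q ∧
    ∫⁻ τ in Set.Ioc 0 t, gradBesov φ (d / q) (ENNReal.ofReal q) 1 (V τ) ≤ 1 / 2

/-! ### The fractional Laplacian in Lagrangian coordinates -/

/-- The kernel `c / |z|^{d+s}` of the fractional Laplacian `Λ^s = (-Δ)^{s/2}`, `0 < s < 2`, with
`c = 2^s Γ((d+s)/2) / (π^{d/2} |Γ(-s/2)|)`. -/
def kernel (d : ℕ) (s : ℝ) (z : Sp d) : ℝ :=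
  (2 ^ s * Real.Gamma ((d + s) / 2) / (Real.pi ^ ((d : ℝ) / 2) * |Real.Gamma (-s / 2)|)) /
    ‖z‖ ^ ((d : ℝ) + s)

/-- The truncation of `∫_{𝕋^d} f(y) ∫_{ℝ^d} (w(y) - w(z)) K^s(X(y) - X(z)) dz dy` to
`|y - z| > ε`. -/
def truncPairing {d : ℕ} (X : Sp d → Sp d) (s ε : ℝ) (w f : Sp d → ℂ) : ℂ :=
  ∫ y in cube d, ∫ z in {z : Sp d | ε < ‖y - z‖},
    f y * (w y - w z) * (kernel d s (X y - X z) : ℂ)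

/-- `g` is the distribution `y ↦ p.v. ∫_{ℝ^d} (u(y) - u(z)) K^s(X(y) - X(z)) dz`: the distribution
`u` is an integrable function and the principal value converges to `g` in the sense of
distributions. (For a function `u` of low regularity it need not converge pointwise.) -/
def IsFracLap {d : ℕ} (X : Sp d → Sp d) (s : ℝ) (u g : Distr d) : Prop :=
  ∃ w : Sp d → ℂ, Represents w u ∧
    ∀ f : Test d, Tendsto (fun ε => truncPairing X s ε w f) (𝓝[>] 0) (𝓝 (g.1 f))

end LagFrac

end

/-!
Write `a = s₁`, `b = s₂ - s₁`, both in `(0, 1)`, so that the operator has order `a + b`, and put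
`κ(y, z) = K(X(y) - X(z))`, a symmetric kernel that is periodic in the diagonal direction.

*The operator.* Exchanging `y` and `z` (over the torus, two fundamental domains of the diagonal
lattice), the pairing of the truncated operator with a test function `f` becomes half of
`∬ (f(y) - f(z)) (w(y) - w(z)) κ(y, z)`. If `|κ(y, z)| ≤ A |y - z|^{-d-a-b}`, this integral
converges absolutely, so that it defines a distribution and is the limit of the truncations; this
is `IsSingularKernel.exists_distr` and `IsSingularKernel.tendsto_truncated`. Taking for `f` the
reflected kernel of a dyadic block, and writing `w` as the sum of its blocks, the block of frequency
`2^j` of the result is bounded by Minkowski's and Young's inequalities through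
`∫ |h|^{-d-a-b} min(1, 2^j|h|) min(1, 2^m|h|) dh` times the block of frequency `2^m` of `w`. As
`0 < a, b < 1`, Schur's test gives the bound from `B^b_{p,r}` to `B^{-a}_{p,r}` with a constant
proportional to `A`; this is `exists_besov_le_of_form`. The form is linear in `κ`, so the same
theorem, applied to the difference of two kernels, yields the second estimate.

*The kernel.* What is needed is that the flow `X` is bi-Lipschitz with constants that depend on the
dimension and the cutoff only. By Bernstein's inequality a field is Lipschitz with the constant
`C ‖∇V‖_{B^{d/q}_{q,1}}` (`exists_edist_le_gradBesov`), so that the smallness condition bounds the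
Lipschitz constant of `X`. For the lower bound on `|X(y) - X(z)|` this is not enough, as `C` may be
large, and volume preservation comes in: a Lipschitz map that is a uniform limit of homeomorphisms
that almost preserve volumes is bi-Lipschitz (`norm_sub_le_of_volume`), since the preimage of the
segment between the images of `y` and `z` is a curve from `y` to `z`, a neighbourhood of which has
a volume of at least the order of `|y - z|`. The homeomorphisms are provided by the Euler scheme
(`exists_isApproxFlow`): each of its steps is the identity plus a divergence-free field of small
Lipschitz constant, the Jacobian of which is close to `1` to first order. This also avoids the
theory of flows of Sobolev fields.
-/


noncomputable section

namespace LagFrac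

/-! ### The integer lattice and its fundamental domains -/

section Lattice

variable {d : ℕ}

/-- The inclusion of the lattice as a homomorphism. -/
def latHom (d : ℕ) : (Fin d → ℤ) →+ Sp d where
  toFun := lat
  map_zero' := by ext i; simp [lat]
  map_add' k m := by ext i; simp [lat]

@[simp] theorem lat_apply (k : Fin d → ℤ) (i : Fin d) : (lat k : Sp d) i = k i := rfl

@[simp] theorem lat_zero : (lat 0 : Sp d) = 0 := (latHom d).map_zero

theorem lat_add (k m : Fin d → ℤ) : (lat (k + m) : Sp d) = lat k + lat m := (latHom d).map_add k m

theorem lat_neg (k : Fin d → ℤ) : (lat (-k) : Sp d) = -lat k := (latHom d).map_neg k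

/-- The lattice acts on `ℝ^d` by translations, and hence diagonally on `ℝ^d × ℝ^d`. -/
instance : AddAction (Fin d → ℤ) (Sp d) where
  vadd k x := lat k + x
  zero_vadd x := by change lat 0 + x = x; simp
  add_vadd k m x := by change lat (k + m) + x = lat k + (lat m + x); rw [lat_add, add_assoc]

theorem lat_vadd (k : Fin d → ℤ) (x : Sp d) : k +ᵥ x = x + lat k := add_comm _ _

instance : MeasurableConstVAdd (Fin d → ℤ) (Sp d) where
  measurable_const_vadd k := (measurable_const_add (lat k : Sp d))

instance : VAddInvariantMeasure (Fin d → ℤ) (Sp d) volume where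
  measure_preimage_vadd k _ hs := (measurePreserving_add_left volume (lat k : Sp d)).measure_preimage
    hs.nullMeasurableSet

instance : MeasurableConstVAdd (Fin d → ℤ) (Sp d × Sp d) where
  measurable_const_vadd k := by
    change Measurable fun x : Sp d × Sp d => (k +ᵥ x.1, k +ᵥ x.2)
    exact ((measurable_const_vadd k).comp measurable_fst).prodMk
      ((measurable_const_vadd k).comp measurable_snd)

instance : VAddInvariantMeasure (Fin d → ℤ) (Sp d × Sp d) (volume.prod volume) where
  measure_preimage_vadd k _ hs := by
    have h := (measurePreserving_add_left volume (lat k : Sp d))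
    exact (h.prod h).measure_preimage hs.nullMeasurableSet

theorem measurableSet_cube : MeasurableSet (cube d) := by
  have : cube d = ⋂ i, (fun x : Sp d => x i) ⁻¹' Set.Ico (0 : ℝ) 1 := by ext; simp [cube]
  rw [this]
  refine MeasurableSet.iInter fun i => ?_
  exact (by fun_prop : Measurable fun x : Sp d => x i) measurableSet_Ico

theorem existsUnique_vadd_mem_cube (x : Sp d) : ∃! k : Fin d → ℤ, k +ᵥ x ∈ cube d := by
  refine ⟨fun i => -⌊x i⌋, fun i => ?_, fun k hk => ?_⟩
  · rw [lat_vadd]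
    simp only [PiLp.add_apply, lat_apply]
    push_cast
    exact ⟨by linarith [Int.floor_le (x i)], by linarith [Int.lt_floor_add_one (x i)]⟩
  · funext i
    have h := hk i
    rw [lat_vadd] at h
    simp only [PiLp.add_apply, lat_apply] at h
    have : ⌊x i⌋ = -k i := by
      rw [Int.floor_eq_iff]; push_cast; exact ⟨by linarith [h.1], by linarith [h.2]⟩
    omega

theorem isAddFundamentalDomain_cube :
    IsAddFundamentalDomain (Fin d → ℤ) (cube d) volume :=
  .mk' measurableSet_cube.nullMeasurableSet existsUnique_vadd_mem_cube

theorem isAddFundamentalDomain_cube_translate (h : Sp d) :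
    IsAddFundamentalDomain (Fin d → ℤ) {x | x + h ∈ cube d} volume := by
  refine .mk' ?_ fun x => ?_
  · exact (measurable_add_const h measurableSet_cube).nullMeasurableSet
  · have := existsUnique_vadd_mem_cube (x + h)
    simp only [lat_vadd] at this ⊢
    change ∃! k : Fin d → ℤ, x + lat k + h ∈ cube d
    simpa only [add_right_comm] using this

theorem isAddFundamentalDomain_cube_neg :
    IsAddFundamentalDomain (Fin d → ℤ) {x | -x ∈ cube d} (volume : Measure (Sp d)) := by
  refine .mk' ?_ fun x => ?_
  · exact (measurable_neg measurableSet_cube).nullMeasurableSet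
  · obtain ⟨k, hk, hu⟩ := existsUnique_vadd_mem_cube (-x)
    refine ⟨-k, ?_, fun m hm => ?_⟩
    · simpa [lat_vadd, lat_neg, add_comm, sub_eq_add_neg] using hk
    · have := hu (-m) (by simpa [lat_vadd, lat_neg, add_comm, sub_eq_add_neg] using hm)
      rw [← this, neg_neg]

theorem isAddFundamentalDomain_cube_prod :
    IsAddFundamentalDomain (Fin d → ℤ) (cube d ×ˢ (univ : Set (Sp d)))
      ((volume : Measure (Sp d)).prod volume) := by
  refine .mk' (measurableSet_cube.prod .univ).nullMeasurableSet fun x => ?_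
  simpa using existsUnique_vadd_mem_cube x.1

theorem isAddFundamentalDomain_prod_cube :
    IsAddFundamentalDomain (Fin d → ℤ) ((univ : Set (Sp d)) ×ˢ cube d)
      ((volume : Measure (Sp d)).prod volume) := by
  refine .mk' (MeasurableSet.univ.prod measurableSet_cube).nullMeasurableSet fun x => ?_
  simpa using existsUnique_vadd_mem_cube x.2

theorem volume_cube : volume (cube d) = 1 := by
  have h := (EuclideanSpace.volume_preserving_symm_measurableEquiv_toLp (Fin d))
  have h2 : cube d = ((MeasurableEquiv.toLp 2 (Fin d → ℝ)).symm) ⁻¹'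
      (Set.univ.pi fun _ => Set.Ico (0 : ℝ) 1) := by
    ext x; simp [cube]
  rw [h2, h.measure_preimage
    (MeasurableSet.univ_pi fun _ => measurableSet_Ico).nullMeasurableSet, Real.volume_pi_Ico]
  simp

instance : IsProbabilityMeasure ((volume : Measure (Sp d)).restrict (cube d)) :=
  ⟨by simp [volume_cube]⟩

/-! ### Integrals of periodic functions -/

variable {E : Type*}

theorem Periodic.vadd {f : Sp d → E} (hf : Periodic f) (k : Fin d → ℤ) (x : Sp d) :
    f (k +ᵥ x) = f x := by rw [lat_vadd, hf]

theorem setLIntegral_cube_add {f : Sp d → ℝ≥0∞} (hf : Periodic f) (h : Sp d) :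
    ∫⁻ x in cube d, f (x + h) = ∫⁻ x in cube d, f x := by
  have := (measurePreserving_add_right volume h).setLIntegral_comp_preimage_emb
    (MeasurableEquiv.addRight h).measurableEmbedding f (cube d)
  rw [← this]
  refine isAddFundamentalDomain_cube.setLIntegral_eq
    (isAddFundamentalDomain_cube_translate h) _ fun k x => ?_
  rw [lat_vadd, add_right_comm, hf]

theorem setLIntegral_cube_neg {f : Sp d → ℝ≥0∞} (hf : Periodic f) :
    ∫⁻ x in cube d, f (-x) = ∫⁻ x in cube d, f x := by
  have := (Measure.measurePreserving_neg (volume : Measure (Sp d))).setLIntegral_comp_preimage_emb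
    (MeasurableEquiv.neg (Sp d)).measurableEmbedding f (cube d)
  rw [← this]
  refine isAddFundamentalDomain_cube.setLIntegral_eq isAddFundamentalDomain_cube_neg _ fun k x => ?_
  rw [lat_vadd, neg_add, ← lat_neg, hf]

variable [NormedAddCommGroup E]

theorem integrableOn_cube_add {f : Sp d → E} (hf : Periodic f) (h : Sp d)
    (hi : IntegrableOn f (cube d)) : IntegrableOn (fun x => f (x + h)) (cube d) := by
  have h1 : IntegrableOn (fun x => f (x + h)) {x | x + h ∈ cube d} :=
    ((measurePreserving_add_right volume h).integrableOn_comp_preimage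
      (MeasurableEquiv.addRight h).measurableEmbedding).2 hi
  refine (isAddFundamentalDomain_cube.integrableOn_iff
    (isAddFundamentalDomain_cube_translate h) fun k x => ?_).2 h1
  rw [lat_vadd, add_right_comm, hf]

variable [NormedSpace ℝ E]

theorem setIntegral_cube_add {f : Sp d → E} (hf : Periodic f) (h : Sp d) :
    ∫ x in cube d, f (x + h) = ∫ x in cube d, f x := by
  have := (measurePreserving_add_right volume h).setIntegral_preimage_emb
    (MeasurableEquiv.addRight h).measurableEmbedding f (cube d)
  rw [← this]
  refine isAddFundamentalDomain_cube.setIntegral_eq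
    (isAddFundamentalDomain_cube_translate h) fun k x => ?_
  rw [lat_vadd, add_right_comm, hf]

/-- A function on `ℝ^d × ℝ^d` that is invariant under the diagonal action of the lattice may be
integrated over `cube × ℝ^d` or over `ℝ^d × cube`. -/
theorem setIntegral_cube_prod_swap {H : Sp d × Sp d → E}
    (hH : ∀ (k : Fin d → ℤ) y z, H (y + lat k, z + lat k) = H (y, z)) :
    ∫ x in cube d ×ˢ (univ : Set (Sp d)), H x.swap ∂(volume.prod volume) =
      ∫ x in cube d ×ˢ (univ : Set (Sp d)), H x ∂(volume.prod volume) := by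
  have hH' : ∀ (k : Fin d → ℤ) (x : Sp d × Sp d), H (k +ᵥ x) = H x := fun k x => by
    rw [← hH k x.1 x.2]
    congr 1
    exact Prod.ext (lat_vadd _ _) (lat_vadd _ _)
  rw [isAddFundamentalDomain_cube_prod.setIntegral_eq isAddFundamentalDomain_prod_cube hH']
  have := (Measure.measurePreserving_swap (μ := (volume : Measure (Sp d)))
    (ν := (volume : Measure (Sp d)))).setIntegral_preimage_emb
    MeasurableEquiv.prodComm.measurableEmbedding H (univ ×ˢ cube d)
  rw [← this]
  congr 2
  ext x; simp [and_comm]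

theorem lintegral_eq_tsum_cube (f : Sp d → ℝ≥0∞) :
    ∫⁻ x, f x = ∑' k : Fin d → ℤ, ∫⁻ x in cube d, f (x + lat k) := by
  rw [isAddFundamentalDomain_cube.lintegral_eq_tsum'']
  simp only [lat_vadd]

theorem integral_eq_tsum_cube {f : Sp d → E} (hf : Integrable f) :
    ∫ x, f x = ∑' k : Fin d → ℤ, ∫ x in cube d, f (x + lat k) := by
  rw [isAddFundamentalDomain_cube.integral_eq_tsum'' f hf]
  simp only [lat_vadd]

end Lattice

section Expo

variable {d : ℕ}

/-! ### Exponentials and uniqueness of Fourier coefficients -/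

@[simp] theorem expo_zero (x : Sp d) : expo 0 x = 1 := by simp [expo]

theorem expo_add_left (k m : Fin d → ℤ) (x : Sp d) : expo (k + m) x = expo k x * expo m x := by
  simp only [expo, ← Complex.exp_add, Pi.add_apply]
  congr 1
  push_cast
  simp only [add_mul, Finset.sum_add_distrib, mul_add]

theorem expo_add (k : Fin d → ℤ) (x y : Sp d) : expo k (x + y) = expo k x * expo k y := by
  simp only [expo, ← Complex.exp_add, PiLp.add_apply]
  congr 1
  push_cast
  simp only [mul_add, Finset.sum_add_distrib]

theorem expo_neg_left (k : Fin d → ℤ) (x : Sp d) : expo (-k) x = expo k (-x) := by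
  simp [expo]

@[simp] theorem expo_apply_zero (k : Fin d → ℤ) : expo k (0 : Sp d) = 1 := by simp [expo]

@[simp] theorem norm_expo (k : Fin d → ℤ) (x : Sp d) : ‖expo k x‖ = 1 := by
  rw [expo, show (2 * Real.pi * Complex.I * ((∑ i, (k i : ℝ) * x i : ℝ) : ℂ)) =
    ((2 * Real.pi * (∑ i, (k i : ℝ) * x i) : ℝ) : ℂ) * Complex.I by push_cast; ring]
  exact Complex.norm_exp_ofReal_mul_I _

@[fun_prop] theorem contDiff_expo (k : Fin d → ℤ) {n : ℕ∞} : ContDiff ℝ n (expo k : Sp d → ℂ) :=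
  (expo_mem k).1.of_le (by exact_mod_cast le_top)

@[fun_prop] theorem continuous_expo (k : Fin d → ℤ) : Continuous (expo k : Sp d → ℂ) :=
  (expo_mem k).1.continuous

theorem periodic_expo (k : Fin d → ℤ) : Periodic (expo k : Sp d → ℂ) := (expo_mem k).2

theorem exists_norm_le_of_mem_cube (d : ℕ) : ∃ B, ∀ x ∈ cube d, ‖x‖ ≤ B := by
  refine ⟨Real.sqrt (∑ _i : Fin d, (1 : ℝ) ^ 2), fun x hx => ?_⟩
  rw [EuclideanSpace.norm_eq]
  refine Real.sqrt_le_sqrt (Finset.sum_le_sum fun i _ => ?_)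
  rw [Real.norm_eq_abs, abs_of_nonneg (hx i).1]
  have := hx i
  nlinarith [this.1, this.2]

theorem integrableOn_cube_of_continuous {F : Type*} [NormedAddCommGroup F] {f : Sp d → F}
    (hf : Continuous f) : IntegrableOn f (cube d) := by
  have hb : Bornology.IsBounded (cube d) := by
    rw [isBounded_iff_forall_norm_le]
    exact exists_norm_le_of_mem_cube d
  exact (hf.continuousOn.integrableOn_compact hb.isCompact_closure).mono_set subset_closure

theorem integral_cube_expo (k : Fin d → ℤ) :
    ∫ x in cube d, expo k x = if k = 0 then 1 else 0 := by
  split_ifs with h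
  · subst h
    simp [Measure.real]
  · obtain ⟨i, hi⟩ : ∃ i, k i ≠ 0 := by
      by_contra! hc
      exact h (funext hc)
    have h1 := setIntegral_cube_add (periodic_expo k)
      (EuclideanSpace.single i (1 / (2 * (k i : ℝ))))
    have h2 : expo k (EuclideanSpace.single i (1 / (2 * (k i : ℝ))) : Sp d) = -1 := by
      rw [expo, ← Complex.exp_pi_mul_I]
      congr 1
      have : ∑ j, (k j : ℝ) * (EuclideanSpace.single i (1 / (2 * (k i : ℝ))) : Sp d) j = 1 / 2 := by
        rw [Finset.sum_eq_single i]
        · have : (k i : ℝ) ≠ 0 := by exact_mod_cast hi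
          simp; field_simp
        · intro j _ hj; simp [hj]
        · simp
      rw [this]; push_cast; ring
    simp only [expo_add, h2] at h1
    rw [integral_mul_const] at h1
    linear_combination (-1 / 2 : ℂ) * h1

theorem integrableOn_mul_expo {f : Sp d → ℂ} (hf : IntegrableOn f (cube d)) (k : Fin d → ℤ) :
    IntegrableOn (fun x => f x * expo k x) (cube d) :=
  hf.mul_bdd (c := 1) (continuous_expo k).aestronglyMeasurable (.of_forall fun x => by simp)

theorem finite_lat_norm_le (R : ℝ) : {k : Fin d → ℤ | ‖(lat k : Sp d)‖ ≤ R}.Finite := by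
  refine (Set.finite_Icc (fun _ => -⌊R⌋) (fun _ : Fin d => ⌊R⌋)).subset fun k hk => ?_
  have h : ∀ i, |(k i : ℝ)| ≤ R := fun i =>
    (PiLp.norm_apply_le (lat k : Sp d) i).trans hk
  constructor <;> intro i
  · have := (abs_le.1 (h i)).1
    have : -k i ≤ ⌊R⌋ := Int.le_floor.2 (by push_cast; linarith)
    simp only; omega
  · exact Int.le_floor.2 (abs_le.1 (h i)).2

/-- The projection of `ℝ^d` onto the torus. -/
def toTorus (d : ℕ) (x : Sp d) : UnitAddTorus (Fin d) := fun i => (x i : UnitAddCircle)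

theorem isOpenQuotientMap_toTorus : IsOpenQuotientMap (toTorus d) := by
  have h1 : IsOpenQuotientMap (Pi.map fun (_ : Fin d) (x : ℝ) => (x : UnitAddCircle)) :=
    IsOpenQuotientMap.piMap fun _ => QuotientAddGroup.isOpenQuotientMap_mk
  exact h1.comp (PiLp.homeomorph 2 fun _ : Fin d => ℝ).isOpenQuotientMap

theorem mFourier_toTorus (k : Fin d → ℤ) (x : Sp d) :
    UnitAddTorus.mFourier k (toTorus d x) = expo k x := by
  simp only [UnitAddTorus.mFourier, toTorus, ContinuousMap.coe_mk, fourier_coe_apply, expo]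
  rw [← Complex.exp_sum]
  congr 1
  push_cast
  rw [Finset.mul_sum]
  exact Finset.sum_congr rfl fun i _ => by ring

/-- A continuous periodic function is a continuous function on the torus. -/
theorem exists_eq_comp_toTorus {h : Sp d → ℂ} (hc : Continuous h) (hp : Periodic h) :
    ∃ Q : C(UnitAddTorus (Fin d), ℂ), ∀ x, Q (toTorus d x) = h x := by
  have hq := (isOpenQuotientMap_toTorus (d := d)).isQuotientMap
  let π : C(Sp d, UnitAddTorus (Fin d)) := ⟨toTorus d, hq.continuous⟩
  have hπ : IsQuotientMap π := hq
  have hfac : Function.FactorsThrough (⟨h, hc⟩ : C(Sp d, ℂ)) π := by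
    intro a b hab
    have h1 : ∀ i, ∃ n : ℤ, a i - b i = n := fun i => by
      have h2 : ((a i - b i : ℝ) : UnitAddCircle) = 0 := by
        rw [AddCircle.coe_sub, sub_eq_zero]
        exact congrFun hab i
      obtain ⟨n, hn⟩ := (AddCircle.coe_eq_zero_iff _).1 h2
      exact ⟨n, by rw [← hn]; simp⟩
    choose n hn using h1
    have : a = b + lat n := by
      ext i
      simp only [PiLp.add_apply, lat_apply]
      linarith [hn i]
    change h a = h b
    rw [this, hp]
  exact ⟨hπ.lift ⟨h, hc⟩ hfac, fun x =>
    congrArg (fun F : C(Sp d, ℂ) => F x) (hπ.lift_comp ⟨h, hc⟩ hfac)⟩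

/-- Trigonometric polynomials are dense in the continuous functions on the torus, and the integral
against `f` is continuous in the sup norm. -/
theorem integral_mul_eq_zero_of_funCoeff {f : Sp d → ℂ} (hf : IntegrableOn f (cube d))
    (h0 : ∀ k, funCoeff f k = 0) {h : Sp d → ℂ} (hc : Continuous h) (hp : Periodic h) :
    ∫ x in cube d, f x * h x = 0 := by
  have hcont : Continuous (toTorus d) := isOpenQuotientMap_toTorus.continuous
  have hint : ∀ Q : C(UnitAddTorus (Fin d), ℂ),
      IntegrableOn (fun x => f x * Q (toTorus d x)) (cube d) := fun Q =>
    hf.mul_bdd (c := ‖Q‖) (Q.continuous.comp hcont).aestronglyMeasurable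
      (.of_forall fun x => Q.norm_coe_le_norm _)
  let L : C(UnitAddTorus (Fin d), ℂ) →ₗ[ℂ] ℂ :=
    { toFun := fun Q => ∫ x in cube d, f x * Q (toTorus d x)
      map_add' := fun P Q => by
        simp only [ContinuousMap.add_apply, mul_add]
        exact integral_add (hint P) (hint Q)
      map_smul' := fun c Q => by
        simp only [ContinuousMap.smul_apply, smul_eq_mul, RingHom.id_apply]
        rw [← integral_const_mul]
        congr 1 with x
        ring }
  let L' := L.mkContinuous (∫ x in cube d, ‖f x‖) fun Q => by
    rw [← integral_mul_const]
    refine norm_integral_le_of_norm_le (hf.norm.mul_const _) (.of_forall fun x => ?_)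
    rw [norm_mul]
    exact mul_le_mul_of_nonneg_left (Q.norm_coe_le_norm _) (norm_nonneg _)
  have hall : ∀ Q, L' Q = 0 := by
    intro Q
    have hQ : Q ∈ (Submodule.span ℂ (range (UnitAddTorus.mFourier (d := Fin d)))).topologicalClosure
      := by rw [UnitAddTorus.span_mFourier_closure_eq_top]; trivial
    have hle : (Submodule.span ℂ (range (UnitAddTorus.mFourier (d := Fin d)))) ≤
        LinearMap.ker (L' : C(UnitAddTorus (Fin d), ℂ) →ₗ[ℂ] ℂ) := by
      rw [Submodule.span_le]
      rintro _ ⟨k, rfl⟩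
      change ∫ x in cube d, f x * UnitAddTorus.mFourier k (toTorus d x) = 0
      simp only [mFourier_toTorus]
      simpa [funCoeff] using h0 (-k)
    exact (Submodule.topologicalClosure_minimal _ hle L'.isClosed_ker) hQ
  obtain ⟨Q, hQ⟩ := exists_eq_comp_toTorus hc hp
  have := hall Q
  change ∫ x in cube d, f x * Q (toTorus d x) = 0 at this
  simpa only [hQ] using this

theorem Periodic.locallyIntegrable {F : Type*} [NormedAddCommGroup F] {f : Sp d → F}
    (hp : Periodic f) (hf : IntegrableOn f (cube d)) : LocallyIntegrable f := by
  intro x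
  set c : Sp d := WithLp.toLp 2 fun _ => (1 / 2 : ℝ)
  refine ⟨{y | y + (c - x) ∈ cube d}, ?_, (isAddFundamentalDomain_cube.integrableOn_iff
    (isAddFundamentalDomain_cube_translate (c - x)) hp.vadd).1 hf⟩
  have : ∀ᶠ y in 𝓝 x, ∀ i, 0 < (y + (c - x)) i ∧ (y + (c - x)) i < 1 := by
    rw [eventually_all]
    intro i
    have hcont : Continuous fun y : Sp d => (y + (c - x)) i := by fun_prop
    have hx : (x + (c - x)) i = 1 / 2 := by simp [c]
    exact (hcont.continuousAt.eventually_lt_const (by simp only [hx]; norm_num)).and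
      (hcont.continuousAt.eventually_const_lt (by simp only [hx]; norm_num)) |>.mono fun y h => ⟨h.2, h.1⟩
  filter_upwards [this] with y hy i using ⟨(hy i).1.le, (hy i).2⟩

/-- An integrable function on the torus is determined by its Fourier coefficients. -/
theorem ae_eq_zero_of_funCoeff {f : Sp d → ℂ} (hp : Periodic f) (hf : IntegrableOn f (cube d))
    (h0 : ∀ k, funCoeff f k = 0) : f =ᵐ[volume] 0 := by
  refine ae_eq_zero_of_integral_contDiff_smul_eq_zero (hp.locallyIntegrable hf) fun η hη hηc => ?_
  obtain ⟨R, hR⟩ := hηc.isCompact.isBounded.exists_norm_le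
  have hsupp : ∀ x, R < ‖x‖ → η x = 0 := fun x hx => by
    by_contra hne
    exact absurd (hR x (subset_tsupport _ hne)) (not_le.2 hx)
  have hzero : ∀ (B : ℝ) (x : Sp d) (k : Fin d → ℤ), ‖x‖ ≤ B → R + B < ‖(lat k : Sp d)‖ →
      η (x + lat k) = 0 := fun B x k hx hk => by
    refine hsupp _ ?_
    have := norm_sub_norm_le (lat k : Sp d) (-x)
    rw [norm_neg, sub_neg_eq_add, add_comm (lat k)] at this
    linarith
  have hlf : LocallyFinite fun k : Fin d → ℤ =>
      Function.support fun x : Sp d => (η (x + lat k) : ℂ) := by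
    intro x
    refine ⟨Metric.ball x 1, Metric.ball_mem_nhds _ one_pos,
      (finite_lat_norm_le (R + (‖x‖ + 1))).subset ?_⟩
    rintro k ⟨y, hy, hyb⟩
    by_contra hk
    refine hy ?_
    have : ‖y‖ ≤ ‖x‖ + 1 := by
      have := norm_sub_norm_le y x
      rw [mem_ball_iff_norm] at hyb
      linarith
    simp [hzero _ _ _ this (not_le.1 hk)]
  -- The integral of `f` against the compactly supported `η` is the integral over the torus of `f`
  -- against the periodization `P` of `η`.
  set P : Sp d → ℂ := fun x => ∑ᶠ k : Fin d → ℤ, (η (x + lat k) : ℂ) with hP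
  have hPc : Continuous P := by
    refine continuous_finsum (fun k => ?_) hlf
    have := hη.continuous
    fun_prop
  have hPp : Periodic P := fun m x => by
    simp only [hP]
    rw [← finsum_comp_equiv (Equiv.addLeft m) (f := fun k => (η (x + lat k) : ℂ))]
    simp [lat_add, add_assoc]
  have hint := integral_mul_eq_zero_of_funCoeff hf h0 hPc hPp
  obtain ⟨B, hB⟩ := exists_norm_le_of_mem_cube d
  set S := (finite_lat_norm_le (d := d) (R + B)).toFinset
  have hS : ∀ x ∈ cube d, ∀ k ∉ S, η (x + lat k) = 0 := fun x hx k hk =>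
    hzero B x k (hB x hx) (by simpa [S] using hk)
  have hli := hp.locallyIntegrable hf
  have hfi : Integrable (fun x => η x • f x) :=
    hli.integrable_smul_left_of_hasCompactSupport hη.continuous hηc
  rw [integral_eq_tsum_cube hfi, tsum_eq_sum (s := S), ← integral_finsetSum, ← hint]
  · refine setIntegral_congr_fun measurableSet_cube fun x hx => ?_
    simp only [hp _ x, hP]
    rw [finsum_eq_sum_of_support_subset (s := S), Finset.mul_sum]
    · exact Finset.sum_congr rfl fun k _ => by rw [Complex.real_smul]; ring
    · intro k hk
      by_contra hkS
      exact hk (by simp [hS x hx k hkS])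
  · intro k _
    exact (((measurePreserving_add_right volume (lat k : Sp d)).integrable_comp_emb
      (MeasurableEquiv.addRight (lat k)).measurableEmbedding).2 hfi).integrableOn
  · intro k hk
    rw [setIntegral_congr_fun (g := fun _ => 0) measurableSet_cube fun x hx => ?_]
    · simp
    · simp [hS x hx k hk]

end Expo

section Smooth

variable {d : ℕ}

/-! ### Fourier series of smooth functions -/

theorem Periodic.exists_norm_le {F : Type*} [NormedAddCommGroup F] {f : Sp d → F}
    (hp : Periodic f) (hc : Continuous f) : ∃ C : ℝ, 0 ≤ C ∧ ∀ x, ‖f x‖ ≤ C := by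
  obtain ⟨B, hB⟩ := exists_norm_le_of_mem_cube d
  obtain ⟨C, hC⟩ := (isCompact_closedBall (0 : Sp d) B).exists_bound_of_continuousOn hc.continuousOn
  have h : ∀ x, ‖f x‖ ≤ C := fun x => by
    obtain ⟨k, hk, -⟩ := existsUnique_vadd_mem_cube x
    rw [← hp.vadd k x]
    exact hC _ (by simpa using hB _ hk)
  exact ⟨C, (norm_nonneg _).trans (h 0), h⟩

theorem Periodic.fderiv {F : Type*} [NormedAddCommGroup F] [NormedSpace ℝ F] {f : Sp d → F}
    (hp : Periodic f) : Periodic (fderiv ℝ f) := fun k x => by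
  rw [← fderiv_comp_add_right]
  congr 1
  exact funext (hp k)

theorem funCoeff_translate {f : Sp d → ℂ} (hp : Periodic f) (h : Sp d) (k : Fin d → ℤ) :
    funCoeff (fun x => f (x + h)) k = expo k h * funCoeff f k := by
  have hq : Periodic fun x => f x * expo (-k) x := fun m x => by
    simp only [hp m x, periodic_expo (-k) m x]
  simp only [funCoeff]
  rw [← setIntegral_cube_add hq h, ← integral_const_mul]
  congr 1 with x
  rw [expo_add, expo_neg_left k h]
  have : expo k h * expo k (-h) = 1 := by rw [← expo_add]; simp
  linear_combination (-f (x + h) * expo (-k) x) * this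

theorem funCoeff_sub {f g : Sp d → ℂ} (hf : IntegrableOn f (cube d)) (hg : IntegrableOn g (cube d))
    (k : Fin d → ℤ) : funCoeff (fun x => f x - g x) k = funCoeff f k - funCoeff g k := by
  simp only [funCoeff, sub_mul]
  exact integral_sub (integrableOn_mul_expo hf _) (integrableOn_mul_expo hg _)

theorem funCoeff_const_mul (c : ℂ) (f : Sp d → ℂ) (k : Fin d → ℤ) :
    funCoeff (fun x => c * f x) k = c * funCoeff f k := by
  simp only [funCoeff, mul_assoc]
  exact integral_const_mul _ _

theorem funCoeff_expo (m k : Fin d → ℤ) :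
    funCoeff (expo m : Sp d → ℂ) k = if m = k then 1 else 0 := by
  simp only [funCoeff, ← expo_add_left, integral_cube_expo, add_neg_eq_zero]

theorem funCoeff_tsum {ι : Type*} [Countable ι] {F : ι → Sp d → ℂ}
    (hF : ∀ i, IntegrableOn (F i) (cube d)) (hs : Summable fun i => ∫ x in cube d, ‖F i x‖)
    (k : Fin d → ℤ) : funCoeff (fun x => ∑' i, F i x) k = ∑' i, funCoeff (F i) k := by
  simp only [funCoeff, ← tsum_mul_right]
  refine (integral_tsum_of_summable_integral_norm (fun i => integrableOn_mul_expo (hF i) _) ?_).symm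
  simpa using hs

/-- Fourier coefficients of a partial derivative. The derivative need only be the almost everywhere
limit of difference quotients, as for Lipschitz functions. -/
theorem funCoeff_of_tendsto_differenceQuotient {f D : Sp d → ℂ} {K : ℝ≥0} (hf : LipschitzWith K f)
    (hp : Periodic f) (i : Fin d)
    (hD : ∀ᵐ x, Tendsto (fun n : ℕ => ((n : ℂ) + 1) *
      (f (x + EuclideanSpace.single i (1 / ((n : ℝ) + 1))) - f x)) atTop (𝓝 (D x)))
    (k : Fin d → ℤ) : funCoeff D k = 2 * Real.pi * Complex.I * k i * funCoeff f k := by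
  have hint := integrableOn_cube_of_continuous hf.continuous
  have hstep : ∀ h : Sp d, IntegrableOn (fun x => f (x + h)) (cube d) := fun h =>
    integrableOn_cube_add hp h hint
  have h1 : Tendsto (fun n : ℕ => funCoeff (fun x => ((n : ℂ) + 1) *
      (f (x + EuclideanSpace.single i (1 / ((n : ℝ) + 1))) - f x)) k) atTop (𝓝 (funCoeff D k)) := by
    refine tendsto_integral_of_dominated_convergence (fun _ => (K : ℝ)) (fun n => ?_)
      (integrable_const _) (fun n => .of_forall fun x => ?_) ?_
    · exact (integrableOn_mul_expo (((hstep _).sub hint).const_mul _) _).aestronglyMeasurable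
    · rw [norm_mul, norm_mul, norm_expo, mul_one]
      have h2 := hf.dist_le_mul (x + EuclideanSpace.single i (1 / ((n : ℝ) + 1))) x
      rw [dist_eq_norm, dist_eq_norm, add_sub_cancel_left, PiLp.norm_single] at h2
      have h3 : ‖(n : ℂ) + 1‖ = (n : ℝ) + 1 := by
        rw [← Nat.cast_succ, Complex.norm_natCast]; simp
      have h4 : (0 : ℝ) < (n : ℝ) + 1 := by positivity
      rw [Real.norm_of_nonneg (by positivity)] at h2
      rw [h3]
      calc _ ≤ ((n : ℝ) + 1) * (K * (1 / ((n : ℝ) + 1))) := by gcongr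
        _ = K := by field_simp
    · filter_upwards [ae_restrict_of_ae hD] with x hx using hx.mul_const _
  have h2 : ∀ n : ℕ, funCoeff (fun x => ((n : ℂ) + 1) *
      (f (x + EuclideanSpace.single i (1 / ((n : ℝ) + 1))) - f x)) k =
      ((n : ℂ) + 1) * (Complex.exp (2 * Real.pi * Complex.I * k i * (1 / ((n : ℂ) + 1))) - 1)
        * funCoeff f k := fun n => by
    rw [funCoeff_const_mul, funCoeff_sub (hstep _) hint, funCoeff_translate hp]
    have : expo k (EuclideanSpace.single i (1 / ((n : ℝ) + 1)) : Sp d) =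
        Complex.exp (2 * Real.pi * Complex.I * k i * (1 / ((n : ℂ) + 1))) := by
      rw [expo, Finset.sum_eq_single i]
      · congr 1; simp; ring
      · intro j _ hj; simp [hj]
      · simp
    rw [this]; ring
  simp only [h2] at h1
  refine tendsto_nhds_unique h1 (Tendsto.mul_const _ ?_)
  have h3 : HasDerivAt (fun z : ℂ => Complex.exp (2 * Real.pi * Complex.I * k i * z))
      (2 * Real.pi * Complex.I * k i) 0 := by
    have := ((hasDerivAt_id (0 : ℂ)).const_mul (2 * Real.pi * Complex.I * k i)).cexp
    simpa using this
  have h4 := h3.tendsto_slope_zero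
  have h5 : Tendsto (fun n : ℕ => (1 / ((n : ℂ) + 1))) atTop (𝓝[≠] 0) := by
    refine tendsto_nhdsWithin_iff.2 ⟨tendsto_one_div_add_atTop_nhds_zero_nat, ?_⟩
    refine .of_forall fun n => ?_
    have : (n : ℂ) + 1 ≠ 0 := by exact_mod_cast n.succ_ne_zero
    simpa using this
  refine (h4.comp h5).congr fun n => ?_
  simp

theorem tendsto_differenceQuotient {f : Sp d → ℂ} {x : Sp d} (hf : DifferentiableAt ℝ f x)
    (i : Fin d) : Tendsto (fun n : ℕ => ((n : ℂ) + 1) *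
      (f (x + EuclideanSpace.single i (1 / ((n : ℝ) + 1))) - f x)) atTop
      (𝓝 (fderiv ℝ f x (EuclideanSpace.single i 1))) := by
  have h := (hf.hasFDerivAt.hasLineDerivAt (EuclideanSpace.single i (1 : ℝ))).tendsto_slope_zero
  have h5 : Tendsto (fun n : ℕ => (1 / ((n : ℝ) + 1))) atTop (𝓝[≠] 0) := by
    refine tendsto_nhdsWithin_iff.2 ⟨tendsto_one_div_add_atTop_nhds_zero_nat, ?_⟩
    refine .of_forall fun n => ?_
    have : (n : ℝ) + 1 ≠ 0 := by positivity
    simpa using this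
  refine (h.comp h5).congr fun n => ?_
  have : (1 / ((n : ℝ) + 1)) • (EuclideanSpace.single i (1 : ℝ) : Sp d) =
      EuclideanSpace.single i (1 / ((n : ℝ) + 1)) := by
    ext j; by_cases hj : j = i
    · subst hj; simp
    · simp [hj]
  simp only [Function.comp, this, Complex.real_smul]
  push_cast
  simp

theorem Test.exists_lipschitzWith (f : Test d) : ∃ K, LipschitzWith K (f : Sp d → ℂ) := by
  have h1 : ContDiff ℝ 1 (f : Sp d → ℂ) := f.2.1.of_le (by exact_mod_cast le_top)
  obtain ⟨C, hC0, hC⟩ := f.2.2.fderiv.exists_norm_le (h1.continuous_fderiv one_ne_zero)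
  exact ⟨⟨C, hC0⟩, lipschitzWith_of_nnnorm_fderiv_le (h1.differentiable one_ne_zero) hC⟩

/-- The partial derivative of a smooth function. -/
def partialDeriv (i : Fin d) (f : Test d) : Test d :=
  ⟨fun x => fderiv ℝ (f : Sp d → ℂ) x (EuclideanSpace.single i 1),
    (f.2.1.fderiv_right (m := ((⊤ : ℕ∞) : WithTop ℕ∞)) (by simp)).clm_apply contDiff_const,
    fun k x => by simp only [f.2.2.fderiv k x]⟩

theorem funCoeff_partialDeriv (i : Fin d) (f : Test d) (k : Fin d → ℤ) :
    funCoeff (partialDeriv i f : Sp d → ℂ) k =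
      2 * Real.pi * Complex.I * k i * funCoeff (f : Sp d → ℂ) k := by
  obtain ⟨K, hK⟩ := Test.exists_lipschitzWith f
  refine funCoeff_of_tendsto_differenceQuotient hK f.2.2 i (.of_forall fun x => ?_) k
  exact tendsto_differenceQuotient (f.2.1.differentiable (by simp) x) i

theorem Test.continuous (f : Test d) : Continuous (f : Sp d → ℂ) := f.2.1.continuous

theorem Test.integrableOn (f : Test d) : IntegrableOn (f : Sp d → ℂ) (cube d) :=
  integrableOn_cube_of_continuous (Test.continuous f)

theorem funCoeff_add {f g : Sp d → ℂ} (hf : IntegrableOn f (cube d)) (hg : IntegrableOn g (cube d))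
    (k : Fin d → ℤ) : funCoeff (fun x => f x + g x) k = funCoeff f k + funCoeff g k := by
  simp only [funCoeff, add_mul]
  exact integral_add (integrableOn_mul_expo hf _) (integrableOn_mul_expo hg _)

/-- The Fourier coefficients of a smooth function, as a linear map. -/
def testCoeff (k : Fin d → ℤ) : Test d →ₗ[ℂ] ℂ where
  toFun f := funCoeff (f : Sp d → ℂ) k
  map_add' f g := funCoeff_add (Test.integrableOn f) (Test.integrableOn g) k
  map_smul' c _ := funCoeff_const_mul c _ k

theorem norm_lat_sq (k : Fin d → ℤ) : ‖(lat k : Sp d)‖ ^ 2 = ∑ i, (k i : ℝ) ^ 2 := by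
  simp [EuclideanSpace.norm_sq_eq]

/-- Multiplication of the Fourier coefficients by `1 + |k|^2`. -/
theorem exists_funCoeff_eq_mul (f : Test d) : ∃ g : Test d, ∀ k,
    funCoeff (g : Sp d → ℂ) k = (1 + ‖(lat k : Sp d)‖ ^ 2 : ℝ) * funCoeff (f : Sp d → ℂ) k := by
  refine ⟨f - (1 / (4 * Real.pi ^ 2) : ℂ) • ∑ i, partialDeriv i (partialDeriv i f), fun k => ?_⟩
  change testCoeff k _ = _
  rw [map_sub, map_smul, map_sum]
  have : ∀ i, testCoeff k (partialDeriv i (partialDeriv i f)) =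
      -(4 * Real.pi ^ 2) * (k i : ℂ) ^ 2 * funCoeff (f : Sp d → ℂ) k := fun i => by
    change funCoeff _ k = _
    rw [funCoeff_partialDeriv, funCoeff_partialDeriv]
    linear_combination (4 * Real.pi ^ 2 * (k i : ℂ) ^ 2 * funCoeff (f : Sp d → ℂ) k) *
      Complex.I_sq
  simp only [this, norm_lat_sq]
  rw [← Finset.sum_mul, ← Finset.mul_sum]
  change funCoeff (f : Sp d → ℂ) k - _ = _
  have hpi : (Real.pi : ℂ) ≠ 0 := by exact_mod_cast Real.pi_ne_zero
  push_cast
  rw [smul_eq_mul]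
  field_simp
  ring

theorem norm_funCoeff_le_of_norm_le {f : Sp d → ℂ} {C : ℝ} (hC : ∀ x, ‖f x‖ ≤ C)
    (k : Fin d → ℤ) : ‖funCoeff f k‖ ≤ C := by
  refine (norm_setIntegral_le_of_norm_le_const (C := C) ?_ fun x _ => ?_).trans ?_
  · simp [volume_cube]
  · simpa using hC x
  · simp [Measure.real, volume_cube]

/-- The Fourier coefficients of a smooth function decay faster than any power of the frequency. -/
theorem exists_rapid_decay (f : Test d) (M : ℕ) : ∃ C : ℝ, ∀ k,
    ‖funCoeff (f : Sp d → ℂ) k‖ * (1 + ‖(lat k : Sp d)‖ ^ 2) ^ M ≤ C := by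
  induction M generalizing f with
  | zero =>
    obtain ⟨C, -, hC⟩ := f.2.2.exists_norm_le (Test.continuous f)
    exact ⟨C, fun k => by simpa using norm_funCoeff_le_of_norm_le hC k⟩
  | succ M ih =>
    obtain ⟨g, hg⟩ := exists_funCoeff_eq_mul f
    obtain ⟨C, hC⟩ := ih g
    refine ⟨C, fun k => (le_of_eq ?_).trans (hC k)⟩
    rw [hg, norm_mul, Complex.norm_real, Real.norm_of_nonneg (by positivity)]
    ring

/-- The sum is compared with the integral of `(1 + ‖x‖) ^ (-2 (d + 1))` over the translates of the
unit cube. -/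
theorem summable_one_add_norm_lat_sq (d : ℕ) :
    Summable fun k : Fin d → ℤ => ((1 + ‖(lat k : Sp d)‖ ^ 2) ^ (d + 1))⁻¹ := by
  obtain ⟨B, hB⟩ := exists_norm_le_of_mem_cube d
  have hB0 : 0 ≤ B := (norm_nonneg _).trans (hB 0 fun i => by simp)
  have h1 := finite_integral_one_add_norm (E := Sp d) (μ := volume) (r := 2 * (d + 1 : ℕ))
    (by simp; linarith)
  rw [lintegral_eq_tsum_cube] at h1
  set c : ℝ := ((2 * (1 + B) ^ 2) ^ (d + 1))⁻¹
  have hc : 0 < c := by positivity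
  have h2 : ∀ k : Fin d → ℤ, ENNReal.ofReal (c * ((1 + ‖(lat k : Sp d)‖ ^ 2) ^ (d + 1))⁻¹) ≤
      ∫⁻ x in cube d, ENNReal.ofReal ((1 + ‖x + lat k‖) ^ (-(2 * (d + 1 : ℕ) : ℝ))) := fun k => by
    calc _ = ∫⁻ x in cube d, ENNReal.ofReal (c * ((1 + ‖(lat k : Sp d)‖ ^ 2) ^ (d + 1))⁻¹) := by
          simp
      _ ≤ _ := setLIntegral_mono' measurableSet_cube fun x hx => ?_
    refine ENNReal.ofReal_le_ofReal ?_
    rw [← mul_inv, ← mul_pow, Real.rpow_neg (by positivity)]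
    have h3 : (1 + ‖x + lat k‖) ^ (2 * (d + 1 : ℕ) : ℝ) = ((1 + ‖x + lat k‖) ^ 2) ^ (d + 1) := by
      rw [← pow_mul, ← Real.rpow_natCast]
      push_cast; rfl
    rw [h3]
    refine inv_anti₀ (by positivity) (pow_le_pow_left₀ (by positivity) ?_ _)
    have h4 : 1 + ‖x + lat k‖ ≤ (1 + B) * (1 + ‖(lat k : Sp d)‖) := by
      have := norm_add_le x (lat k)
      have := hB x hx
      nlinarith [norm_nonneg (lat k : Sp d)]
    calc _ ≤ ((1 + B) * (1 + ‖(lat k : Sp d)‖)) ^ 2 := by gcongr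
      _ ≤ _ := by
        rw [mul_pow, mul_comm (2 : ℝ), mul_assoc]
        gcongr
        nlinarith [sq_nonneg (1 - ‖(lat k : Sp d)‖)]
  have h3 := (ENNReal.tsum_le_tsum h2).trans_lt h1
  have h4 := ENNReal.summable_toReal h3.ne
  refine (summable_mul_left_iff hc.ne').1 (h4.congr fun k => ?_)
  rw [ENNReal.toReal_ofReal (by positivity)]

/-- The derivative of `expo k` is a multiple of `expo k`. -/
def expoDeriv (k : Fin d → ℤ) : ℂ →L[ℝ] (Sp d →L[ℝ] ℂ) :=
  (ContinuousLinearMap.smulRightL ℝ (Sp d) ℂ (innerSL ℝ (lat k : Sp d))) ∘L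
    (ContinuousLinearMap.mul ℝ ℂ (2 * Real.pi * Complex.I))

theorem fderiv_expo (k : Fin d → ℤ) : fderiv ℝ (expo k : Sp d → ℂ) = expoDeriv k ∘ expo k := by
  funext x
  have h1 : HasFDerivAt (fun x : Sp d => (∑ i, (k i : ℝ) * x i : ℝ)) (innerSL ℝ (lat k : Sp d)) x := by
    have := (innerSL ℝ (lat k : Sp d)).hasFDerivAt (x := x)
    convert! this using 2 with y
    simp [PiLp.inner_apply, mul_comm]
  have h2 := ((Complex.ofRealCLM.hasFDerivAt.comp x h1).const_mul
    (2 * Real.pi * Complex.I)).cexp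
  have h3 : HasFDerivAt (expo k : Sp d → ℂ) _ x := h2
  rw [h3.fderiv]
  ext v
  simp [expoDeriv, expo]
  ring

theorem norm_expoDeriv_le (k : Fin d → ℤ) : ‖expoDeriv k‖ ≤ 2 * Real.pi * ‖(lat k : Sp d)‖ := by
  refine (expoDeriv k).opNorm_le_bound (by positivity) fun z => ?_
  refine ContinuousLinearMap.opNorm_le_bound _ (by positivity) fun v => ?_
  have h1 : expoDeriv k z v = (inner ℝ (lat k : Sp d) v : ℝ) • (2 * Real.pi * Complex.I * z) := by
    simp [expoDeriv]
  rw [h1, norm_smul]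
  have h2 := norm_inner_le_norm (𝕜 := ℝ) (lat k : Sp d) v
  have h3 : ‖2 * (Real.pi : ℂ) * Complex.I * z‖ = 2 * Real.pi * ‖z‖ := by
    simp [abs_of_pos Real.pi_pos]
  rw [h3]
  have : 0 ≤ 2 * Real.pi * ‖z‖ := by positivity
  nlinarith

theorem norm_iteratedFDeriv_expo_le (k : Fin d → ℤ) (n : ℕ) (x : Sp d) :
    ‖iteratedFDeriv ℝ n (expo k : Sp d → ℂ) x‖ ≤ (2 * Real.pi * ‖(lat k : Sp d)‖) ^ n := by
  induction n with
  | zero => simp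
  | succ n ih =>
    rw [← norm_iteratedFDeriv_fderiv, fderiv_expo]
    refine ((expoDeriv k).norm_iteratedFDeriv_comp_left (f := expo k) (n := n)
      (contDiff_expo k).contDiffAt le_rfl).trans ?_
    rw [pow_succ']
    exact mul_le_mul (norm_expoDeriv_le k) ih (norm_nonneg _) (by positivity)

/-- The Fourier series of a smooth function converges normally together with all its derivatives,
that is, in the topology against which distributions are continuous. -/
theorem exists_summable_iteratedFDeriv (f : Test d) (N : ℕ) : ∃ v : (Fin d → ℤ) → ℝ, Summable v ∧
    ∀ n ≤ N, ∀ k x, ‖iteratedFDeriv ℝ n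
      (fun x => funCoeff (f : Sp d → ℂ) k * expo k x) x‖ ≤ v k := by
  obtain ⟨C, hC⟩ := exists_rapid_decay f (N + (d + 1))
  refine ⟨fun k => (2 * Real.pi + 1) ^ N * C * ((1 + ‖(lat k : Sp d)‖ ^ 2) ^ (d + 1))⁻¹,
    (summable_one_add_norm_lat_sq d).mul_left _, fun n hn k x => ?_⟩
  have h1 : iteratedFDeriv ℝ n (fun x => funCoeff (f : Sp d → ℂ) k * expo k x) x =
      funCoeff (f : Sp d → ℂ) k • iteratedFDeriv ℝ n (expo k) x :=
    iteratedFDeriv_const_smul_apply (a := funCoeff (f : Sp d → ℂ) k) (f := expo k) (i := n)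
      (contDiff_expo k).contDiffAt
  rw [h1, norm_smul]
  have h2 := norm_iteratedFDeriv_expo_le k n x
  set t := ‖(lat k : Sp d)‖
  have ht : 0 ≤ t := norm_nonneg _
  have h3 : (2 * Real.pi * t) ^ n ≤ (2 * Real.pi + 1) ^ N * (1 + t ^ 2) ^ N := by
    rw [mul_pow]
    have hpi := Real.pi_pos
    refine mul_le_mul ?_ ?_ (by positivity) (by positivity)
    · exact (pow_le_pow_left₀ (by positivity) (by linarith) n).trans
        (pow_le_pow_right₀ (by linarith) hn)
    · exact (pow_le_pow_left₀ (by positivity) (by nlinarith [sq_nonneg (t - 1)]) n).trans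
        (pow_le_pow_right₀ (by nlinarith) hn)
  calc _ ≤ ‖funCoeff (f : Sp d → ℂ) k‖ * ((2 * Real.pi + 1) ^ N * (1 + t ^ 2) ^ N) := by
        gcongr; exact h2.trans h3
    _ = (2 * Real.pi + 1) ^ N * (‖funCoeff (f : Sp d → ℂ) k‖ * (1 + t ^ 2) ^ (N + (d + 1))) *
        ((1 + t ^ 2) ^ (d + 1))⁻¹ := by
        rw [pow_add]; field_simp
    _ ≤ _ := by
        have := hC k
        have hpi := Real.pi_pos
        exact mul_le_mul_of_nonneg_right (mul_le_mul_of_nonneg_left this (by positivity))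
          (by positivity)

theorem eq_of_funCoeff_eq {f g : Sp d → ℂ} (hf : Continuous f) (hg : Continuous g)
    (hfp : Periodic f) (hgp : Periodic g) (h : ∀ k, funCoeff f k = funCoeff g k) : f = g := by
  have h1 : (fun x => f x - g x) =ᵐ[volume] 0 := by
    refine ae_eq_zero_of_funCoeff (fun k x => by rw [hfp, hgp])
      (integrableOn_cube_of_continuous (hf.sub hg)) fun k => ?_
    rw [funCoeff_sub (integrableOn_cube_of_continuous hf) (integrableOn_cube_of_continuous hg),
      h, sub_self]
  have h2 := (hf.sub hg).ae_eq_iff_eq (μ := volume) continuous_zero |>.1 h1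
  funext x
  exact sub_eq_zero.1 (congrFun h2 x)

theorem Test.hasSum (f : Test d) (x : Sp d) :
    HasSum (fun k => funCoeff (f : Sp d → ℂ) k * expo k x) ((f : Sp d → ℂ) x) := by
  obtain ⟨v, hv, hvb⟩ := exists_summable_iteratedFDeriv f 0
  have hb : ∀ k x, ‖funCoeff (f : Sp d → ℂ) k * expo k x‖ ≤ v k := fun k x => by
    simpa using hvb 0 le_rfl k x
  have hs : ∀ x, Summable fun k => funCoeff (f : Sp d → ℂ) k * expo k x := fun x =>
    Summable.of_norm_bounded hv fun k => hb k x
  have key : (f : Sp d → ℂ) = fun x => ∑' k, funCoeff (f : Sp d → ℂ) k * expo k x := by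
    refine eq_of_funCoeff_eq (Test.continuous f) (continuous_tsum (fun k => by fun_prop) hv hb) f.2.2
      (fun m x => by simp only [periodic_expo _ m x]) fun k => ?_
    rw [funCoeff_tsum (fun m => integrableOn_cube_of_continuous (by fun_prop)) ?_, tsum_eq_single k]
    · rw [funCoeff_const_mul, funCoeff_expo]; simp
    · intro m hm
      rw [funCoeff_const_mul, funCoeff_expo]; simp [hm]
    · refine Summable.of_nonneg_of_le (fun k => by positivity) (fun k => ?_) hv
      simpa using hb k 0
  have := (hs x).hasSum
  rwa [← congrFun key x] at this

/-- A distribution is determined by its Fourier coefficients. -/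
theorem Distr.apply_eq_of_coeff_eq {u : Distr d} {w : Sp d → ℂ} (hw : IntegrableOn w (cube d))
    (h : ∀ k, coeff u k = funCoeff w k) (f : Test d) :
    u.1 f = ∫ x in cube d, w x * (f : Sp d → ℂ) x := by
  obtain ⟨N, C, hC0, hC⟩ := u.2
  obtain ⟨v, hv, hvb⟩ := exists_summable_iteratedFDeriv f N
  set F : Finset (Fin d → ℤ) → Test d := fun S =>
    ∑ k ∈ S, funCoeff (f : Sp d → ℂ) k • (⟨expo k, expo_mem k⟩ : Test d) with hF
  have hFx : ∀ S x, (F S : Sp d → ℂ) x = ∑ k ∈ S, funCoeff (f : Sp d → ℂ) k * expo k x :=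
    fun S x => by
      simp [hF, Finset.sum_apply]
  have hrest : ∀ S, ((f - F S : Test d) : Sp d → ℂ) =
      fun x => ∑' k : {k // k ∉ S}, funCoeff (f : Sp d → ℂ) k * expo k x := fun S => by
    funext x
    have h1 := (Test.hasSum f x).summable.sum_add_tsum_subtype_compl S
    rw [(Test.hasSum f x).tsum_eq] at h1
    change (f : Sp d → ℂ) x - (F S : Sp d → ℂ) x = _
    rw [hFx, ← h1, add_sub_cancel_left]
  have hbound : ∀ S, ∀ n ≤ N, ∀ x, ‖iteratedFDeriv ℝ n ((f - F S : Test d) : Sp d → ℂ) x‖ ≤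
      ∑' k : {k // k ∉ S}, v k := fun S n hn x => by
    rw [hrest, iteratedFDeriv_tsum (N := (N : ℕ∞))
      (f := fun (k : {k // k ∉ S}) x => funCoeff (f : Sp d → ℂ) k.1 * expo k.1 x)
      (v := fun _ (k : {k // k ∉ S}) => v k.1)
      (fun k => contDiff_const.mul (contDiff_expo k.1)) (fun _ _ => hv.subtype {k | k ∉ S})
      (fun m k x hm => hvb m (by exact_mod_cast hm) k.1 x) (by exact_mod_cast hn)]
    exact tsum_of_norm_bounded (hv.subtype {k | k ∉ S}).hasSum fun k => hvb n hn k.1 x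
  have htail : Tendsto (fun S : Finset (Fin d → ℤ) => ∑' k : {k // k ∉ S}, v k) atTop (𝓝 0) :=
    tendsto_tsum_compl_atTop_zero v
  have h1 : Tendsto (fun S => u.1 (F S)) atTop (𝓝 (u.1 f)) := by
    rw [tendsto_iff_norm_sub_tendsto_zero]
    refine squeeze_zero (fun _ => norm_nonneg _) (fun S => ?_) (by simpa using htail.const_mul C)
    rw [norm_sub_rev, ← map_sub]
    exact hC _ _ (hbound S)
  have h2 : Tendsto (fun S => ∫ x in cube d, w x * (F S : Sp d → ℂ) x) atTop
      (𝓝 (∫ x in cube d, w x * (f : Sp d → ℂ) x)) := by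
    rw [tendsto_iff_norm_sub_tendsto_zero]
    have hi : ∀ g : Test d, IntegrableOn (fun x => w x * (g : Sp d → ℂ) x) (cube d) := fun g => by
      obtain ⟨B, -, hB⟩ := g.2.2.exists_norm_le (Test.continuous g)
      exact hw.mul_bdd (c := B) (Test.continuous g).aestronglyMeasurable (.of_forall hB)
    refine squeeze_zero (fun _ => norm_nonneg _) (fun S => ?_)
      (by simpa using htail.const_mul (∫ x in cube d, ‖w x‖))
    rw [norm_sub_rev, ← integral_sub (hi _) (hi _), ← integral_mul_const]
    refine norm_integral_le_of_norm_le (hw.norm.mul_const _) (.of_forall fun x => ?_)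
    rw [← mul_sub, norm_mul]
    have := hbound S 0 (Nat.zero_le _) x
    rw [norm_iteratedFDeriv_zero] at this
    exact mul_le_mul_of_nonneg_left this (norm_nonneg _)
  refine tendsto_nhds_unique h1 (h2.congr fun S => ?_)
  simp only [hFx, Finset.mul_sum]
  rw [integral_finsetSum]
  · simp only [hF, map_sum, map_smul]
    refine Finset.sum_congr rfl fun k _ => ?_
    have := h (-k)
    simp only [coeff, funCoeff, neg_neg] at this
    rw [this, smul_eq_mul, ← integral_const_mul]
    congr 1 with x
    ring
  · intro k _
    have := (integrableOn_mul_expo hw k).const_mul (funCoeff (f : Sp d → ℂ) k)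
    refine this.congr (.of_forall fun x => ?_)
    simp only
    ring

end Smooth

/-! ### Integral inequalities -/

section Inequalities

variable {α β : Type*} [MeasurableSpace α] [MeasurableSpace β]

/-- Jensen's inequality for the power `q ≥ 1` and the weight `g`. -/
theorem lintegral_mul_rpow_le {μ : Measure α} {g u : α → ℝ≥0∞} (hg : AEMeasurable g μ)
    (hu : AEMeasurable u μ) {q : ℝ} (hq : 1 ≤ q) :
    (∫⁻ x, g x * u x ∂μ) ^ q ≤ (∫⁻ x, g x ∂μ) ^ (q - 1) * ∫⁻ x, g x * u x ^ q ∂μ := by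
  have hq0 : 0 < q := by linarith
  have h := ENNReal.lintegral_mul_norm_pow_le hg (hg.mul (hu.pow_const q))
    (p := 1 - 1 / q) (q := 1 / q) (by rw [sub_nonneg, div_le_one hq0]; exact hq) (by positivity)
    (by ring)
  have h1 : ∀ x, g x ^ (1 - 1 / q) * (g x * u x ^ q) ^ (1 / q) = g x * u x := fun x => by
    rw [ENNReal.mul_rpow_of_nonneg _ _ (by positivity), ← ENNReal.rpow_mul, mul_one_div,
      div_self hq0.ne', ENNReal.rpow_one, ← mul_assoc, ← ENNReal.rpow_add_of_nonneg]
    · simp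
    · rw [sub_nonneg, div_le_one hq0]; exact hq
    · positivity
  simp only [Pi.mul_apply, h1] at h
  calc _ ≤ ((∫⁻ x, g x ∂μ) ^ (1 - 1 / q) * (∫⁻ x, g x * u x ^ q ∂μ) ^ (1 / q)) ^ q := by
        gcongr
    _ = _ := by
        rw [ENNReal.mul_rpow_of_nonneg _ _ hq0.le, ← ENNReal.rpow_mul, ← ENNReal.rpow_mul]
        congr 2
        · field_simp
        · field_simp; simp

/-- Minkowski's integral inequality: the `L^p` norm of an integral is at most the integral of any
measurable bound for the `L^p` norms. -/
theorem eLpNorm_lintegral_le {μ : Measure α} {ν : Measure β} [SFinite μ] [SFinite ν]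
    {F : α → β → ℝ≥0∞} (hF : Measurable (Function.uncurry F)) {p : ℝ≥0∞} (hp : 1 ≤ p)
    {N : β → ℝ≥0∞} (hN : Measurable N) (h : ∀ y, eLpNorm (fun x => F x y) p μ ≤ N y) :
    eLpNorm (fun x => ∫⁻ y, F x y ∂ν) p μ ≤ ∫⁻ y, N y ∂ν := by
  have hFx : ∀ x, Measurable (F x) := fun x => hF.comp measurable_prodMk_left
  have hFy : ∀ y, Measurable fun x => F x y := fun y => hF.comp measurable_prodMk_right
  by_cases hI : ∫⁻ y, N y ∂ν = ⊤
  · rw [hI]; exact le_top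
  by_cases hpt : p = ⊤
  · subst hpt
    have h1 : ∀ᵐ x ∂μ, ∀ᵐ y ∂ν, F x y ≤ N y := by
      have hm : MeasurableSet {z : α × β | F z.1 z.2 ≤ N z.2} :=
        measurableSet_le hF (hN.comp measurable_snd)
      rw [Measure.ae_ae_comm hm]
      refine .of_forall fun y => ?_
      have h2 : ∀ᵐ x ∂μ, ‖F x y‖ₑ ≤ eLpNorm (fun x => F x y) ⊤ μ := by
        rw [eLpNorm_exponent_top]; exact ae_le_eLpNormEssSup
      filter_upwards [h2] with x hx using hx.trans (h y)
    rw [eLpNorm_exponent_top]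
    refine essSup_le_of_ae_le _ ?_
    filter_upwards [h1] with x hx using lintegral_mono_ae hx
  have hp0 : p ≠ 0 := (zero_lt_one.trans_le hp).ne'
  set q := p.toReal
  have hq : 1 ≤ q := by
    have := ENNReal.toReal_mono hpt hp
    simpa using this
  have hq0 : 0 < q := by linarith
  have hn : ∀ f : α → ℝ≥0∞, eLpNorm f p μ = (∫⁻ x, f x ^ q ∂μ) ^ (1 / q) := fun f => by
    rw [eLpNorm_eq_lintegral_rpow_enorm_toReal hp0 hpt]; simp [q]
  have hNq : ∀ y, ∫⁻ x, F x y ^ q ∂μ ≤ N y ^ q := fun y => by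
    have := ENNReal.rpow_le_rpow (h y) hq0.le
    rwa [hn, ← ENNReal.rpow_mul, one_div_mul_cancel hq0.ne', ENNReal.rpow_one] at this
  have hNfin : ∀ᵐ y ∂ν, N y < ⊤ := ae_lt_top hN hI
  -- where the bound vanishes, so does the function, and the weight `N` may be divided out
  have hae : ∀ᵐ x ∂μ, ∀ᵐ y ∂ν, F x y = N y * (F x y / N y) := by
    have h1 : ∀ᵐ x ∂μ, ∀ᵐ y ∂ν, N y = 0 → F x y = 0 := by
      rw [Measure.ae_ae_comm]
      · refine .of_forall fun y => ?_
        by_cases hy : N y = 0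
        · have h2 := hNq y
          rw [hy, ENNReal.zero_rpow_of_pos hq0, nonpos_iff_eq_zero,
            lintegral_eq_zero_iff ((hFy y).pow_const q)] at h2
          filter_upwards [h2] with x hx _
          simpa [hq0, hq0.le, ENNReal.rpow_eq_zero_iff, hq0.not_gt] using hx
        · exact .of_forall fun x hc => absurd hc hy
      · have hA : MeasurableSet {x : α × β | N x.2 = 0} :=
          (hN.comp measurable_snd) (measurableSet_singleton 0)
        have hB : MeasurableSet {x : α × β | F x.1 x.2 = 0} := hF (measurableSet_singleton 0)
        convert hA.compl.union hB using 1
        ext x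
        simp [imp_iff_not_or]
    filter_upwards [h1] with x hx
    filter_upwards [hx, hNfin] with y hy hfin
    by_cases h0 : N y = 0
    · rw [hy h0]; simp
    · rw [ENNReal.mul_div_cancel h0 hfin.ne]
  have hdm : Measurable fun z : α × β => F z.1 z.2 / N z.2 := hF.div (hN.comp measurable_snd)
  have key : ∫⁻ x, (∫⁻ y, F x y ∂ν) ^ q ∂μ ≤ (∫⁻ y, N y ∂ν) ^ q := by
    calc ∫⁻ x, (∫⁻ y, F x y ∂ν) ^ q ∂μ
        ≤ ∫⁻ x, (∫⁻ y, N y ∂ν) ^ (q - 1) * ∫⁻ y, N y * (F x y / N y) ^ q ∂ν ∂μ := by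
          refine lintegral_mono_ae ?_
          filter_upwards [hae] with x hx
          rw [lintegral_congr_ae hx]
          exact lintegral_mul_rpow_le hN.aemeasurable ((hFx x).div hN).aemeasurable hq
      _ = (∫⁻ y, N y ∂ν) ^ (q - 1) * ∫⁻ y, ∫⁻ x, N y * (F x y / N y) ^ q ∂μ ∂ν := by
          rw [lintegral_const_mul, lintegral_lintegral_swap]
          · exact ((hN.comp measurable_snd).mul (hdm.pow_const q)).aemeasurable
          · exact ((hN.comp measurable_snd).mul (hdm.pow_const q)).lintegral_prod_right'
      _ ≤ (∫⁻ y, N y ∂ν) ^ (q - 1) * ∫⁻ y, N y ∂ν := by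
          gcongr with y
          rw [lintegral_const_mul _ (((hFy y).div_const _).pow_const _)]
          simp only [ENNReal.div_rpow_of_nonneg _ _ hq0.le]
          simp only [div_eq_mul_inv]
          rw [lintegral_mul_const _ ((hFy y).pow_const _)]
          calc N y * ((∫⁻ x, F x y ^ q ∂μ) * (N y ^ q)⁻¹) ≤ N y * (N y ^ q * (N y ^ q)⁻¹) := by
                gcongr; exact hNq y
            _ ≤ N y * 1 := by gcongr; exact ENNReal.mul_inv_le_one _
            _ = N y := mul_one _
      _ = (∫⁻ y, N y ∂ν) ^ q := by
          nth_rewrite 2 [← ENNReal.rpow_one (∫⁻ y, N y ∂ν)]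
          rw [← ENNReal.rpow_add_of_nonneg _ _ (by linarith) zero_le_one]
          congr 1
          ring
  rw [hn]
  calc _ ≤ ((∫⁻ y, N y ∂ν) ^ q) ^ (1 / q) := by gcongr
    _ = _ := by rw [← ENNReal.rpow_mul, mul_one_div, div_self hq0.ne', ENNReal.rpow_one]

theorem eLpNorm_mul_const_le {μ : Measure α} {f : α → ℝ≥0∞} (hf : Measurable f) (c : ℝ≥0∞)
    (p : ℝ≥0∞) : eLpNorm (fun x => f x * c) p μ ≤ c * eLpNorm f p μ :=
  eLpNorm_le_mul_eLpNorm_of_ae_le_mul'' p hf.aestronglyMeasurable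
    (.of_forall fun x => by simp [mul_comm])

theorem eLpNorm_tsum_le {ι : Type*} [Countable ι] {μ : Measure α} [SFinite μ] {f : ι → α → ℝ≥0∞}
    (hf : ∀ i, Measurable (f i)) {p : ℝ≥0∞} (hp : 1 ≤ p) :
    eLpNorm (fun x => ∑' i, f i x) p μ ≤ ∑' i, eLpNorm (f i) p μ := by
  let _ : MeasurableSpace ι := ⊤
  have := eLpNorm_lintegral_le (μ := μ) (ν := (Measure.count : Measure ι)) (F := fun x i => f i x)
    (measurable_from_prod_countable_left fun i => hf i) hp (N := fun i => eLpNorm (f i) p μ)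
    (measurable_of_countable _) (fun _ => le_rfl)
  simpa [lintegral_count] using this

/-- Schur's test on `ℓ^r`, with the norm of `ℓ^r` written as in the definition of Besov norms. -/
theorem tsum_schur_le {ι : Type*} {A : ι → ι → ℝ≥0∞} {Q : ℝ≥0∞} (h1 : ∀ i, ∑' j, A i j ≤ Q)
    (h2 : ∀ j, ∑' i, A i j ≤ Q) (b : ι → ℝ≥0∞) {r : ℝ} (hr : 1 ≤ r) :
    (∑' i, (∑' j, A i j * b j) ^ r) ^ (1 / r) ≤ Q * (∑' j, b j ^ r) ^ (1 / r) := by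
  let _ : MeasurableSpace ι := ⊤
  have hr0 : 0 < r := by linarith
  have h3 : ∀ i, (∑' j, A i j * b j) ^ r ≤ Q ^ (r - 1) * ∑' j, A i j * b j ^ r := fun i => by
    have := lintegral_mul_rpow_le (μ := (Measure.count : Measure ι)) (g := A i) (u := b)
      (measurable_from_top).aemeasurable (measurable_from_top).aemeasurable hr
    simp only [lintegral_count] at this
    refine this.trans ?_
    gcongr
    exact h1 i
  calc _ ≤ (∑' i, Q ^ (r - 1) * ∑' j, A i j * b j ^ r) ^ (1 / r) := by
        gcongr with i; exact h3 i
    _ = (Q ^ (r - 1) * ∑' j, (∑' i, A i j) * b j ^ r) ^ (1 / r) := by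
        rw [ENNReal.tsum_mul_left, ENNReal.tsum_comm]
        simp only [ENNReal.tsum_mul_right]
    _ ≤ (Q ^ (r - 1) * ∑' j, Q * b j ^ r) ^ (1 / r) := by
        gcongr with j; exact h2 j
    _ = (Q ^ r * ∑' j, b j ^ r) ^ (1 / r) := by
        rw [ENNReal.tsum_mul_left, ← mul_assoc]
        nth_rewrite 2 [← ENNReal.rpow_one Q]
        rw [← ENNReal.rpow_add_of_nonneg _ _ (by linarith) zero_le_one]
        congr 3
        ring
    _ = _ := by
        rw [ENNReal.mul_rpow_of_nonneg _ _ (by positivity), ← ENNReal.rpow_mul, mul_one_div,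
          div_self hr0.ne', ENNReal.rpow_one]

end Inequalities

section Torus

variable {d : ℕ}

theorem eLpNorm_cube_add {f : Sp d → ℝ≥0∞} (hf : Periodic f) (h : Sp d) (p : ℝ≥0∞) :
    eLpNorm (fun x => f (x + h)) p (volume.restrict (cube d)) =
      eLpNorm f p (volume.restrict (cube d)) := by
  by_cases hp0 : p = 0
  · simp [hp0]
  by_cases hpt : p = ⊤
  · simp only [hpt, eLpNorm_exponent_top, eLpNormEssSup_eq_essSup_enorm, enorm_eq_self]
    rw [isAddFundamentalDomain_cube.essSup_measure_restrict hf.vadd,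
      isAddFundamentalDomain_cube.essSup_measure_restrict]
    · have h1 := (MeasurableEquiv.addRight h).measurableEmbedding.essSup_map_measure
        (μ := (volume : Measure (Sp d))) (g := f)
      have h2 : Measure.map (MeasurableEquiv.addRight h) (volume : Measure (Sp d)) = volume :=
        (measurePreserving_add_right (volume : Measure (Sp d)) h).map_eq
      rw [h2] at h1
      exact h1.symm
    · intro k x
      rw [lat_vadd, add_right_comm, hf]
  · rw [eLpNorm_eq_lintegral_rpow_enorm_toReal hp0 hpt,
      eLpNorm_eq_lintegral_rpow_enorm_toReal hp0 hpt]
    congr 1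
    exact setLIntegral_cube_add (f := fun x => ‖f x‖ₑ ^ p.toReal) (fun k x => by simp only [hf k x]) h

/-- Young's inequality for the convolution on the torus. -/
theorem eLpNorm_cube_convolution_le {a b : Sp d → ℝ≥0∞} (ha : Measurable a) (hb : Measurable b)
    (hap : Periodic a) {p : ℝ≥0∞} (hp : 1 ≤ p) :
    eLpNorm (fun x => ∫⁻ y in cube d, a (x - y) * b y) p (volume.restrict (cube d)) ≤
      (∫⁻ y in cube d, b y) * eLpNorm a p (volume.restrict (cube d)) := by
  rw [← lintegral_mul_const _ hb]
  refine eLpNorm_lintegral_le (F := fun x y => a (x - y) * b y) ?_ hp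
    (hb.mul_const _) fun y => ?_
  · exact (ha.comp (measurable_fst.sub measurable_snd)).mul (hb.comp measurable_snd)
  · refine (eLpNorm_mul_const_le (ha.comp (measurable_id.sub_const y)) (b y) p).trans ?_
    have := eLpNorm_cube_add hap (-y) p
    simp only [← sub_eq_add_neg] at this
    exact (congrArg (b y * ·) this).le

end Torus

section TrigPoly

variable {d : ℕ}

/-! ### Trigonometric polynomials -/

/-- The trigonometric polynomial with coefficients `a` (meaningful when `a` has finite support). -/
def ser (a : (Fin d → ℤ) → ℂ) (x : Sp d) : ℂ := ∑' k, a k * expo k x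

theorem ser_eq_sum {a : (Fin d → ℤ) → ℂ} {S : Finset (Fin d → ℤ)} (hS : ∀ k ∉ S, a k = 0)
    (x : Sp d) : ser a x = ∑ k ∈ S, a k * expo k x :=
  tsum_eq_sum fun k hk => by rw [hS k hk, zero_mul]

theorem ser_eq_sum_toFinset {a : (Fin d → ℤ) → ℂ} (ha : a.support.Finite) (x : Sp d) :
    ser a x = ∑ k ∈ ha.toFinset, a k * expo k x :=
  ser_eq_sum (fun k hk => by simpa using hk) x

theorem contDiff_ser {a : (Fin d → ℤ) → ℂ} (ha : a.support.Finite) {n : ℕ∞} :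
    ContDiff ℝ n (ser a) := by
  rw [funext (ser_eq_sum_toFinset ha)]
  exact ContDiff.sum fun k _ => contDiff_const.mul (contDiff_expo k)

theorem continuous_ser {a : (Fin d → ℤ) → ℂ} (ha : a.support.Finite) : Continuous (ser a) :=
  (contDiff_ser ha (n := 0)).continuous

theorem periodic_ser (a : (Fin d → ℤ) → ℂ) : Periodic (ser a) := fun m x => by
  simp only [ser, periodic_expo _ m x]

theorem ser_add_sub (a : (Fin d → ℤ) → ℂ) (ha : a.support.Finite) (h x : Sp d) :
    ser a (x + h) - ser a x = ser (fun k => (expo k h - 1) * a k) x := by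
  rw [ser_eq_sum_toFinset ha, ser_eq_sum_toFinset ha, ← Finset.sum_sub_distrib,
    ser_eq_sum (S := ha.toFinset) fun k hk => by
      rw [show a k = 0 by simpa using hk, mul_zero]]
  exact Finset.sum_congr rfl fun k _ => by rw [expo_add]; ring

theorem funCoeff_finsetSum {ι : Type*} (S : Finset ι) {F : ι → Sp d → ℂ}
    (hF : ∀ i ∈ S, IntegrableOn (F i) (cube d)) (k : Fin d → ℤ) :
    funCoeff (fun x => ∑ i ∈ S, F i x) k = ∑ i ∈ S, funCoeff (F i) k := by
  simp only [funCoeff, Finset.sum_mul]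
  exact integral_finsetSum _ fun i hi => integrableOn_mul_expo (hF i hi) _

theorem funCoeff_ser {a : (Fin d → ℤ) → ℂ} (ha : a.support.Finite) (k : Fin d → ℤ) :
    funCoeff (ser a) k = a k := by
  rw [funext (ser_eq_sum_toFinset ha), funCoeff_finsetSum]
  · simp only [funCoeff_const_mul, funCoeff_expo, mul_ite, mul_one, mul_zero,
      Finset.sum_ite_eq']
    split_ifs with h
    · rfl
    · exact (by simpa using h : a k = 0).symm
  · exact fun k _ => integrableOn_cube_of_continuous (by fun_prop)

theorem ser_convolution {a b : (Fin d → ℤ) → ℂ} (ha : a.support.Finite) (hb : b.support.Finite)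
    (x : Sp d) : ∫ y in cube d, ser a (x - y) * ser b y = ser (fun k => a k * b k) x := by
  have h1 : ∀ y, ser a (x - y) * ser b y =
      ∑ k ∈ ha.toFinset, (a k * expo k x) * (ser b y * expo (-k) y) := fun y => by
    rw [ser_eq_sum_toFinset ha, Finset.sum_mul]
    refine Finset.sum_congr rfl fun k _ => ?_
    rw [sub_eq_add_neg, expo_add, ← expo_neg_left]
    ring
  simp only [h1]
  rw [integral_finsetSum]
  · rw [ser_eq_sum (S := ha.toFinset) fun k hk => by
      rw [show a k = 0 by simpa using hk, zero_mul]]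
    refine Finset.sum_congr rfl fun k _ => ?_
    rw [integral_const_mul]
    have := funCoeff_ser hb k
    rw [funCoeff] at this
    rw [this]
    ring
  · exact fun k _ => (integrableOn_mul_expo (integrableOn_cube_of_continuous
      (continuous_ser hb)) _).const_mul _

/-- If the coefficients are the values at the lattice points of the Fourier transform of an
integrable function `G`, then the trigonometric polynomial is the periodization of `G`, so that its
`L^1` norm on the torus is at most that of `G`. -/
theorem lintegral_cube_ser_le {a : (Fin d → ℤ) → ℂ} (ha : a.support.Finite) {G : Sp d → ℂ}
    (hG : Integrable G) (h : ∀ k, ∫ x, G x * expo (-k) x = a k) :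
    ∫⁻ x in cube d, ‖ser a x‖ₑ ≤ ∫⁻ x, ‖G x‖ₑ := by
  set P : Sp d → ℂ := fun x => ∑' k, G (x + lat k) with hP
  have hGk : ∀ k : Fin d → ℤ, Integrable fun x => G (x + lat k) := fun k =>
    ((measurePreserving_add_right volume (lat k : Sp d)).integrable_comp_emb
      (MeasurableEquiv.addRight (lat k)).measurableEmbedding).2 hG
  have hle : ∫⁻ x in cube d, ‖P x‖ₑ ≤ ∫⁻ x, ‖G x‖ₑ := by
    rw [lintegral_eq_tsum_cube, ← lintegral_tsum fun k => (hGk k).aestronglyMeasurable.enorm.restrict]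
    exact lintegral_mono fun x => enorm_tsum_le_tsum_enorm
  have hPi : IntegrableOn P (cube d) :=
    ⟨(AEMeasurable.tsum fun k => (hGk k).aemeasurable.restrict).aestronglyMeasurable,
      hle.trans_lt hG.2⟩
  have hPp : Periodic P := fun m x => by
    simp only [hP]
    rw [← (Equiv.addLeft m).tsum_eq (fun k => G (x + lat k))]
    simp [lat_add, add_assoc]
  have hcoeff : ∀ k, funCoeff P k = a k := fun k => by
    rw [hP, funCoeff_tsum fun k => (hGk k).integrableOn, ← h k, integral_eq_tsum_cube]
    · refine tsum_congr fun m => ?_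
      simp only [funCoeff, periodic_expo (-k) m]
    · exact hG.mul_bdd (c := 1) (continuous_expo _).aestronglyMeasurable (.of_forall fun x => by simp)
    · have h1 := hG.2
      rw [HasFiniteIntegral, lintegral_eq_tsum_cube] at h1
      refine (ENNReal.summable_toReal h1.ne).congr fun k => ?_
      rw [integral_norm_eq_lintegral_enorm (hGk k).aestronglyMeasurable.restrict]
  have hae : (fun x => ser a x - P x) =ᵐ[volume] 0 :=
    ae_eq_zero_of_funCoeff (fun k x => by rw [periodic_ser, hPp])
      ((integrableOn_cube_of_continuous (continuous_ser ha)).sub hPi) fun k => by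
      rw [funCoeff_sub (integrableOn_cube_of_continuous (continuous_ser ha)) hPi,
        funCoeff_ser ha, hcoeff, sub_self]
  refine le_trans (le_of_eq ?_) hle
  refine lintegral_congr_ae (ae_restrict_of_ae ?_)
  filter_upwards [hae] with x hx
  rw [sub_eq_zero.1 hx]

/-! ### Kernels of frequency cutoffs -/

/-- The translates of `g` are Lipschitz in `L^1`, with the `L^1` norm of the derivative as
constant. -/
theorem integral_norm_add_sub_le (g : SchwartzMap (Sp d) ℂ) (v : Sp d) :
    ∫⁻ x, ‖g (x + v) - g x‖ₑ ≤ ‖v‖ₑ * ∫⁻ x, ‖fderiv ℝ g x‖ₑ := by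
  have hd : Differentiable ℝ g := g.differentiable
  have hc : Continuous (fderiv ℝ g) := (g.smooth 1).continuous_fderiv one_ne_zero
  have h1 : ∀ x, ‖g (x + v) - g x‖ₑ ≤ ∫⁻ t in Ioc (0 : ℝ) 1, ‖fderiv ℝ g (x + t • v)‖ₑ * ‖v‖ₑ := by
    intro x
    have h2 : ∀ t ∈ uIcc (0 : ℝ) 1, HasDerivAt (fun t : ℝ => g (x + t • v))
        (fderiv ℝ g (x + t • v) v) t := fun t _ => by
      have h3 : HasDerivAt (fun t : ℝ => x + t • v) v t := by
        simpa using ((hasDerivAt_id t).smul_const v).const_add x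
      exact (hd _).hasFDerivAt.comp_hasDerivAt t h3
    have h4 := intervalIntegral.integral_eq_sub_of_hasDerivAt h2
      (Continuous.intervalIntegrable (by fun_prop) _ _)
    simp only [one_smul, zero_smul, add_zero] at h4
    rw [← h4, intervalIntegral.integral_of_le zero_le_one]
    refine (enorm_integral_le_lintegral_enorm _).trans (lintegral_mono fun t => ?_)
    exact ContinuousLinearMap.le_opENorm _ _
  calc _ ≤ ∫⁻ x, ∫⁻ t in Ioc (0 : ℝ) 1, ‖fderiv ℝ g (x + t • v)‖ₑ * ‖v‖ₑ := lintegral_mono h1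
    _ = ∫⁻ t in Ioc (0 : ℝ) 1, ∫⁻ x, ‖fderiv ℝ g (x + t • v)‖ₑ * ‖v‖ₑ := by
      refine lintegral_lintegral_swap (Continuous.measurable ?_).aemeasurable
      have : Continuous fun z : Sp d × ℝ => ‖fderiv ℝ g (z.1 + z.2 • v)‖ₑ := by fun_prop
      exact ENNReal.continuous_mul_const (by simp) |>.comp this
    _ = ∫⁻ t in Ioc (0 : ℝ) 1, ‖v‖ₑ * ∫⁻ x, ‖fderiv ℝ g x‖ₑ := by
      refine lintegral_congr fun t => ?_
      rw [lintegral_mul_const _ (by fun_prop), mul_comm,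
        lintegral_add_right_eq_self (fun x => ‖fderiv ℝ g x‖ₑ)]
    _ = _ := by simp

/-- The coefficients `χ(2^{-j} k)` of the kernel of a dyadic frequency cutoff. -/
def dyadic (χ : Sp d → ℝ) (j : ℤ) (k : Fin d → ℤ) : ℂ := (χ ((2 : ℝ) ^ (-j) • lat k) : ℂ)

theorem finite_support_dyadic {χ : Sp d → ℝ} {R : ℝ} (hχ : ∀ ξ, χ ξ ≠ 0 → ‖ξ‖ ≤ R) (j : ℤ) :
    (dyadic χ j).support.Finite := by
  refine (finite_lat_norm_le (R * 2 ^ j)).subset fun k hk => ?_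
  have h : χ ((2 : ℝ) ^ (-j) • lat k) ≠ 0 := fun h0 => hk (by rw [dyadic, h0, Complex.ofReal_zero])
  have h1 := hχ _ h
  rw [norm_smul, Real.norm_of_nonneg (by positivity), zpow_neg] at h1
  rw [Set.mem_ofPred_eq, ← div_le_iff₀ (by positivity), div_eq_inv_mul]
  exact h1

theorem integral_dilate (f : Sp d → ℂ) (j : ℤ) :
    ∫ x, (((2 : ℝ) ^ j) ^ d : ℝ) • f ((2 : ℝ) ^ j • x) = ∫ x, f x := by
  rw [integral_smul, Measure.integral_comp_smul, smul_smul]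
  have : (0 : ℝ) < ((2 : ℝ) ^ j) ^ d := by positivity
  simp [abs_of_pos this, this.ne']

theorem lintegral_dilate {f : Sp d → ℂ} (j : ℤ) :
    ∫⁻ x, ‖(((2 : ℝ) ^ j) ^ d : ℝ) • f ((2 : ℝ) ^ j • x)‖ₑ = ∫⁻ x, ‖f x‖ₑ := by
  have hR : (2 : ℝ) ^ j ≠ 0 := by positivity
  have hpos : (0 : ℝ) < ((2 : ℝ) ^ j) ^ d := by positivity
  simp only [enorm_smul]
  rw [lintegral_const_mul' _ _ (by simp)]
  have h1 := (Homeomorph.smulOfNeZero ((2 : ℝ) ^ j) hR).measurableEmbedding.lintegral_map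
    (μ := (volume : Measure (Sp d))) (fun x => ‖f x‖ₑ)
  have h2 : Measure.map (Homeomorph.smulOfNeZero ((2 : ℝ) ^ j) hR) (volume : Measure (Sp d)) =
      ENNReal.ofReal |(((2 : ℝ) ^ j) ^ Module.finrank ℝ (Sp d))⁻¹| • volume :=
    Measure.map_addHaar_smul volume hR
  rw [h2] at h1
  change _ = ∫⁻ x, ‖f ((2 : ℝ) ^ j • x)‖ₑ at h1
  rw [← h1, lintegral_smul_measure, smul_eq_mul, ← mul_assoc]
  have h3 : ‖((2 : ℝ) ^ j) ^ d‖ₑ * ENNReal.ofReal |((2 : ℝ) ^ j) ^ Module.finrank ℝ (Sp d)|⁻¹ = 1 := by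
    rw [Real.enorm_of_nonneg hpos.le, ← ENNReal.ofReal_mul hpos.le]
    simp [hpos.ne']
  rw [abs_inv, h3, one_mul]

/-- The kernels of dyadic frequency cutoffs are bounded in `L^1` of the torus, and their translates
are continuous at the dyadic scale. -/
theorem exists_kernel_bound {χ : Sp d → ℝ} (hs : ContDiff ℝ ((⊤ : ℕ∞) : WithTop ℕ∞) χ) {R : ℝ}
    (hχ : ∀ ξ, χ ξ ≠ 0 → ‖ξ‖ ≤ R) : ∃ C : ℝ≥0, ∀ j : ℤ,
      (∫⁻ x in cube d, ‖ser (dyadic χ j) x‖ₑ ≤ C) ∧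
      ∀ h, ∫⁻ x in cube d, ‖ser (dyadic χ j) (x + h) - ser (dyadic χ j) x‖ₑ ≤
        C * min 1 (2 ^ (j : ℝ) * ‖h‖ₑ) := by
  have hcomp : HasCompactSupport fun ξ => (χ ξ : ℂ) := by
    refine HasCompactSupport.of_support_subset_isCompact (isCompact_closedBall 0 R) fun ξ hξ => ?_
    simpa using hχ ξ fun h0 => hξ (by simp [h0])
  let f : SchwartzMap (Sp d) ℂ := hcomp.toSchwartzMap (Complex.ofRealCLM.contDiff.comp hs)
  -- `g` has Fourier transform `χ`, and the coefficients of the kernel are the values at the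
  -- lattice points of the Fourier transform of the dilation `G` of `g`, defined below.
  let g : SchwartzMap (Sp d) ℂ := FourierTransform.fourierInv f
  have hfg : ∀ ξ, ∫ x, g x * Complex.exp (↑(-2 * Real.pi * inner ℝ x ξ) * Complex.I) = χ ξ := by
    intro ξ
    have h1 : FourierTransform.fourier g = f := FourierTransform.fourier_fourierInv_eq f
    have h2 : FourierTransform.fourier (g : Sp d → ℂ) ξ = f ξ := by
      rw [← SchwartzMap.fourier_coe, h1]
    rw [Real.fourier_eq'] at h2
    simp only [smul_eq_mul, mul_comm _ (g _)] at h2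
    exact h2
  have hgi : Integrable g := g.integrable
  have hgd : ∫⁻ x, ‖fderiv ℝ g x‖ₑ < ⊤ := (SchwartzMap.fderivCLM ℝ (Sp d) ℂ g).integrable.2
  set A := (∫⁻ x, ‖g x‖ₑ).toNNReal
  set B := (∫⁻ x, ‖fderiv ℝ g x‖ₑ).toNNReal
  have hA : ∫⁻ x, ‖g x‖ₑ = A := (ENNReal.coe_toNNReal hgi.2.ne).symm
  have hB : ∫⁻ x, ‖fderiv ℝ g x‖ₑ = B := (ENNReal.coe_toNNReal hgd.ne).symm
  refine ⟨2 * A + B, fun j => ?_⟩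
  have hR : (0 : ℝ) < (2 : ℝ) ^ j := by positivity
  set G : Sp d → ℂ := fun x => (((2 : ℝ) ^ j) ^ d : ℝ) • g ((2 : ℝ) ^ j • x) with hG
  have hGi : Integrable G :=
    ((integrable_comp_smul_iff volume g hR.ne').2 hgi).smul (((2 : ℝ) ^ j) ^ d)
  have hGc : ∀ k, ∫ x, G x * expo (-k) x = dyadic χ j k := fun k => by
    rw [dyadic, ← hfg]
    refine Eq.trans ?_ (integral_dilate _ j)
    congr 1 with x
    simp only [hG, smul_mul_assoc]
    congr 2
    rw [expo]
    congr 1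
    have : inner ℝ ((2 : ℝ) ^ j • x) ((2 : ℝ) ^ (-j) • (lat k : Sp d)) = ∑ i, (k i : ℝ) * x i := by
      rw [real_inner_smul_left, real_inner_smul_right, ← mul_assoc, ← zpow_add₀ two_ne_zero]
      simp [PiLp.inner_apply]
    rw [this]
    push_cast
    simp only [Pi.neg_apply, Int.cast_neg, neg_mul, Finset.sum_neg_distrib]
    ring
  have hfin := finite_support_dyadic hχ j
  have h1 : ∫⁻ x in cube d, ‖ser (dyadic χ j) x‖ₑ ≤ A := by
    refine (lintegral_cube_ser_le hfin hGi hGc).trans ?_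
    rw [lintegral_dilate, hA]
  refine ⟨h1.trans (by norm_cast; exact le_add_right (le_mul_of_one_le_left' one_le_two)),
    fun h => ?_⟩
  have hshift : Integrable fun x => G (x + h) :=
    ((measurePreserving_add_right volume h).integrable_comp_emb
      (MeasurableEquiv.addRight h).measurableEmbedding).2 hGi
  have h2 : ∫⁻ x in cube d, ‖ser (dyadic χ j) (x + h) - ser (dyadic χ j) x‖ₑ ≤
      ∫⁻ x, ‖G (x + h) - G x‖ₑ := by
    simp only [ser_add_sub _ hfin]
    refine lintegral_cube_ser_le (hfin.subset fun k hk hk0 => hk (by simp [hk0]))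
      (hshift.sub hGi) fun k => ?_
    have hb : ∀ F : Sp d → ℂ, Integrable F → Integrable fun x => F x * expo (-k) x := fun F hF =>
      hF.mul_bdd (c := 1) (continuous_expo _).aestronglyMeasurable (.of_forall fun x => by simp)
    simp only [sub_mul]
    rw [integral_sub (hb _ hshift) (hb _ hGi), hGc]
    have h3 := integral_add_right_eq_self (μ := (volume : Measure (Sp d)))
      (fun x => G x * expo (-k) x) h
    rw [hGc] at h3
    have h4 : ∀ x, G (x + h) * expo (-k) x = expo k h * (G (x + h) * expo (-k) (x + h)) :=
      fun x => by
        have : expo k h * expo (-k) h = 1 := by rw [expo_neg_left, ← expo_add]; simp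
        rw [expo_add (-k)]
        linear_combination (-G (x + h) * expo (-k) x) * this
    simp only [h4]
    rw [integral_const_mul, h3]
    ring
  have h5 : ∫⁻ x, ‖G (x + h) - G x‖ₑ = ∫⁻ x, ‖g (x + (2 : ℝ) ^ j • h) - g x‖ₑ := by
    rw [← lintegral_dilate (f := fun x => g (x + (2 : ℝ) ^ j • h) - g x) j]
    simp only [hG, smul_add, smul_sub]
  have h6 : ∫⁻ x, ‖g (x + (2 : ℝ) ^ j • h) - g x‖ₑ ≤ 2 * A := by
    calc _ ≤ ∫⁻ x, (‖g (x + (2 : ℝ) ^ j • h)‖ₑ + ‖g x‖ₑ) := lintegral_mono fun x => enorm_sub_le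
      _ = 2 * A := by
        rw [lintegral_add_right _ g.continuous.enorm.measurable,
          lintegral_add_right_eq_self (fun x => ‖g x‖ₑ), hA, two_mul]
  have h7 : ∫⁻ x, ‖g (x + (2 : ℝ) ^ j • h) - g x‖ₑ ≤ B * (2 ^ (j : ℝ) * ‖h‖ₑ) := by
    refine (integral_norm_add_sub_le g _).trans (le_of_eq ?_)
    rw [hB, mul_comm, enorm_smul, Real.enorm_of_nonneg hR.le, ← Real.rpow_intCast,
      ← ENNReal.ofReal_rpow_of_pos two_pos]
    simp
  rw [← h5] at h6 h7
  rcases min_choice 1 (2 ^ (j : ℝ) * ‖h‖ₑ) with e | e <;> rw [e]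
  · rw [mul_one]
    exact h2.trans (h6.trans (by push_cast; exact le_self_add))
  · exact h2.trans (h7.trans (by push_cast; gcongr; exact le_add_self))

end TrigPoly

section Blocks

variable {d : ℕ} {φ : Sp d → ℝ}

/-! ### Dyadic blocks -/

theorem exists_fattened_cutoff (d : ℕ) : ∃ χ : Sp d → ℝ,
    ContDiff ℝ ((⊤ : ℕ∞) : WithTop ℕ∞) χ ∧ (∀ ξ, ‖ξ‖ ≤ 8 / 3 → χ ξ = 1) ∧
    (∀ ξ, χ ξ ≠ 0 → ‖ξ‖ ≤ 3) ∧ ∀ ξ, |χ ξ| ≤ 1 := by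
  let b : ContDiffBump (0 : Sp d) := ⟨8 / 3, 3, by norm_num, by norm_num⟩
  refine ⟨b, b.contDiff, fun ξ hξ => b.one_of_mem_closedBall (by simpa using hξ), fun ξ hξ => ?_,
    fun ξ => by rw [abs_of_nonneg b.nonneg]; exact b.le_one⟩
  have : ξ ∈ Function.support b := hξ
  rw [b.support_eq] at this
  exact (mem_ball_zero_iff.1 this).le

theorem block_eq_ser (j : ℤ) (c : (Fin d → ℤ) → ℂ) :
    block φ j c = ser fun k => dyadic φ j k * c k := rfl

theorem IsCutoff.norm_le (hφ : IsCutoff φ) (ξ : Sp d) (h : φ ξ ≠ 0) : ‖ξ‖ ≤ 8 / 3 :=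
  (hφ.supp ξ h).2

theorem IsCutoff.finite_support (hφ : IsCutoff φ) (j : ℤ) (c : (Fin d → ℤ) → ℂ) :
    (Function.support fun k => dyadic φ j k * c k).Finite :=
  (finite_support_dyadic hφ.norm_le j).subset fun k hk hk0 => hk (by simp [hk0])

theorem contDiff_block (hφ : IsCutoff φ) (j : ℤ) (c : (Fin d → ℤ) → ℂ) {n : ℕ∞} :
    ContDiff ℝ n (block φ j c) := contDiff_ser (hφ.finite_support j c)

theorem continuous_block (hφ : IsCutoff φ) (j : ℤ) (c : (Fin d → ℤ) → ℂ) :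
    Continuous (block φ j c) := continuous_ser (hφ.finite_support j c)

theorem periodic_block (j : ℤ) (c : (Fin d → ℤ) → ℂ) : Periodic (block φ j c) := periodic_ser _

theorem one_le_norm_lat {k : Fin d → ℤ} (hk : k ≠ 0) : 1 ≤ ‖(lat k : Sp d)‖ := by
  obtain ⟨i, hi⟩ : ∃ i, k i ≠ 0 := by
    by_contra! hc
    exact hk (funext hc)
  refine le_trans ?_ (PiLp.norm_apply_le (lat k : Sp d) i)
  rw [lat_apply, Real.norm_eq_abs]
  exact_mod_cast Int.one_le_abs hi

theorem IsCutoff.dyadic_zero (hφ : IsCutoff φ) (j : ℤ) : dyadic φ j (0 : Fin d → ℤ) = 0 := by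
  by_contra h
  have h1 := (hφ.supp ((2 : ℝ) ^ (-j) • lat 0) fun h0 => h (by rw [dyadic, h0]; simp)).1
  rw [lat_zero, smul_zero, norm_zero] at h1
  norm_num at h1

/-- The annuli of index `j < -1` contain no lattice point. -/
theorem IsCutoff.dyadic_of_lt (hφ : IsCutoff φ) {j : ℤ} (hj : j < -1) (k : Fin d → ℤ) :
    dyadic φ j k = 0 := by
  by_cases hk : k = 0
  · rw [hk, hφ.dyadic_zero]
  by_contra h
  have h1 := (hφ.supp ((2 : ℝ) ^ (-j) • lat k) fun h0 => h (by rw [dyadic, h0]; simp)).2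
  rw [norm_smul, Real.norm_of_nonneg (by positivity)] at h1
  have h2 := one_le_norm_lat hk
  have h3 : (4 : ℝ) ≤ 2 ^ (-j) := by
    calc (4 : ℝ) = 2 ^ (2 : ℤ) := by norm_num
      _ ≤ _ := zpow_le_zpow_right₀ one_le_two (by omega)
  nlinarith

theorem IsCutoff.block_of_lt (hφ : IsCutoff φ) {j : ℤ} (hj : j < -1) (c : (Fin d → ℤ) → ℂ)
    (x : Sp d) : block φ j c x = 0 := by
  simp [block_eq_ser, ser, hφ.dyadic_of_lt hj]

theorem dyadic_mul_fattened (hφ : IsCutoff φ) {χ : Sp d → ℝ} (hχ : ∀ ξ, ‖ξ‖ ≤ 8 / 3 → χ ξ = 1)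
    (j : ℤ) (k : Fin d → ℤ) : dyadic φ j k * dyadic χ j k = dyadic φ j k := by
  by_cases h : φ ((2 : ℝ) ^ (-j) • lat k) = 0
  · rw [dyadic, h]; simp
  · rw [dyadic, dyadic, hχ _ (hφ.norm_le _ h)]; simp

/-- Translates of a dyadic block in `L^p`. The block is reproduced by the convolution with the
kernel of a cutoff `χ` that is `1` on the support of `φ`, so that the translation may be put on
that kernel. -/
theorem exists_eLpNorm_block_add_sub_le (hφ : IsCutoff φ) : ∃ C : ℝ≥0, ∀ (p : ℝ≥0∞), 1 ≤ p →
    ∀ (j : ℤ) (c : (Fin d → ℤ) → ℂ) (h : Sp d),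
      eLpNorm (fun x => block φ j c (x + h) - block φ j c x) p (volume.restrict (cube d)) ≤
        C * min 1 (2 ^ (j : ℝ) * ‖h‖ₑ) * eLpNorm (block φ j c) p (volume.restrict (cube d)) := by
  obtain ⟨χ, hχs, hχ1, hχ3, -⟩ := exists_fattened_cutoff d
  obtain ⟨C, hC⟩ := exists_kernel_bound hχs hχ3
  refine ⟨C, fun p hp j c h => ?_⟩
  have hfin := hφ.finite_support j c
  have hχf := finite_support_dyadic hχ3 j
  have hbf : (Function.support fun k => (expo k h - 1) * dyadic χ j k).Finite :=
    hχf.subset fun k hk hk0 => hk (by simp [hk0])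
  have h1 : ∀ x, block φ j c (x + h) - block φ j c x =
      ∫ y in cube d, block φ j c (x - y) * (ser (dyadic χ j) (y + h) - ser (dyadic χ j) y) := by
    intro x
    simp only [block_eq_ser, ser_add_sub _ hfin, ser_add_sub _ hχf]
    rw [ser_convolution hfin hbf]
    congr 1
    funext k
    have := dyadic_mul_fattened hφ hχ1 j k
    linear_combination (-(expo k h - 1) * c k) * this
  have hca : Continuous (ser (dyadic χ j)) := continuous_ser hχf
  have hcb := continuous_block hφ j c
  have h2 := eLpNorm_cube_convolution_le (a := fun x => ‖block φ j c x‖ₑ)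
    (b := fun y => ‖ser (dyadic χ j) (y + h) - ser (dyadic χ j) y‖ₑ)
    (by fun_prop) (by fun_prop) (fun k x => by simp only [periodic_block j c k x]) hp
  calc _ ≤ eLpNorm (fun x => ∫⁻ y in cube d, ‖block φ j c (x - y)‖ₑ *
        ‖ser (dyadic χ j) (y + h) - ser (dyadic χ j) y‖ₑ) p (volume.restrict (cube d)) := by
        refine eLpNorm_mono_enorm fun x => ?_
        rw [h1 x]
        refine (enorm_integral_le_lintegral_enorm _).trans (le_of_eq ?_)
        simp [enorm_mul]
    _ ≤ _ := h2
    _ ≤ _ := by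
        rw [eLpNorm_enorm]
        gcongr
        exact (hC j).2 h

/-- The kernel of a dyadic cutoff is bounded by the number of its frequencies. For `j ≥ -1` this
number is at most of the order of `2^{jd}`. -/
theorem enorm_ser_dyadic_le {χ : Sp d → ℝ} (h3 : ∀ ξ, χ ξ ≠ 0 → ‖ξ‖ ≤ 3) (h1 : ∀ ξ, |χ ξ| ≤ 1)
    {j : ℤ} (hj : -1 ≤ j) (x : Sp d) :
    ‖ser (dyadic χ j) x‖ₑ ≤ ENNReal.ofReal ((8 * 2 ^ j) ^ d) := by
  set S : Finset (Fin d → ℤ) := Finset.Icc (fun _ => -⌊3 * (2 : ℝ) ^ j⌋) (fun _ => ⌊3 * (2 : ℝ) ^ j⌋)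
  have hpos : (0 : ℝ) < 2 ^ j := by positivity
  have hj1 : (1 : ℝ) ≤ 2 * 2 ^ j := by
    have : (2 : ℝ) ^ (-1 : ℤ) ≤ 2 ^ j := zpow_le_zpow_right₀ one_le_two hj
    norm_num at this
    linarith
  have hS : ∀ k ∉ S, dyadic χ j k = 0 := fun k hk => by
    by_contra h
    have hn := h3 ((2 : ℝ) ^ (-j) • lat k) fun h0 => h (by rw [dyadic, h0]; simp)
    rw [norm_smul, Real.norm_of_nonneg (by positivity), zpow_neg, ← div_eq_inv_mul,
      div_le_iff₀ hpos] at hn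
    refine hk (Finset.mem_Icc.2 ⟨fun i => ?_, fun i => ?_⟩)
    all_goals
      have h := (PiLp.norm_apply_le (lat k : Sp d) i).trans hn
      rw [lat_apply, Real.norm_eq_abs] at h
    · have := (abs_le.1 h).1
      have : -k i ≤ ⌊3 * (2 : ℝ) ^ j⌋ := Int.le_floor.2 (by push_cast; linarith)
      simp only; omega
    · exact Int.le_floor.2 (abs_le.1 h).2
  have hcard : (S.card : ℝ) ≤ (8 * 2 ^ j) ^ d := by
    rw [Pi.card_Icc]
    push_cast
    simp only [Int.card_Icc, Finset.prod_const, Finset.card_univ, Fintype.card_fin]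
    gcongr
    have h0 : (0 : ℤ) ≤ ⌊3 * (2 : ℝ) ^ j⌋ := Int.floor_nonneg.2 (by positivity)
    have h4 : ((⌊3 * (2 : ℝ) ^ j⌋ + 1 - -⌊3 * (2 : ℝ) ^ j⌋).toNat : ℝ) =
        ((⌊3 * (2 : ℝ) ^ j⌋ + 1 - -⌊3 * (2 : ℝ) ^ j⌋ : ℤ) : ℝ) := by
      exact_mod_cast Int.toNat_of_nonneg (by omega)
    rw [h4]
    push_cast
    have := Int.floor_le (3 * (2 : ℝ) ^ j)
    linarith
  rw [← ofReal_norm]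
  refine ENNReal.ofReal_le_ofReal (le_trans ?_ hcard)
  rw [ser_eq_sum hS]
  refine (norm_sum_le _ _).trans ?_
  rw [Finset.cast_card]
  refine Finset.sum_le_sum fun k _ => ?_
  rw [norm_mul, norm_expo, mul_one, dyadic, Complex.norm_real]
  exact h1 _

/-- Bernstein's inequality for dyadic blocks, with a constant that is uniform in the exponent: the
block is the convolution of itself with the kernel of a wider cutoff, and Jensen's inequality
applies with the absolute value of that kernel as weight. -/
theorem exists_bernstein (hφ : IsCutoff φ) : ∃ C : ℝ≥0, ∀ (q : ℝ), 1 ≤ q →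
    ∀ (j : ℤ) (c : (Fin d → ℤ) → ℂ) (x : Sp d), ‖block φ j c x‖ₑ ≤
      C * (2 ^ ((j : ℝ) * (d / q)) *
        eLpNorm (block φ j c) (ENNReal.ofReal q) (volume.restrict (cube d))) := by
  obtain ⟨χ, hχs, hχ1, hχ3, hχb⟩ := exists_fattened_cutoff d
  obtain ⟨C, hC⟩ := exists_kernel_bound hχs hχ3
  -- The constant is `C + 1` rather than `C`, so that its powers increase with the exponent.
  refine ⟨(C + 1) * 8 ^ d, fun q hq j c x => ?_⟩
  by_cases hj : j < -1
  · simp [hφ.block_of_lt hj]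
  rw [not_lt] at hj
  have hq0 : 0 < q := by linarith
  have hfin := hφ.finite_support j c
  have hχf := finite_support_dyadic hχ3 j
  have hca : Continuous (ser (dyadic χ j)) := continuous_ser hχf
  have hcb := continuous_block hφ j c
  have hmb : Measurable (block φ j c) := hcb.measurable
  have h1 : block φ j c x = ∫ y in cube d, block φ j c (x - y) * ser (dyadic χ j) y := by
    simp only [block_eq_ser]
    rw [ser_convolution hfin hχf]
    congr 1
    funext k
    have := dyadic_mul_fattened hφ hχ1 j k
    linear_combination (-c k) * this
  have h2 : ‖block φ j c x‖ₑ ≤ ∫⁻ y in cube d, ‖ser (dyadic χ j) y‖ₑ * ‖block φ j c (x - y)‖ₑ := by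
    rw [h1]
    refine (enorm_integral_le_lintegral_enorm _).trans (le_of_eq ?_)
    simp [enorm_mul, mul_comm]
  have h3 : ∫⁻ y in cube d, ‖block φ j c (x - y)‖ₑ ^ q = ∫⁻ y in cube d, ‖block φ j c y‖ₑ ^ q := by
    have hper : Periodic fun y => ‖block φ j c y‖ₑ ^ q := fun k y => by
      simp only [periodic_block j c k y]
    have e1 := setLIntegral_cube_neg (f := fun y => ‖block φ j c (x + y)‖ₑ ^ q) fun k y => by
      simp only [← add_assoc, periodic_block j c k _]
    have e2 := setLIntegral_cube_add hper x
    simp only [← sub_eq_add_neg] at e1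
    rw [e1, ← e2]
    simp only [add_comm]
  set M : ℝ≥0∞ := ENNReal.ofReal ((8 * 2 ^ j) ^ d)
  have h4 : ‖block φ j c x‖ₑ ^ q ≤
      (C + 1 : ℝ≥0∞) ^ q * (M * ∫⁻ y in cube d, ‖block φ j c y‖ₑ ^ q) := by
    calc _ ≤ _ := ENNReal.rpow_le_rpow h2 hq0.le
      _ ≤ _ := lintegral_mul_rpow_le (by fun_prop) (by fun_prop) hq
      _ ≤ (C + 1 : ℝ≥0∞) ^ q * ∫⁻ y in cube d, M * ‖block φ j c (x - y)‖ₑ ^ q := by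
        gcongr with y
        · calc _ ≤ (C + 1 : ℝ≥0∞) ^ (q - 1) := by
                gcongr
                exact (hC j).1.trans le_self_add
            _ ≤ _ := ENNReal.rpow_le_rpow_of_exponent_le le_add_self (by linarith)
        · exact enorm_ser_dyadic_le hχ3 hχb hj y
      _ = _ := by rw [lintegral_const_mul _ (by fun_prop), h3]
  have h5 := ENNReal.rpow_le_rpow h4 (z := 1 / q) (by positivity)
  rw [← ENNReal.rpow_mul, mul_one_div, div_self hq0.ne', ENNReal.rpow_one,
    ENNReal.mul_rpow_of_nonneg _ _ (by positivity), ENNReal.mul_rpow_of_nonneg _ _ (by positivity),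
    ← ENNReal.rpow_mul, mul_one_div, div_self hq0.ne', ENNReal.rpow_one] at h5
  have h6 : eLpNorm (block φ j c) (ENNReal.ofReal q) (volume.restrict (cube d)) =
      (∫⁻ y in cube d, ‖block φ j c y‖ₑ ^ q) ^ (1 / q) := by
    rw [eLpNorm_eq_lintegral_rpow_enorm_toReal (by simpa using hq0) ENNReal.ofReal_ne_top,
      ENNReal.toReal_ofReal hq0.le]
  have h7 : M ^ (1 / q) ≤ 8 ^ d * 2 ^ ((j : ℝ) * (d / q)) := by
    have e1 : M = 8 ^ d * 2 ^ ((j : ℝ) * d) := by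
      simp only [M]
      rw [mul_pow, ENNReal.ofReal_mul (by positivity)]
      congr 1
      · rw [ENNReal.ofReal_pow (by norm_num)]; simp
      · rw [← zpow_natCast, ← zpow_mul, ← Real.rpow_intCast, ← ENNReal.ofReal_rpow_of_pos two_pos]
        simp
    rw [e1, ENNReal.mul_rpow_of_nonneg _ _ (by positivity), ← ENNReal.rpow_mul,
      show (j : ℝ) * d * (1 / q) = j * (d / q) by ring]
    gcongr
    calc ((8 : ℝ≥0∞) ^ d) ^ (1 / q) ≤ ((8 : ℝ≥0∞) ^ d) ^ (1 : ℝ) := by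
            refine ENNReal.rpow_le_rpow_of_exponent_le (one_le_pow₀ (by norm_num)) ?_
            rw [div_le_one hq0]; exact hq
        _ = _ := ENNReal.rpow_one _
  rw [h6]
  refine h5.trans ?_
  push_cast
  calc _ ≤ (C + 1 : ℝ≥0∞) * (8 ^ d * 2 ^ ((j : ℝ) * (d / q)) * _) := by gcongr
    _ = _ := by ring

end Blocks

section Reconstruction

variable {d : ℕ} {φ : Sp d → ℝ}

/-! ### Reconstruction of a function from its dyadic blocks -/

theorem integrableOn_tsum {ι : Type*} [Countable ι] {F : ι → Sp d → ℂ}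
    (hF : ∀ i, IntegrableOn (F i) (cube d)) (hs : ∑' i, ∫⁻ x in cube d, ‖F i x‖ₑ ≠ ⊤) :
    IntegrableOn (fun x => ∑' i, F i x) (cube d) := by
  refine ⟨(AEMeasurable.tsum fun i => (hF i).aemeasurable).aestronglyMeasurable, ?_⟩
  refine lt_of_le_of_lt (lintegral_mono fun x => enorm_tsum_le_tsum_enorm) ?_
  rw [lintegral_tsum fun i => (hF i).aestronglyMeasurable.enorm]
  exact hs.lt_top

theorem funCoeff_tsum' {ι : Type*} [Countable ι] {F : ι → Sp d → ℂ}
    (hF : ∀ i, IntegrableOn (F i) (cube d)) (hs : ∑' i, ∫⁻ x in cube d, ‖F i x‖ₑ ≠ ⊤)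
    (k : Fin d → ℤ) : funCoeff (fun x => ∑' i, F i x) k = ∑' i, funCoeff (F i) k := by
  refine funCoeff_tsum hF ((ENNReal.summable_toReal hs).congr fun i => ?_) k
  rw [integral_norm_eq_lintegral_enorm (hF i).aestronglyMeasurable]

theorem integrableOn_block (hφ : IsCutoff φ) (j : ℤ) (c : (Fin d → ℤ) → ℂ) :
    IntegrableOn (block φ j c) (cube d) :=
  integrableOn_cube_of_continuous (continuous_block hφ j c)

theorem integrableOn_cube_const (a : ℂ) : IntegrableOn (fun _ : Sp d => a) (cube d) :=
  integrableOn_cube_of_continuous continuous_const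

theorem funCoeff_const (a : ℂ) (k : Fin d → ℤ) :
    funCoeff (fun _ : Sp d => a) k = if k = 0 then a else 0 := by
  have h := funCoeff_const_mul a (expo (0 : Fin d → ℤ) : Sp d → ℂ) k
  simp only [expo_zero, mul_one, funCoeff_expo] at h
  rw [h]
  simp [eq_comm]

theorem IsCutoff.hasSum_dyadic (hφ : IsCutoff φ) {k : Fin d → ℤ} (hk : k ≠ 0) :
    HasSum (fun j : ℤ => dyadic φ j k) 1 := by
  have h0 : (lat k : Sp d) ≠ 0 := fun h => by
    have := one_le_norm_lat hk
    rw [h, norm_zero] at this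
    linarith
  have := hφ.partition _ h0
  simpa [dyadic] using Complex.hasSum_ofReal.2 this

/-- The Fourier coefficients of the sum of the dyadic blocks, possibly with constants removed to
make the series converge. -/
theorem funCoeff_tsum_block (hφ : IsCutoff φ) (c : (Fin d → ℤ) → ℂ) (a : ℤ → ℂ)
    (hs : ∑' j, ∫⁻ x in cube d, ‖block φ j c x - a j‖ₑ ≠ ⊤) (k : Fin d → ℤ) :
    funCoeff (fun x => ∑' j, (block φ j c x - a j)) k = if k = 0 then -∑' j, a j else c k := by
  rw [funCoeff_tsum' (F := fun j x => block φ j c x - a j)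
    (fun j => (integrableOn_block hφ j c).sub (integrableOn_cube_const _)) hs]
  have h1 : ∀ j, funCoeff (fun x => block φ j c x - a j) k =
      dyadic φ j k * c k - if k = 0 then a j else 0 := fun j => by
    rw [funCoeff_sub (integrableOn_block hφ j c) (integrableOn_cube_const _), funCoeff_const,
      block_eq_ser, funCoeff_ser (hφ.finite_support j c)]
  simp only [h1]
  split_ifs with h
  · simp only [h, hφ.dyadic_zero, zero_mul, zero_sub, tsum_neg]
  · simp only [sub_zero]
    rw [tsum_mul_right, (hφ.hasSum_dyadic h).tsum_eq, one_mul]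

theorem exists_ae_eq_const_add_tsum_block (hφ : IsCutoff φ) {f : Sp d → ℂ} (hp : Periodic f)
    (hf : IntegrableOn f (cube d)) (a : ℤ → ℂ)
    (hs : ∑' j, ∫⁻ x in cube d, ‖block φ j (funCoeff f) x - a j‖ₑ ≠ ⊤) :
    ∃ b : ℂ, ∀ᵐ x, f x = b + ∑' j, (block φ j (funCoeff f) x - a j) := by
  set W : Sp d → ℂ := fun x => ∑' j, (block φ j (funCoeff f) x - a j)
  have hW : IntegrableOn W (cube d) := integrableOn_tsum
    (fun j => (integrableOn_block hφ j _).sub (integrableOn_cube_const _)) hs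
  have hWp : Periodic W := fun k x => by simp only [W, periodic_block _ _ k x]
  set b : ℂ := funCoeff (fun x => f x - W x) 0
  refine ⟨b, ?_⟩
  have h1 : (fun x => f x - W x - b) =ᵐ[volume] 0 := by
    refine ae_eq_zero_of_funCoeff (fun k x => by rw [hp, hWp])
      ((hf.sub hW).sub (integrableOn_cube_const b)) fun k => ?_
    rw [funCoeff_sub (f := fun x => f x - W x) (hf.sub hW) (integrableOn_cube_const b),
      funCoeff_const]
    split_ifs with hk
    · rw [hk, sub_self]
    · rw [funCoeff_sub hf hW, funCoeff_tsum_block hφ _ a hs, if_neg hk]; ring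
  filter_upwards [h1] with x hx
  have hx' : f x - W x - b = 0 := hx
  linear_combination hx'

/-- A distribution whose blocks are summable in `L^1` is an integrable function. -/
theorem represents_of_tsum_block (hφ : IsCutoff φ) (u : Distr d)
    (hs : ∑' j, ∫⁻ x in cube d, ‖block φ j (coeff u) x‖ₑ ≠ ⊤) :
    Represents (fun x => coeff u 0 + ∑' j, block φ j (coeff u) x) u := by
  have hi := integrableOn_tsum (fun j => integrableOn_block hφ j (coeff u)) hs
  have hi2 := (integrableOn_cube_const (d := d) (coeff u 0)).add hi
  refine ⟨fun k x => by simp only [periodic_block _ _ k x], hi2,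
    Distr.apply_eq_of_coeff_eq hi2 fun k => ?_⟩
  have h1 := funCoeff_tsum_block hφ (coeff u) (fun _ => 0) (by simpa using hs) k
  simp only [sub_zero] at h1
  refine Eq.trans ?_ (funCoeff_add (integrableOn_cube_const (d := d) (coeff u 0)) hi k).symm
  rw [h1, funCoeff_const]
  split_ifs with hk
  · simp [hk]
  · simp

theorem le_besov (s : ℝ) (p : ℝ≥0∞) {r : ℝ≥0∞} (hr : 1 ≤ r) (c : (Fin d → ℤ) → ℂ) (j : ℤ) :
    (2 : ℝ≥0∞) ^ ((j : ℝ) * s) * eLpNorm (block φ j c) p (volume.restrict (cube d)) ≤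
      besov φ s p r c := by
  unfold besov
  split_ifs with h
  · exact le_iSup (fun j : ℤ => (2 : ℝ≥0∞) ^ ((j : ℝ) * s) *
      eLpNorm (block φ j c) p (volume.restrict (cube d))) j
  · have hr0 : 0 < r.toReal := ENNReal.toReal_pos (zero_lt_one.trans_le hr).ne' h
    rw [one_div, ENNReal.le_rpow_inv_iff hr0]
    exact ENNReal.le_tsum (f := fun j : ℤ => ((2 : ℝ≥0∞) ^ ((j : ℝ) * s) *
      eLpNorm (block φ j c) p (volume.restrict (cube d))) ^ r.toReal) j

theorem tsum_two_rpow_lt_top {s : ℝ} (hs : 0 < s) :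
    ∑' j : ℤ, (if j < -1 then 0 else (2 : ℝ≥0∞) ^ (-((j : ℝ) * s))) < ⊤ := by
  have hinj : Function.Injective fun n : ℕ => (n : ℤ) - 1 := fun a b h => by
    simpa using h
  rw [← hinj.tsum_eq]
  · have h1 : ∀ n : ℕ, (if (n : ℤ) - 1 < -1 then 0 else
        (2 : ℝ≥0∞) ^ (-((((n : ℤ) - 1 : ℤ) : ℝ) * s))) = 2 ^ s * ((2 : ℝ≥0∞) ^ (-s)) ^ n := fun n => by
      rw [if_neg (by omega), ← ENNReal.rpow_natCast, ← ENNReal.rpow_mul,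
        ← ENNReal.rpow_add _ _ two_ne_zero ENNReal.ofNat_ne_top]
      congr 1
      push_cast
      ring
    simp only [h1]
    rw [ENNReal.tsum_mul_left, ENNReal.tsum_geometric]
    refine ENNReal.mul_lt_top (ENNReal.rpow_lt_top_of_nonneg hs.le ENNReal.ofNat_ne_top) ?_
    simp only [ENNReal.inv_lt_top, tsub_pos_iff_lt]
    rw [ENNReal.rpow_neg]
    simpa using ENNReal.one_lt_rpow (by norm_num : (1 : ℝ≥0∞) < 2) hs
  · intro j hj
    rw [Function.mem_support] at hj
    by_cases hj0 : j < -1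
    · simp [hj0] at hj
    · exact ⟨(j + 1).toNat, show (((j + 1).toNat : ℕ) : ℤ) - 1 = j by omega⟩

theorem lintegral_block_le (hφ : IsCutoff φ) {p : ℝ≥0∞} (hp : 1 ≤ p) (j : ℤ)
    (c : (Fin d → ℤ) → ℂ) : ∫⁻ x in cube d, ‖block φ j c x‖ₑ ≤
      eLpNorm (block φ j c) p (volume.restrict (cube d)) := by
  rw [← eLpNorm_one_eq_lintegral_enorm]
  exact eLpNorm_le_eLpNorm_of_exponent_le hp (continuous_block hφ j c).aestronglyMeasurable

/-- The blocks of an element of a Besov space of positive regularity are summable in `L^1`. -/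
theorem tsum_lintegral_block_ne_top (hφ : IsCutoff φ) {s : ℝ} (hs : 0 < s) {p r : ℝ≥0∞}
    (hp : 1 ≤ p) (hr : 1 ≤ r) {c : (Fin d → ℤ) → ℂ} (hc : besov φ s p r c < ⊤) :
    ∑' j, ∫⁻ x in cube d, ‖block φ j c x‖ₑ ≠ ⊤ := by
  have h : ∀ j, ∫⁻ x in cube d, ‖block φ j c x‖ₑ ≤
      besov φ s p r c * if j < -1 then 0 else (2 : ℝ≥0∞) ^ (-((j : ℝ) * s)) := fun j => by
    by_cases hj : j < -1
    · simp [hφ.block_of_lt hj]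
    · simp only [if_neg hj]
      refine (lintegral_block_le hφ hp j c).trans ?_
      have h1 := le_besov (φ := φ) s p hr c j
      rw [ENNReal.rpow_neg, ← div_eq_mul_inv, ENNReal.le_div_iff_mul_le (by simp) (by simp)]
      rwa [mul_comm]
  refine ne_of_lt (lt_of_le_of_lt (ENNReal.tsum_le_tsum h) ?_)
  rw [ENNReal.tsum_mul_left]
  exact ENNReal.mul_lt_top hc (tsum_two_rpow_lt_top hs)

end Reconstruction

section Sums

/-! ### Dyadic sums and the interaction of frequencies -/

theorem two_rpow_add (x y : ℝ) : (2 : ℝ≥0∞) ^ (x + y) = 2 ^ x * 2 ^ y :=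
  ENNReal.rpow_add _ _ two_ne_zero ENNReal.ofNat_ne_top

theorem tsum_geometric_two_lt_top {θ : ℝ} (hθ : 0 < θ) :
    ∑' n : ℕ, (2 : ℝ≥0∞) ^ (-((n : ℝ) * θ)) < ⊤ := by
  have h1 : ∀ n : ℕ, (2 : ℝ≥0∞) ^ (-((n : ℝ) * θ)) = ((2 : ℝ≥0∞) ^ (-θ)) ^ n := fun n => by
    rw [← ENNReal.rpow_natCast, ← ENNReal.rpow_mul]
    congr 1
    ring
  simp only [h1]
  rw [ENNReal.tsum_geometric]
  simp only [ENNReal.inv_lt_top, tsub_pos_iff_lt]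
  rw [ENNReal.rpow_neg]
  simpa using ENNReal.one_lt_rpow (by norm_num : (1 : ℝ≥0∞) < 2) hθ

theorem tsum_min_two_rpow_lt_top {θ : ℝ} (h0 : 0 < θ) (h1 : θ < 1) :
    ∑' i : ℤ, (2 : ℝ≥0∞) ^ (-((i : ℝ) * θ)) * min 1 (2 ^ (i : ℝ)) < ⊤ := by
  have hs := HasSum.of_nat_of_neg_add_one
    (f := fun i : ℤ => (2 : ℝ≥0∞) ^ (-((i : ℝ) * θ)) * min 1 (2 ^ (i : ℝ)))
    ENNReal.summable.hasSum ENNReal.summable.hasSum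
  rw [hs.tsum_eq]
  refine ENNReal.add_lt_top.2 ⟨?_, ?_⟩
  · refine lt_of_le_of_lt (ENNReal.tsum_le_tsum fun n => ?_) (tsum_geometric_two_lt_top h0)
    calc _ ≤ (2 : ℝ≥0∞) ^ (-(((n : ℤ) : ℝ) * θ)) * 1 := by gcongr; exact min_le_left _ _
      _ = _ := by simp
  · refine lt_of_le_of_lt (ENNReal.tsum_le_tsum fun n => ?_)
      (tsum_geometric_two_lt_top (sub_pos.2 h1))
    calc _ ≤ (2 : ℝ≥0∞) ^ (-(((-((n : ℤ) + 1) : ℤ) : ℝ) * θ)) * 2 ^ ((-((n : ℤ) + 1) : ℤ) : ℝ) := by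
          gcongr; exact min_le_right _ _
      _ = 2 ^ (-((n : ℝ) * (1 - θ)) + (-(1 - θ))) := by
          rw [← two_rpow_add]; congr 1; push_cast; ring
      _ ≤ _ := ENNReal.rpow_le_rpow_of_exponent_le one_le_two (by linarith)

/-- The sum is dominated, up to constants, by its terms with `2^j` close to `1 / ρ`. -/
theorem exists_tsum_min_le {θ : ℝ} (h0 : 0 < θ) (h1 : θ < 1) : ∃ C : ℝ≥0, ∀ ρ : ℝ≥0∞, ρ ≠ ⊤ →
    ∑' j : ℤ, (2 : ℝ≥0∞) ^ (-((j : ℝ) * θ)) * min 1 (2 ^ (j : ℝ) * ρ) ≤ C * ρ ^ θ := by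
  set K := ∑' i : ℤ, (2 : ℝ≥0∞) ^ (-((i : ℝ) * θ)) * min 1 (2 ^ (i : ℝ)) with hK
  have hKt : K < ⊤ := tsum_min_two_rpow_lt_top h0 h1
  refine ⟨2 * K.toNNReal, fun ρ hρ => ?_⟩
  by_cases hρ0 : ρ = 0
  · simp [hρ0]
  -- With `2^n ≤ ρ < 2^{n+1}`, shifting the index by `n` reduces to `ρ = 1`.
  obtain ⟨n, hn1, hn2⟩ := ENNReal.exists_mem_Ico_zpow hρ0 hρ
    (by norm_num : (1 : ℝ≥0∞) < 2) ENNReal.ofNat_ne_top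
  rw [← ENNReal.rpow_intCast] at hn1 hn2
  rw [← (Equiv.subRight n).tsum_eq]
  have h2 : ∀ i : ℤ, (2 : ℝ≥0∞) ^ (-(((Equiv.subRight n i : ℤ) : ℝ) * θ)) *
      min 1 (2 ^ ((Equiv.subRight n i : ℤ) : ℝ) * ρ) ≤
      2 * ρ ^ θ * ((2 : ℝ≥0∞) ^ (-((i : ℝ) * θ)) * min 1 (2 ^ (i : ℝ))) := fun i => by
    rw [Equiv.subRight_apply]
    have e1 : (2 : ℝ≥0∞) ^ (-(((i - n : ℤ) : ℝ) * θ)) ≤ ρ ^ θ * 2 ^ (-((i : ℝ) * θ)) := by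
      rw [show -(((i - n : ℤ) : ℝ) * θ) = n * θ + -(i * θ) by push_cast; ring, two_rpow_add,
        ENNReal.rpow_mul]
      gcongr
    have e2 : (2 : ℝ≥0∞) ^ ((i - n : ℤ) : ℝ) * ρ ≤ 2 * 2 ^ (i : ℝ) := by
      calc _ ≤ (2 : ℝ≥0∞) ^ ((i - n : ℤ) : ℝ) * 2 ^ ((n + 1 : ℤ) : ℝ) := by gcongr
        _ = 2 ^ ((1 : ℝ) + i) := by rw [← two_rpow_add]; congr 1; push_cast; ring
        _ = _ := by rw [two_rpow_add, ENNReal.rpow_one]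
    have e3 : min 1 ((2 : ℝ≥0∞) ^ ((i - n : ℤ) : ℝ) * ρ) ≤ 2 * min 1 (2 ^ (i : ℝ)) := by
      rcases min_choice 1 ((2 : ℝ≥0∞) ^ (i : ℝ)) with e | e <;> rw [e]
      · exact (min_le_left _ _).trans (by norm_num)
      · exact (min_le_right _ _).trans e2
    calc _ ≤ (ρ ^ θ * 2 ^ (-((i : ℝ) * θ))) * (2 * min 1 (2 ^ (i : ℝ))) := mul_le_mul' e1 e3
      _ = _ := by ring
  refine (ENNReal.tsum_le_tsum h2).trans (le_of_eq ?_)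
  rw [ENNReal.tsum_mul_left, ← hK]
  push_cast
  rw [ENNReal.coe_toNNReal hKt.ne]
  ring

variable {d : ℕ}

theorem volume_ball_two_rpow (n : ℝ) : volume {h : Sp d | ‖h‖ₑ < 2 ^ n} =
    2 ^ (n * d) * volume (Metric.ball (0 : Sp d) 1) := by
  have h1 : {h : Sp d | ‖h‖ₑ < 2 ^ n} = Metric.ball 0 ((2 : ℝ) ^ n) := by
    ext h
    rw [mem_ball_zero_iff, Set.mem_ofPred_eq, ← ofReal_norm,
      show (2 : ℝ≥0∞) ^ n = ENNReal.ofReal (2 ^ n) by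
        rw [← ENNReal.ofReal_rpow_of_pos two_pos]; simp,
      ENNReal.ofReal_lt_ofReal_iff (by positivity)]
  rw [h1, Measure.addHaar_ball_of_pos _ _ (by positivity), finrank_euclideanSpace_fin,
    ← Real.rpow_natCast, ← Real.rpow_mul two_pos.le, ← ENNReal.ofReal_rpow_of_pos two_pos,
    ENNReal.ofReal_ofNat]

/-- The singular integral `∫ |h|^{-d-θ} min(1, 2^m |h|) dh` scales like `2^{mθ}`. -/
theorem exists_lintegral_min_le (d : ℕ) {θ : ℝ} (h0 : 0 < θ) (h1 : θ < 1) :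
    ∃ C : ℝ≥0, ∀ m : ℤ,
      ∫⁻ h : Sp d, ‖h‖ₑ ^ (-(d + θ)) * min 1 (2 ^ (m : ℝ) * ‖h‖ₑ) ≤ C * 2 ^ ((m : ℝ) * θ) := by
  obtain ⟨C, hC⟩ := exists_tsum_min_le h0 h1
  set ω := volume (Metric.ball (0 : Sp d) 1)
  have hω : ω < ⊤ := measure_ball_lt_top
  refine ⟨C * 2 ^ (d + θ) * ω.toNNReal, fun m => ?_⟩
  set S : ℤ → Set (Sp d) := fun n => {h | (2 : ℝ≥0∞) ^ (n : ℝ) ≤ ‖h‖ₑ ∧ ‖h‖ₑ < 2 ^ ((n : ℝ) + 1)}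
  have hSm : ∀ n, MeasurableSet (S n) := fun n =>
    (measurableSet_le measurable_const measurable_enorm).inter
      (measurableSet_lt measurable_enorm measurable_const)
  have hcov : ∀ h : Sp d, h ≠ 0 → h ∈ ⋃ n, S n := fun h hh => by
    obtain ⟨n, hn1, hn2⟩ := ENNReal.exists_mem_Ico_zpow (x := ‖h‖ₑ) (by simpa using hh) (by simp)
      (by norm_num : (1 : ℝ≥0∞) < 2) ENNReal.ofNat_ne_top
    rw [← ENNReal.rpow_intCast] at hn1 hn2
    exact mem_iUnion.2 ⟨n, hn1, by push_cast at hn2; exact hn2⟩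
  set F : Sp d → ℝ≥0∞ := fun h => ‖h‖ₑ ^ (-(d + θ)) * min 1 (2 ^ (m : ℝ) * ‖h‖ₑ)
  have hF0 : Function.support F ⊆ ⋃ n, S n := fun h hh => hcov h fun h0 => hh (by simp [F, h0])
  have hpiece : ∀ n : ℤ, ∫⁻ h in S n, F h ≤
      2 ^ (d : ℝ) * ω * (2 ^ (-((n : ℝ) * θ)) * min 1 (2 ^ (n : ℝ) * 2 ^ ((m : ℝ) + 1))) := fun n => by
    calc ∫⁻ h in S n, F h
        ≤ ∫⁻ h in S n, 2 ^ (-((n : ℝ) * (d + θ))) * min 1 (2 ^ (n : ℝ) * 2 ^ ((m : ℝ) + 1)) := by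
          refine setLIntegral_mono' (hSm n) fun h hh => ?_
          refine mul_le_mul' ?_ (min_le_min le_rfl ?_)
          · rw [ENNReal.rpow_neg, ENNReal.rpow_neg, ENNReal.rpow_mul]
            exact ENNReal.inv_le_inv.2 (ENNReal.rpow_le_rpow hh.1 (by positivity))
          · calc _ ≤ (2 : ℝ≥0∞) ^ (m : ℝ) * 2 ^ ((n : ℝ) + 1) := by gcongr; exact hh.2.le
              _ = _ := by rw [← two_rpow_add, ← two_rpow_add]; congr 1; ring
      _ ≤ 2 ^ (-((n : ℝ) * (d + θ))) * min 1 (2 ^ (n : ℝ) * 2 ^ ((m : ℝ) + 1)) *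
          (2 ^ (((n : ℝ) + 1) * d) * ω) := by
          rw [setLIntegral_const, ← volume_ball_two_rpow]
          gcongr
          exact fun h hh => hh.2
      _ = (2 ^ (-((n : ℝ) * (d + θ))) * 2 ^ (((n : ℝ) + 1) * d)) * ω *
          min 1 (2 ^ (n : ℝ) * 2 ^ ((m : ℝ) + 1)) := by ring
      _ = _ := by
          rw [← two_rpow_add, show -((n : ℝ) * (d + θ)) + ((n : ℝ) + 1) * d = d + -(n * θ) by ring,
            two_rpow_add]
          ring
  calc ∫⁻ h, F h = ∫⁻ h in ⋃ n, S n, F h := (setLIntegral_eq_of_support_subset hF0).symm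
    _ ≤ ∑' n, ∫⁻ h in S n, F h := lintegral_iUnion_le _ _
    _ ≤ _ := ENNReal.tsum_le_tsum hpiece
    _ ≤ 2 ^ (d : ℝ) * ω * (C * (2 ^ ((m : ℝ) + 1)) ^ θ) := by
        rw [ENNReal.tsum_mul_left]
        gcongr
        exact hC _ (by simp)
    _ = _ := by
        push_cast
        rw [ENNReal.coe_toNNReal hω.ne, ← ENNReal.rpow_mul, add_mul, one_mul, two_rpow_add,
          ENNReal.coe_rpow_of_nonneg _ (by positivity), ENNReal.coe_ofNat, two_rpow_add]
        ring

/-- The interaction of the frequencies `2^j` and `2^m` in the bilinear form with kernel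
`|h|^{-d-s}`. -/
def interaction (d : ℕ) (s : ℝ) (j m : ℤ) : ℝ≥0∞ :=
  ∫⁻ h : Sp d, ‖h‖ₑ ^ (-(d + s)) * (min 1 (2 ^ (j : ℝ) * ‖h‖ₑ) * min 1 (2 ^ (m : ℝ) * ‖h‖ₑ))

theorem interaction_comm (d : ℕ) (s : ℝ) (j m : ℤ) : interaction d s j m = interaction d s m j := by
  refine lintegral_congr fun h => ?_
  rw [mul_comm (min 1 (2 ^ (j : ℝ) * ‖h‖ₑ))]

/-- The row sums for Schur's test: the sum over `j` under the integral sign turns the factor `min 1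
(2^j ‖h‖)` into `‖h‖ ^ a`, and the remaining integral scales like `2^{mb}`. -/
theorem exists_tsum_interaction_le (d : ℕ) {a b : ℝ} (ha : 0 < a) (ha' : a < 1) (hb : 0 < b)
    (hb' : b < 1) : ∃ Q : ℝ≥0, ∀ m : ℤ,
      ∑' j : ℤ, (2 : ℝ≥0∞) ^ (-((j : ℝ) * a)) * 2 ^ (-((m : ℝ) * b)) * interaction d (a + b) j m ≤
        Q := by
  obtain ⟨C₁, h₁⟩ := exists_tsum_min_le ha ha'
  obtain ⟨C₂, h₂⟩ := exists_lintegral_min_le d hb hb'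
  refine ⟨C₁ * C₂, fun m => ?_⟩
  have hm : ∀ j : ℤ, Measurable fun h : Sp d => (2 : ℝ≥0∞) ^ (-((j : ℝ) * a)) *
      (‖h‖ₑ ^ (-(d + (a + b))) * (min 1 (2 ^ (j : ℝ) * ‖h‖ₑ) * min 1 (2 ^ (m : ℝ) * ‖h‖ₑ))) := by
    intro j; fun_prop
  calc _ = 2 ^ (-((m : ℝ) * b)) * ∫⁻ h : Sp d, ∑' j : ℤ, (2 : ℝ≥0∞) ^ (-((j : ℝ) * a)) *
      (‖h‖ₑ ^ (-(d + (a + b))) * (min 1 (2 ^ (j : ℝ) * ‖h‖ₑ) * min 1 (2 ^ (m : ℝ) * ‖h‖ₑ))) := by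
        rw [lintegral_tsum fun j => (hm j).aemeasurable, ← ENNReal.tsum_mul_left]
        refine tsum_congr fun j => ?_
        rw [lintegral_const_mul' _ _ (by simp), interaction]
        ring
    _ ≤ 2 ^ (-((m : ℝ) * b)) * ∫⁻ h : Sp d, C₁ *
        (‖h‖ₑ ^ (-(d + b)) * min 1 (2 ^ (m : ℝ) * ‖h‖ₑ)) := by
        gcongr with h
        by_cases hh : h = 0
        · simp [hh]
        calc _ = ‖h‖ₑ ^ (-(d + (a + b))) * min 1 (2 ^ (m : ℝ) * ‖h‖ₑ) *
              ∑' j : ℤ, (2 : ℝ≥0∞) ^ (-((j : ℝ) * a)) * min 1 (2 ^ (j : ℝ) * ‖h‖ₑ) := by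
              rw [← ENNReal.tsum_mul_left]
              exact tsum_congr fun j => by ring
          _ ≤ ‖h‖ₑ ^ (-(d + (a + b))) * min 1 (2 ^ (m : ℝ) * ‖h‖ₑ) * (C₁ * ‖h‖ₑ ^ a) := by
              gcongr
              exact h₁ _ (by simp)
          _ = C₁ * (‖h‖ₑ ^ (-(d + (a + b))) * ‖h‖ₑ ^ a * min 1 (2 ^ (m : ℝ) * ‖h‖ₑ)) := by ring
          _ = _ := by
              rw [← ENNReal.rpow_add _ _ (by simpa using hh) (by simp)]
              congr 4
              ring
    _ ≤ 2 ^ (-((m : ℝ) * b)) * (C₁ * (C₂ * 2 ^ ((m : ℝ) * b))) := by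
        rw [lintegral_const_mul' _ _ (by simp)]
        gcongr
        exact h₂ m
    _ = C₁ * C₂ * (2 ^ (-((m : ℝ) * b)) * 2 ^ ((m : ℝ) * b)) := by ring
    _ = _ := by rw [← two_rpow_add, neg_add_cancel]; simp

/-- Estimates of the blocks of `c'` by those of `c` through the interaction of frequencies give an
estimate of Besov norms. -/
theorem exists_besov_le_of_interaction (φ : Sp d → ℝ) {a b : ℝ} (ha : 0 < a) (ha' : a < 1)
    (hb : 0 < b) (hb' : b < 1) : ∃ Q : ℝ≥0, ∀ (p r : ℝ≥0∞), 1 ≤ r →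
      ∀ (K : ℝ≥0) (c c' : (Fin d → ℤ) → ℂ),
      (∀ j, eLpNorm (block φ j c') p (volume.restrict (cube d)) ≤ K *
        ∑' m, interaction d (a + b) j m * eLpNorm (block φ m c) p (volume.restrict (cube d))) →
      besov φ (-a) p r c' ≤ Q * K * besov φ b p r c := by
  obtain ⟨Q₁, h₁⟩ := exists_tsum_interaction_le d ha ha' hb hb'
  obtain ⟨Q₂, h₂⟩ := exists_tsum_interaction_le d hb hb' ha ha'
  refine ⟨Q₁ + Q₂, fun p r hr K c c' h => ?_⟩
  set A : ℤ → ℤ → ℝ≥0∞ := fun j m =>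
    (2 : ℝ≥0∞) ^ (-((j : ℝ) * a)) * 2 ^ (-((m : ℝ) * b)) * interaction d (a + b) j m with hA
  have hA1 : ∀ j, ∑' m, A j m ≤ Q₁ + Q₂ := fun j => by
    refine le_trans (le_of_eq ?_) ((h₂ j).trans le_add_self)
    refine tsum_congr fun m => ?_
    rw [hA, interaction_comm, add_comm b a]
    ring
  have hA2 : ∀ m, ∑' j, A j m ≤ Q₁ + Q₂ := fun m => (h₁ m).trans le_self_add
  set T : ℤ → ℝ≥0∞ := fun m => 2 ^ ((m : ℝ) * b) *
    eLpNorm (block φ m c) p (volume.restrict (cube d)) with hT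
  have hj : ∀ j : ℤ, (2 : ℝ≥0∞) ^ ((j : ℝ) * -a) *
      eLpNorm (block φ j c') p (volume.restrict (cube d)) ≤ K * ∑' m, A j m * T m := fun j => by
    calc _ ≤ (2 : ℝ≥0∞) ^ ((j : ℝ) * -a) * (K * ∑' m, interaction d (a + b) j m *
          eLpNorm (block φ m c) p (volume.restrict (cube d))) := by gcongr; exact h j
      _ = K * ∑' m, (2 : ℝ≥0∞) ^ ((j : ℝ) * -a) * (interaction d (a + b) j m *
          eLpNorm (block φ m c) p (volume.restrict (cube d))) := by
          rw [ENNReal.tsum_mul_left]; ring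
      _ = _ := by
          congr 1
          refine tsum_congr fun m => ?_
          have : (2 : ℝ≥0∞) ^ (-((m : ℝ) * b)) * 2 ^ ((m : ℝ) * b) = 1 := by
            rw [← two_rpow_add, neg_add_cancel, ENNReal.rpow_zero]
          simp only [hA, hT]
          calc _ = (2 : ℝ≥0∞) ^ ((j : ℝ) * -a) * interaction d (a + b) j m *
                eLpNorm (block φ m c) p (volume.restrict (cube d)) * 1 := by ring
            _ = _ := by rw [← this, mul_neg]; ring
  unfold besov
  split_ifs with hr'
  · refine iSup_le fun j => (hj j).trans ?_
    calc _ ≤ (K : ℝ≥0∞) * ∑' m, A j m * ⨆ m, T m := by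
          gcongr with m; exact le_iSup T m
      _ ≤ (K : ℝ≥0∞) * ((Q₁ + Q₂) * ⨆ m, T m) := by
          rw [ENNReal.tsum_mul_right]; gcongr; exact hA1 j
      _ = _ := by push_cast; ring
  · have hr1 : 1 ≤ r.toReal := by simpa using ENNReal.toReal_mono hr' hr
    calc _ ≤ (∑' j, (∑' m, A j m * (K * T m)) ^ r.toReal) ^ (1 / r.toReal) := by
          gcongr with j
          refine (hj j).trans (le_of_eq ?_)
          rw [← ENNReal.tsum_mul_left]
          exact tsum_congr fun m => by ring
      _ ≤ (Q₁ + Q₂) * (∑' m, (K * T m) ^ r.toReal) ^ (1 / r.toReal) :=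
          tsum_schur_le hA1 hA2 _ hr1
      _ = _ := by
          have hr0 : 0 < r.toReal := by linarith
          simp only [ENNReal.mul_rpow_of_nonneg _ _ hr0.le]
          rw [ENNReal.tsum_mul_left, ENNReal.mul_rpow_of_nonneg _ _ (by positivity),
            ← ENNReal.rpow_mul, mul_one_div, div_self hr0.ne', ENNReal.rpow_one]
          simp only [hT, ENNReal.mul_rpow_of_nonneg _ _ hr0.le]
          push_cast
          ring

end Sums

section Form

/-! ### The bilinear form of a singular kernel -/

variable {d : ℕ} {φ : Sp d → ℝ}

/-- A symmetric kernel on `ℝ^d × ℝ^d` that is periodic in the diagonal direction, with a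
singularity of order `σ` on the diagonal. -/
structure IsSingularKernel (σ : ℝ) (A : ℝ≥0) (κ : Sp d → Sp d → ℝ) : Prop where
  meas : Measurable (Function.uncurry κ)
  symm : ∀ y z, κ y z = κ z y
  diag : ∀ (k : Fin d → ℤ) y z, κ (y + lat k) (z + lat k) = κ y z
  bound : ∀ y z, ‖κ y z‖ₑ ≤ A * ‖y - z‖ₑ ^ (-σ)

/-- Integration over `y` in the torus and `z` in `ℝ^d`. -/
def pairMeasure (d : ℕ) : Measure (Sp d × Sp d) := (volume.restrict (cube d)).prod volume

/-- The integrand of the bilinear form of the kernel `κ`. -/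
def formIntegrand (κ : Sp d → Sp d → ℝ) (w f : Sp d → ℂ) (q : Sp d × Sp d) : ℂ :=
  (f q.1 - f q.2) * (w q.1 - w q.2) * (κ q.1 q.2 : ℂ)

/-- The bilinear form of the kernel `κ`. It is twice the pairing of the principal value operator
of kernel `κ`, applied to `w`, with `f`. -/
def form (κ : Sp d → Sp d → ℝ) (w f : Sp d → ℂ) : ℂ := ∫ q, formIntegrand κ w f q ∂pairMeasure d

/-- The form with absolute values everywhere and kernel `|y - z|^{-σ}`, in the variables `y` and
`h = z - y`. -/
def absForm (σ : ℝ) (w f : Sp d → ℂ) : ℝ≥0∞ :=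
  ∫⁻ h, ‖h‖ₑ ^ (-σ) * ∫⁻ y in cube d, ‖f (y + h) - f y‖ₑ * ‖w (y + h) - w y‖ₑ

theorem lintegral_pairMeasure {F : Sp d × Sp d → ℝ≥0∞} (hF : Measurable F) :
    ∫⁻ q, F q ∂pairMeasure d = ∫⁻ h, ∫⁻ y in cube d, F (y, y + h) := by
  have hm : Measurable (Function.uncurry fun h y => F (y, y + h)) :=
    hF.comp (measurable_snd.prodMk (measurable_snd.add measurable_fst))
  rw [pairMeasure, lintegral_prod _ hF.aemeasurable, lintegral_lintegral_swap hm.aemeasurable]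
  exact lintegral_congr fun y => (lintegral_add_left_eq_self (fun z => F (y, z)) y).symm

theorem IsSingularKernel.measurable_formIntegrand {σ : ℝ} {A : ℝ≥0} {κ : Sp d → Sp d → ℝ}
    (hκ : IsSingularKernel σ A κ) {w f : Sp d → ℂ} (hw : Measurable w) (hf : Measurable f) :
    Measurable (formIntegrand κ w f) := by
  unfold formIntegrand
  have : Measurable fun q : Sp d × Sp d => (κ q.1 q.2 : ℂ) :=
    Complex.measurable_ofReal.comp hκ.meas
  fun_prop

theorem IsSingularKernel.lintegral_formIntegrand_le {σ : ℝ} {A : ℝ≥0} {κ : Sp d → Sp d → ℝ}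
    (hκ : IsSingularKernel σ A κ) {w f : Sp d → ℂ} (hw : Measurable w) (hf : Measurable f) :
    ∫⁻ q, ‖formIntegrand κ w f q‖ₑ ∂pairMeasure d ≤ A * absForm σ w f := by
  rw [lintegral_pairMeasure (hκ.measurable_formIntegrand hw hf).enorm, absForm,
    ← lintegral_const_mul' _ _ ENNReal.coe_ne_top]
  refine lintegral_mono fun h => ?_
  have hm : Measurable fun y => ‖f (y + h) - f y‖ₑ * ‖w (y + h) - w y‖ₑ := by fun_prop
  rw [← mul_assoc, ← lintegral_const_mul _ hm]
  refine lintegral_mono fun y => ?_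
  simp only [formIntegrand]
  rw [enorm_mul, enorm_mul, enorm_sub_rev (f y), enorm_sub_rev (w y), mul_comm]
  gcongr
  have := hκ.bound y (y + h)
  rw [sub_add_cancel_left, enorm_neg] at this
  rwa [← ofReal_norm, Complex.norm_real, ofReal_norm]

theorem IsSingularKernel.integrable_formIntegrand {σ : ℝ} {A : ℝ≥0} {κ : Sp d → Sp d → ℝ}
    (hκ : IsSingularKernel σ A κ) {w f : Sp d → ℂ} (hw : Measurable w) (hf : Measurable f)
    (h : absForm σ w f ≠ ⊤) : Integrable (formIntegrand κ w f) (pairMeasure d) :=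
  ⟨(hκ.measurable_formIntegrand hw hf).aestronglyMeasurable,
    (hκ.lintegral_formIntegrand_le hw hf).trans_lt
      (ENNReal.mul_lt_top ENNReal.coe_lt_top h.lt_top)⟩

theorem IsSingularKernel.enorm_form_le {σ : ℝ} {A : ℝ≥0} {κ : Sp d → Sp d → ℝ}
    (hκ : IsSingularKernel σ A κ) {w f : Sp d → ℂ} (hw : Measurable w) (hf : Measurable f) :
    ‖form κ w f‖ₑ ≤ A * absForm σ w f :=
  (enorm_integral_le_lintegral_enorm _).trans (hκ.lintegral_formIntegrand_le hw hf)

/-- The sum of the blocks of a distribution, which is a representative of it as soon as the sum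
converges in `L^1`. -/
def blockSum (φ : Sp d → ℝ) (c : (Fin d → ℤ) → ℂ) (x : Sp d) : ℂ := c 0 + ∑' j : ℤ, block φ j c x

theorem periodic_blockSum (φ : Sp d → ℝ) (c : (Fin d → ℤ) → ℂ) : Periodic (blockSum φ c) :=
  fun k x => by simp only [blockSum, periodic_block _ _ k x]

theorem measurable_blockSum (hφ : IsCutoff φ) (c : (Fin d → ℤ) → ℂ) :
    Measurable (blockSum φ c) :=
  measurable_const.add (Measurable.tsum fun j => (continuous_block hφ j c).measurable)

theorem ae_enorm_blockSum_add_sub_le (hφ : IsCutoff φ) {c : (Fin d → ℤ) → ℂ}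
    (hs : ∑' j, ∫⁻ x in cube d, ‖block φ j c x‖ₑ ≠ ⊤) (h : Sp d) :
    ∀ᵐ y ∂(volume.restrict (cube d)), ‖blockSum φ c (y + h) - blockSum φ c y‖ₑ ≤
      ∑' j, ‖block φ j c (y + h) - block φ j c y‖ₑ := by
  have hm : ∀ j, Measurable fun x => ‖block φ j c x‖ₑ := fun j =>
    (continuous_block hφ j c).measurable.enorm
  rw [← lintegral_tsum fun j => (hm j).aemeasurable] at hs
  have hp : Periodic fun x => ∑' j, ‖block φ j c x‖ₑ := fun k x => by
    simp only [periodic_block _ _ k x]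
  have hs' := hs
  rw [← setLIntegral_cube_add hp h] at hs'
  have hM : Measurable fun x => ∑' j, ‖block φ j c x‖ₑ := Measurable.tsum hm
  filter_upwards [ae_lt_top hM hs, ae_lt_top (hM.comp (measurable_add_const h)) hs']
    with y h1 h2
  have hsum : ∀ z, ∑' j, ‖block φ j c z‖ₑ < ⊤ → Summable fun j => block φ j c z := fun z hz => by
    refine Summable.of_norm ?_
    refine (ENNReal.summable_toReal hz.ne).congr fun j => ?_
    simp
  rw [blockSum, blockSum, add_sub_add_left_eq_sub, ← (hsum _ h2).tsum_sub (hsum _ h1)]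
  exact enorm_tsum_le_tsum_enorm

theorem lintegral_mul_blockSum_add_sub_le (hφ : IsCutoff φ) {c : (Fin d → ℤ) → ℂ}
    (hs : ∑' j, ∫⁻ x in cube d, ‖block φ j c x‖ₑ ≠ ⊤) (h : Sp d) {F : Sp d → ℝ≥0∞}
    (hF : Measurable F) :
    ∫⁻ y in cube d, F y * ‖blockSum φ c (y + h) - blockSum φ c y‖ₑ ≤
      ∑' j, ∫⁻ y in cube d, F y * ‖block φ j c (y + h) - block φ j c y‖ₑ := by
  rw [← lintegral_tsum]
  · refine lintegral_mono_ae ?_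
    filter_upwards [ae_enorm_blockSum_add_sub_le hφ hs h] with y hy
    rw [ENNReal.tsum_mul_left]
    gcongr
  · intro j
    have := (continuous_block hφ j c).measurable
    exact AEMeasurable.mul hF.aemeasurable (by fun_prop)

/-- The form is finite, with a bound by the Lipschitz norm of `f`. The regularity `b` is lowered a
little for the sake of summability. -/
theorem exists_absForm_blockSum_le (hφ : IsCutoff φ) {a b : ℝ} (ha : 0 < a) (ha' : a < 1)
    (hb : 0 < b) (hb' : b < 1) {p r : ℝ≥0∞} (hp : 1 ≤ p) (hr : 1 ≤ r) {c : (Fin d → ℤ) → ℂ}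
    (hc : besov φ b p r c < ⊤) : ∃ Q : ℝ≥0, ∀ (f : Sp d → ℂ) (M : ℝ≥0), Continuous f →
      (∀ x, ‖f x‖ₑ ≤ M) → LipschitzWith M f → absForm (d + (a + b)) (blockSum φ c) f ≤ Q * M := by
  obtain ⟨C, hC⟩ := exists_eLpNorm_block_add_sub_le hφ
  set ε := min ((1 - a) / 2) (b / 2) with hε
  have hε0 : 0 < ε := lt_min (by linarith) (by linarith)
  have hε1 : ε ≤ (1 - a) / 2 := min_le_left _ _
  have hε2 : ε ≤ b / 2 := min_le_right _ _
  obtain ⟨Q, hQ⟩ := exists_tsum_interaction_le d (a := a + ε) (b := b - ε) (by linarith)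
    (by linarith) (by linarith) (by linarith)
  have hint : ∀ m : ℤ, interaction d (a + b) 0 m ≤ Q * 2 ^ ((m : ℝ) * (b - ε)) := fun m => by
    have h1 := (ENNReal.le_tsum (0 : ℤ)).trans (hQ m)
    rw [Int.cast_zero, zero_mul, neg_zero, ENNReal.rpow_zero, one_mul,
      show a + ε + (b - ε) = a + b by ring] at h1
    calc interaction d (a + b) 0 m = 2 ^ ((m : ℝ) * (b - ε)) *
          (2 ^ (-((m : ℝ) * (b - ε))) * interaction d (a + b) 0 m) := by
          rw [← mul_assoc, ← two_rpow_add, add_neg_cancel, ENNReal.rpow_zero, one_mul]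
      _ ≤ 2 ^ ((m : ℝ) * (b - ε)) * Q := by gcongr
      _ = _ := mul_comm _ _
  have hs := tsum_lintegral_block_ne_top hφ hb hp hr hc
  have hblock : ∀ m : ℤ, interaction d (a + b) 0 m * ∫⁻ x in cube d, ‖block φ m c x‖ₑ ≤
      Q * besov φ b p r c * if m < -1 then 0 else (2 : ℝ≥0∞) ^ (-((m : ℝ) * ε)) := fun m => by
    by_cases hm : m < -1
    · simp [hφ.block_of_lt hm]
    · rw [if_neg hm]
      calc _ ≤ Q * 2 ^ ((m : ℝ) * (b - ε)) *
            eLpNorm (block φ m c) p (volume.restrict (cube d)) :=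
            mul_le_mul' (hint m) (lintegral_block_le hφ hp m c)
        _ = Q * 2 ^ (-((m : ℝ) * ε)) * (2 ^ ((m : ℝ) * b) *
            eLpNorm (block φ m c) p (volume.restrict (cube d))) := by
            rw [show (m : ℝ) * (b - ε) = -(m * ε) + m * b by ring, two_rpow_add]; ring
        _ ≤ Q * 2 ^ (-((m : ℝ) * ε)) * besov φ b p r c := by
            gcongr; exact le_besov b p hr c m
        _ = _ := by ring
  set R : ℝ≥0∞ := 2 * C * (Q * besov φ b p r c *
    ∑' m : ℤ, if m < -1 then 0 else (2 : ℝ≥0∞) ^ (-((m : ℝ) * ε))) with hR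
  have hRt : R ≠ ⊤ := by
    refine ENNReal.mul_ne_top (ENNReal.mul_ne_top (by simp) (by simp)) ?_
    exact ENNReal.mul_ne_top (ENNReal.mul_ne_top (by simp) hc.ne) (tsum_two_rpow_lt_top hε0).ne
  refine ⟨R.toNNReal, fun f M hf hfM hfL => ?_⟩
  rw [ENNReal.coe_toNNReal hRt]
  have hfh : ∀ y h, ‖f (y + h) - f y‖ₑ ≤ 2 * M * min 1 (2 ^ ((0 : ℤ) : ℝ) * ‖h‖ₑ) := fun y h => by
    rw [Int.cast_zero, ENNReal.rpow_zero, one_mul]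
    rcases min_choice 1 ‖h‖ₑ with e | e <;> rw [e]
    · calc _ ≤ ‖f (y + h)‖ₑ + ‖f y‖ₑ := enorm_sub_le
        _ ≤ M + M := add_le_add (hfM _) (hfM _)
        _ = _ := by ring
    · have := hfL (y + h) y
      rw [edist_eq_enorm_sub, edist_eq_enorm_sub, add_sub_cancel_left] at this
      refine this.trans ?_
      gcongr
      exact le_mul_of_one_le_left' one_le_two
  calc absForm (d + (a + b)) (blockSum φ c) f
      ≤ ∫⁻ h : Sp d, ∑' m : ℤ, (2 * M * C * ∫⁻ x in cube d, ‖block φ m c x‖ₑ) *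
        (‖h‖ₑ ^ (-(d + (a + b))) *
          (min 1 (2 ^ ((0 : ℤ) : ℝ) * ‖h‖ₑ) * min 1 (2 ^ (m : ℝ) * ‖h‖ₑ))) := by
        refine lintegral_mono fun h => ?_
        have hm : Measurable fun y => ‖f (y + h) - f y‖ₑ := by fun_prop
        have e1 := lintegral_mul_blockSum_add_sub_le hφ hs h hm
        refine (mul_le_mul' le_rfl e1).trans ?_
        rw [← ENNReal.tsum_mul_left]
        refine ENNReal.tsum_le_tsum fun m => ?_
        have e2 : ∫⁻ y in cube d, ‖f (y + h) - f y‖ₑ * ‖block φ m c (y + h) - block φ m c y‖ₑ ≤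
            2 * M * min 1 (2 ^ ((0 : ℤ) : ℝ) * ‖h‖ₑ) * (C * min 1 (2 ^ (m : ℝ) * ‖h‖ₑ) *
              ∫⁻ x in cube d, ‖block φ m c x‖ₑ) := by
          have hmb : Measurable (block φ m c) := (continuous_block hφ m c).measurable
          calc _ ≤ ∫⁻ y in cube d, (2 * M * min 1 (2 ^ ((0 : ℤ) : ℝ) * ‖h‖ₑ)) *
                ‖block φ m c (y + h) - block φ m c y‖ₑ := by
                gcongr with y; exact hfh y h
            _ ≤ _ := by
                rw [lintegral_const_mul _ (by fun_prop), ← eLpNorm_one_eq_lintegral_enorm,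
                  ← eLpNorm_one_eq_lintegral_enorm]
                gcongr
                exact hC 1 le_rfl m c h
        refine (mul_le_mul' le_rfl e2).trans (le_of_eq ?_)
        ring
    _ = ∑' m : ℤ, 2 * C * M * (interaction d (a + b) 0 m * ∫⁻ x in cube d, ‖block φ m c x‖ₑ) := by
        rw [lintegral_tsum fun m => by fun_prop]
        refine tsum_congr fun m => ?_
        rw [lintegral_const_mul _ (by fun_prop), interaction]
        ring
    _ ≤ ∑' m : ℤ, 2 * C * M * (Q * besov φ b p r c *
          if m < -1 then 0 else (2 : ℝ≥0∞) ^ (-((m : ℝ) * ε))) :=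
        ENNReal.tsum_le_tsum fun m => mul_le_mul' le_rfl (hblock m)
    _ = _ := by
        rw [ENNReal.tsum_mul_left, ENNReal.tsum_mul_left, hR]
        ring

end Form

section Operator

/-! ### The operator of a singular kernel -/

variable {d : ℕ} {φ : Sp d → ℝ}

theorem form_add {σ : ℝ} {A : ℝ≥0} {κ : Sp d → Sp d → ℝ} (hκ : IsSingularKernel σ A κ)
    {w f g : Sp d → ℂ} (hw : Measurable w) (hf : Measurable f) (hg : Measurable g)
    (hf' : absForm σ w f ≠ ⊤) (hg' : absForm σ w g ≠ ⊤) :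
    form κ w (f + g) = form κ w f + form κ w g := by
  rw [form, form, form, ← integral_add (hκ.integrable_formIntegrand hw hf hf')
    (hκ.integrable_formIntegrand hw hg hg')]
  refine integral_congr_ae (.of_forall fun q => ?_)
  simp only [formIntegrand, Pi.add_apply]
  ring

theorem form_smul (κ : Sp d → Sp d → ℝ) (w f : Sp d → ℂ) (c : ℂ) :
    form κ w (c • f) = c * form κ w f := by
  rw [form, form, ← integral_const_mul]
  refine integral_congr_ae (.of_forall fun q => ?_)
  simp only [formIntegrand, Pi.smul_apply, smul_eq_mul]
  ring

theorem form_kernel_sub {σ : ℝ} {A₁ A₂ : ℝ≥0} {κ₁ κ₂ : Sp d → Sp d → ℝ}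
    (h₁ : IsSingularKernel σ A₁ κ₁) (h₂ : IsSingularKernel σ A₂ κ₂)
    {w f : Sp d → ℂ} (hw : Measurable w) (hf : Measurable f) (hf' : absForm σ w f ≠ ⊤) :
    form (fun y z => κ₁ y z - κ₂ y z) w f = form κ₁ w f - form κ₂ w f := by
  rw [form, form, form, ← integral_sub (h₁.integrable_formIntegrand hw hf hf')
    (h₂.integrable_formIntegrand hw hf hf')]
  refine integral_congr_ae (.of_forall fun q => ?_)
  simp only [formIntegrand]
  push_cast
  ring

/-- The form is finite on test functions. -/
theorem absForm_blockSum_test_ne_top (hφ : IsCutoff φ) {a b : ℝ} (ha : 0 < a) (ha' : a < 1)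
    (hb : 0 < b) (hb' : b < 1) {p r : ℝ≥0∞} (hp : 1 ≤ p) (hr : 1 ≤ r) {c : (Fin d → ℤ) → ℂ}
    (hc : besov φ b p r c < ⊤) (f : Test d) :
    absForm (d + (a + b)) (blockSum φ c) (f : Sp d → ℂ) ≠ ⊤ := by
  obtain ⟨Q, hQ⟩ := exists_absForm_blockSum_le hφ ha ha' hb hb' hp hr hc
  obtain ⟨K, hK⟩ := Test.exists_lipschitzWith f
  obtain ⟨M, hM0, hM⟩ := f.2.2.exists_norm_le (Test.continuous f)
  lift M to ℝ≥0 using hM0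
  refine ((hQ f (max K M) (Test.continuous f) (fun x => ?_) (hK.weaken (le_max_left _ _))).trans_lt
    (by finiteness)).ne
  exact enorm_le_coe.2 ((hM x).trans (le_max_right _ _))

/-- The operator of a singular kernel, as a distribution. -/
theorem IsSingularKernel.exists_distr (hφ : IsCutoff φ) {a b : ℝ} (ha : 0 < a) (ha' : a < 1)
    (hb : 0 < b) (hb' : b < 1) {p r : ℝ≥0∞} (hp : 1 ≤ p) (hr : 1 ≤ r) {c : (Fin d → ℤ) → ℂ}
    (hc : besov φ b p r c < ⊤) {A : ℝ≥0} {κ : Sp d → Sp d → ℝ}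
    (hκ : IsSingularKernel (d + (a + b)) A κ) :
    ∃ g : Distr d, ∀ f : Test d, g.1 f = 1 / 2 * form κ (blockSum φ c) f := by
  have hw := measurable_blockSum hφ c
  have hfin := absForm_blockSum_test_ne_top hφ ha ha' hb hb' hp hr hc
  obtain ⟨Q, hQ⟩ := exists_absForm_blockSum_le hφ ha ha' hb hb' hp hr hc
  let L : Test d →ₗ[ℂ] ℂ :=
    { toFun := fun f => 1 / 2 * form κ (blockSum φ c) f
      map_add' := fun f g => by
        rw [Submodule.coe_add, form_add hκ hw (Test.continuous f).measurable
          (Test.continuous g).measurable (hfin f) (hfin g), mul_add]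
      map_smul' := fun r f => by
        rw [Submodule.coe_smul, form_smul, RingHom.id_apply, smul_eq_mul]
        ring }
  refine ⟨⟨L, 1, A * Q, by positivity, fun f M hM => ?_⟩, fun f => rfl⟩
  have hM0 : 0 ≤ M := (norm_nonneg _).trans (hM 0 (by norm_num) 0)
  lift M to ℝ≥0 using hM0
  have h1 : ∀ x, ‖(f : Sp d → ℂ) x‖ₑ ≤ M := fun x => by
    have := hM 0 (by norm_num) x
    rw [norm_iteratedFDeriv_zero] at this
    exact enorm_le_coe.2 this
  have h2 : LipschitzWith M (f : Sp d → ℂ) := by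
    refine lipschitzWith_of_nnnorm_fderiv_le (f.2.1.differentiable (by simp)) fun x => ?_
    have := hM 1 le_rfl x
    rwa [norm_iteratedFDeriv_one] at this
  have h3 : ‖form κ (blockSum φ c) f‖ₑ ≤ ((A * Q * M : ℝ≥0) : ℝ≥0∞) := by
    refine (hκ.enorm_form_le hw (Test.continuous f).measurable).trans ?_
    push_cast
    rw [mul_assoc]
    gcongr
    exact hQ f M (Test.continuous f) h1 h2
  have h4 : ‖form κ (blockSum φ c) f‖ ≤ A * Q * M := enorm_le_coe.1 h3
  calc ‖L f‖ = 1 / 2 * ‖form κ (blockSum φ c) f‖ := by simp [L]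
    _ ≤ ‖form κ (blockSum φ c) f‖ := by linarith [norm_nonneg (form κ (blockSum φ c) f)]
    _ ≤ _ := h4

/-- The mean value vanishes, as the form only sees the differences of the test function. -/
theorem coeff_zero_of_form {κ : Sp d → Sp d → ℝ} {w : Sp d → ℂ} {g : Distr d}
    (hg : ∀ f : Test d, g.1 f = 1 / 2 * form κ w f) : coeff g 0 = 0 := by
  rw [coeff, hg, form]
  simp [formIntegrand, expo_zero]

/-- A dyadic block of the operator is the form evaluated at the reflected and translated kernel of
the block. -/
theorem block_coeff_of_form (hφ : IsCutoff φ) {κ : Sp d → Sp d → ℝ} {w : Sp d → ℂ} {g : Distr d}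
    (hg : ∀ f : Test d, g.1 f = 1 / 2 * form κ w f) (j : ℤ) (x : Sp d) :
    block φ j (coeff g) x = 1 / 2 * form κ w fun y => ser (dyadic φ j) (x - y) := by
  have hfin := finite_support_dyadic hφ.norm_le j
  let F : Test d := ∑ k ∈ hfin.toFinset,
    (dyadic φ j k * expo k x) • (⟨expo (-k), expo_mem (-k)⟩ : Test d)
  have hF : (F : Sp d → ℂ) = fun y => ser (dyadic φ j) (x - y) := by
    ext y
    simp only [F, Submodule.coe_sum, Submodule.coe_smul, Finset.sum_apply, Pi.smul_apply,
      smul_eq_mul]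
    rw [ser_eq_sum_toFinset hfin]
    refine Finset.sum_congr rfl fun k _ => ?_
    rw [sub_eq_add_neg, expo_add, expo_neg_left, mul_assoc]
  rw [← hF, ← hg F, block_eq_ser, ser_eq_sum (S := hfin.toFinset) fun k hk => by
    rw [show dyadic φ j k = 0 by simpa using hk, zero_mul]]
  simp only [F, map_sum, map_smul, smul_eq_mul, coeff]
  exact Finset.sum_congr rfl fun k _ => by ring

theorem eLpNorm_cube_convolution_le' {a b : Sp d → ℝ≥0∞} (ha : Measurable a) (hb : Measurable b)
    (hap : Periodic a) (hbp : Periodic b) {p : ℝ≥0∞} (hp : 1 ≤ p) :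
    eLpNorm (fun x => ∫⁻ y in cube d, b (x - y) * a y) p (volume.restrict (cube d)) ≤
      (∫⁻ y in cube d, b y) * eLpNorm a p (volume.restrict (cube d)) := by
  refine le_trans (le_of_eq ?_) (eLpNorm_cube_convolution_le ha hb hap hp)
  congr 1
  ext x
  have hG : Periodic fun y => b (x - y) * a y := fun k y => by
    have := hbp (-k) (x - y)
    rw [lat_neg] at this
    simp only [hap k y, sub_add_eq_sub_sub]
    rw [sub_eq_add_neg (x - y), this]
  have hG' : Periodic fun y => b (x - -y) * a (-y) := fun k y => by
    have := hG (-k) (-y)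
    rw [lat_neg, ← neg_add] at this
    exact this
  rw [← setLIntegral_cube_neg hG, ← setLIntegral_cube_add hG' (-x)]
  refine lintegral_congr fun y => ?_
  rw [mul_comm]
  congr 2 <;> abel

/-- Minkowski's and Young's inequalities for the form of two functions one of which is
translated and reflected. -/
theorem eLpNorm_lintegral_convolution_le {Φ B : Sp d → ℂ} (hΦ : Continuous Φ) (hΦp : Periodic Φ)
    (hB : Continuous B) (hBp : Periodic B) (σ : ℝ) {p : ℝ≥0∞} (hp : 1 ≤ p) {n₁ n₂ : Sp d → ℝ≥0∞}
    (hm₁ : Measurable n₁) (hm₂ : Measurable n₂)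
    (h₁ : ∀ h, ∫⁻ y in cube d, ‖Φ (y - h) - Φ y‖ₑ ≤ n₁ h)
    (h₂ : ∀ h, eLpNorm (fun y => B (y + h) - B y) p (volume.restrict (cube d)) ≤ n₂ h) :
    eLpNorm (fun x => ∫⁻ h, ‖h‖ₑ ^ (-σ) * ∫⁻ y in cube d,
      ‖Φ (x - y - h) - Φ (x - y)‖ₑ * ‖B (y + h) - B y‖ₑ) p (volume.restrict (cube d)) ≤
      ∫⁻ h, ‖h‖ₑ ^ (-σ) * (n₁ h * n₂ h) := by
  have hΦm := hΦ.measurable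
  have hBm := hB.measurable
  refine eLpNorm_lintegral_le (F := fun x h => ‖h‖ₑ ^ (-σ) * ∫⁻ y in cube d,
      ‖Φ (x - y - h) - Φ (x - y)‖ₑ * ‖B (y + h) - B y‖ₑ) ?_ hp (by fun_prop) fun h => ?_
  · refine Measurable.mul (by fun_prop) ?_
    exact Measurable.lintegral_prod_right' (f := fun q : (Sp d × Sp d) × Sp d =>
      ‖Φ (q.1.1 - q.2 - q.1.2) - Φ (q.1.1 - q.2)‖ₑ * ‖B (q.2 + q.1.2) - B q.2‖ₑ) (by fun_prop)
  · have e1 : eLpNorm (fun x => ∫⁻ y in cube d, ‖Φ (x - y - h) - Φ (x - y)‖ₑ *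
        ‖B (y + h) - B y‖ₑ) p (volume.restrict (cube d)) ≤ n₁ h * n₂ h := by
      refine (eLpNorm_cube_convolution_le' (a := fun y => ‖B (y + h) - B y‖ₑ)
        (b := fun y => ‖Φ (y - h) - Φ y‖ₑ) (by fun_prop) (by fun_prop) ?_ ?_ hp).trans
        (mul_le_mul' (h₁ h) ?_)
      · intro k y
        simp only [add_right_comm y (lat k), hBp k]
      · intro k y
        simp only [add_sub_right_comm y, hΦp k]
      · rw [eLpNorm_enorm]
        exact h₂ h
    have e2 := eLpNorm_mul_const_le (μ := volume.restrict (cube d))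
      (f := fun x => ∫⁻ y in cube d, ‖Φ (x - y - h) - Φ (x - y)‖ₑ * ‖B (y + h) - B y‖ₑ)
      (Measurable.lintegral_prod_right' (f := fun q : Sp d × Sp d =>
        ‖Φ (q.1 - q.2 - h) - Φ (q.1 - q.2)‖ₑ * ‖B (q.2 + h) - B q.2‖ₑ) (by fun_prop))
      (‖h‖ₑ ^ (-σ)) p
    simp only [mul_comm _ (‖h‖ₑ ^ (-σ))] at e2
    exact e2.trans (mul_le_mul' le_rfl e1)

theorem absForm_blockSum_le_tsum (hφ : IsCutoff φ) {c : (Fin d → ℤ) → ℂ}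
    (hs : ∑' j, ∫⁻ x in cube d, ‖block φ j c x‖ₑ ≠ ⊤) (σ : ℝ) {f : Sp d → ℂ} (hf : Continuous f) :
    absForm σ (blockSum φ c) f ≤ ∑' m, ∫⁻ h, ‖h‖ₑ ^ (-σ) *
      ∫⁻ y in cube d, ‖f (y + h) - f y‖ₑ * ‖block φ m c (y + h) - block φ m c y‖ₑ := by
  have hfm := hf.measurable
  have hm : ∀ m, Measurable fun h : Sp d => ‖h‖ₑ ^ (-σ) *
      ∫⁻ y in cube d, ‖f (y + h) - f y‖ₑ * ‖block φ m c (y + h) - block φ m c y‖ₑ := fun m => by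
    have hbm := (continuous_block hφ m c).measurable
    refine Measurable.mul (by fun_prop) ?_
    exact Measurable.lintegral_prod_right' (f := fun q : Sp d × Sp d =>
      ‖f (q.2 + q.1) - f q.2‖ₑ * ‖block φ m c (q.2 + q.1) - block φ m c q.2‖ₑ) (by fun_prop)
  rw [absForm, ← lintegral_tsum fun m => (hm m).aemeasurable]
  refine lintegral_mono fun h => ?_
  rw [ENNReal.tsum_mul_left]
  gcongr
  exact lintegral_mul_blockSum_add_sub_le hφ hs h (by fun_prop)

/-- The operator of a singular kernel of order `a + b` maps the Besov space of regularity `b` to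
that of regularity `-a`. -/
theorem exists_besov_le_of_form (hφ : IsCutoff φ) {a b : ℝ} (ha : 0 < a) (ha' : a < 1)
    (hb : 0 < b) (hb' : b < 1) : ∃ C : ℝ≥0, ∀ (p r : ℝ≥0∞), 1 ≤ p → 1 ≤ r →
      ∀ (c : (Fin d → ℤ) → ℂ), besov φ b p r c < ⊤ → ∀ (A : ℝ≥0) (κ : Sp d → Sp d → ℝ),
      IsSingularKernel (d + (a + b)) A κ → ∀ g : Distr d,
      (∀ f : Test d, g.1 f = 1 / 2 * form κ (blockSum φ c) f) →
      besov φ (-a) p r (coeff g) ≤ C * A * besov φ b p r c := by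
  obtain ⟨C₁, h₁⟩ := exists_kernel_bound hφ.smooth hφ.norm_le
  obtain ⟨C₂, h₂⟩ := exists_eLpNorm_block_add_sub_le hφ
  obtain ⟨Q, hQ⟩ := exists_besov_le_of_interaction φ ha ha' hb hb'
  refine ⟨Q * (C₁ * C₂), fun p r hp hr c hc A κ hκ g hg => ?_⟩
  have hs := tsum_lintegral_block_ne_top hφ hb hp hr hc
  refine (hQ p r hr (C₁ * C₂ * A) c (coeff g) fun j => ?_).trans (le_of_eq (by push_cast; ring))
  set Φ := ser (dyadic φ j) with hΦ
  have hΦc : Continuous Φ := continuous_ser (finite_support_dyadic hφ.norm_le j)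
  have hΦm : Measurable Φ := hΦc.measurable
  have hΦp : Periodic Φ := periodic_ser _
  have hbc : ∀ m, Continuous (block φ m c) := fun m => continuous_block hφ m c
  set σ : ℝ := d + (a + b)
  set F : ℤ → Sp d → Sp d → ℝ≥0∞ := fun m x h => ‖h‖ₑ ^ (-σ) *
    ∫⁻ y in cube d, ‖Φ (x - y - h) - Φ (x - y)‖ₑ * ‖block φ m c (y + h) - block φ m c y‖ₑ with hF
  have hFm : ∀ m, Measurable (Function.uncurry (F m)) := fun m => by
    have hbm := (hbc m).measurable
    refine Measurable.mul (by fun_prop) ?_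
    refine Measurable.lintegral_prod_right' (f := fun q : (Sp d × Sp d) × Sp d =>
      ‖Φ (q.1.1 - q.2 - q.1.2) - Φ (q.1.1 - q.2)‖ₑ *
        ‖block φ m c (q.2 + q.1.2) - block φ m c q.2‖ₑ) (by fun_prop)
  have hpt : ∀ x, ‖block φ j (coeff g) x‖ₑ ≤ A * ∑' m, ∫⁻ h, F m x h := fun x => by
    have e1 : ‖(1 / 2 : ℂ)‖ₑ ≤ 1 := by
      rw [← ofReal_norm, ENNReal.ofReal_le_one]; norm_num
    have e2 := absForm_blockSum_le_tsum hφ hs σ (f := fun y => Φ (x - y)) (by fun_prop)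
    have e3 := hκ.enorm_form_le (f := fun y => Φ (x - y)) (measurable_blockSum hφ c) (by fun_prop)
    rw [block_coeff_of_form hφ hg, enorm_mul]
    refine (mul_le_mul' e1 e3).trans ?_
    rw [one_mul]
    simp only [← sub_sub] at e2
    exact mul_le_mul' le_rfl e2
  have hmin : ∀ m, eLpNorm (fun x => ∫⁻ h, F m x h) p (volume.restrict (cube d)) ≤
      C₁ * C₂ * (interaction d (a + b) j m *
        eLpNorm (block φ m c) p (volume.restrict (cube d))) := fun m => by
    refine (eLpNorm_lintegral_convolution_le hΦc hΦp (hbc m) (periodic_block m c) σ hp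
      (n₁ := fun h => C₁ * min 1 (2 ^ (j : ℝ) * ‖h‖ₑ))
      (n₂ := fun h => C₂ * min 1 (2 ^ (m : ℝ) * ‖h‖ₑ) *
        eLpNorm (block φ m c) p (volume.restrict (cube d))) (by fun_prop) (by fun_prop)
      (fun h => ?_) (h₂ p hp m c)).trans (le_of_eq ?_)
    · simpa only [← sub_eq_add_neg, enorm_neg] using (h₁ j).2 (-h)
    · rw [interaction, ← lintegral_mul_const _ (by fun_prop), ← lintegral_const_mul _ (by fun_prop)]
      exact lintegral_congr fun h => by ring
  calc eLpNorm (block φ j (coeff g)) p (volume.restrict (cube d))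
      ≤ eLpNorm (fun x => (∑' m, ∫⁻ h, F m x h) * (A : ℝ≥0∞)) p (volume.restrict (cube d)) :=
        eLpNorm_mono_enorm fun x => by rw [mul_comm]; simpa using hpt x
    _ ≤ A * ∑' m, eLpNorm (fun x => ∫⁻ h, F m x h) p (volume.restrict (cube d)) := by
        have hm : ∀ m, Measurable fun x => ∫⁻ h, F m x h := fun m =>
          (hFm m).lintegral_prod_right'
        refine (eLpNorm_mul_const_le (Measurable.tsum hm) _ _).trans ?_
        gcongr
        exact eLpNorm_tsum_le hm hp
    _ ≤ A * ∑' m, C₁ * C₂ * (interaction d (a + b) j m *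
        eLpNorm (block φ m c) p (volume.restrict (cube d))) := by
        gcongr with m; exact hmin m
    _ = _ := by
        rw [ENNReal.tsum_mul_left]; push_cast; ring

end Operator

section Truncation

/-! ### Convergence of the principal value -/

variable {d : ℕ}

theorem interaction_ne_top (d : ℕ) {a b : ℝ} (ha : 0 < a) (ha' : a < 1) (hb : 0 < b) (hb' : b < 1)
    (j m : ℤ) : interaction d (a + b) j m ≠ ⊤ := by
  obtain ⟨Q, hQ⟩ := exists_tsum_interaction_le d ha ha' hb hb'
  have h := ((ENNReal.le_tsum j).trans (hQ m)).trans_lt ENNReal.coe_lt_top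
  intro htop
  have h1 : ∀ x : ℝ, (2 : ℝ≥0∞) ^ x ≠ 0 := fun x => by simp
  rw [htop, ENNReal.mul_top (mul_ne_zero (h1 _) (h1 _))] at h
  exact lt_irrefl _ h

theorem setLIntegral_enorm_rpow_ne_top (d : ℕ) {a b : ℝ} (ha : 0 < a) (ha' : a < 1) (hb : 0 < b)
    (hb' : b < 1) {ε : ℝ} (hε : 0 < ε) :
    ∫⁻ h in {h : Sp d | ε < ‖h‖}, ‖h‖ₑ ^ (-(d + (a + b))) ≠ ⊤ := by
  obtain ⟨n, hn⟩ := pow_unbounded_of_one_lt ε⁻¹ (one_lt_two (α := ℝ))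
  refine ne_top_of_le_ne_top (interaction_ne_top d ha ha' hb hb' n n)
    ((setLIntegral_mono' (measurableSet_lt measurable_const measurable_norm) fun h hh => ?_).trans
      (setLIntegral_le_lintegral _ _))
  have h1 : (1 : ℝ≥0∞) ≤ 2 ^ ((n : ℤ) : ℝ) * ‖h‖ₑ := by
    rw [← ofReal_norm, Int.cast_natCast, ENNReal.rpow_natCast,
      show (2 : ℝ≥0∞) ^ n = ENNReal.ofReal (2 ^ n) by rw [ENNReal.ofReal_pow two_pos.le]; simp,
      ← ENNReal.ofReal_mul (by positivity), ENNReal.one_le_ofReal]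
    calc (1 : ℝ) = ε⁻¹ * ε := (inv_mul_cancel₀ hε.ne').symm
      _ ≤ _ := mul_le_mul hn.le (le_of_lt hh) hε.le (by positivity)
  rw [min_eq_left h1, mul_one, mul_one]

/-- The off-diagonal region of the truncated integral. -/
def offDiag (d : ℕ) (ε : ℝ) : Set (Sp d × Sp d) := {q | ε < ‖q.1 - q.2‖}

theorem measurableSet_offDiag (d : ℕ) (ε : ℝ) : MeasurableSet (offDiag d ε) :=
  measurableSet_lt measurable_const (by fun_prop)

/-- Away from the diagonal, the factor `w(y) - w(z)` of the integrand suffices for integrability. -/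
theorem IsSingularKernel.integrable_indicator {a b : ℝ} (ha : 0 < a) (ha' : a < 1) (hb : 0 < b)
    (hb' : b < 1) {A : ℝ≥0} {κ : Sp d → Sp d → ℝ} (hκ : IsSingularKernel (d + (a + b)) A κ)
    {w : Sp d → ℂ} (hw : Measurable w) (hwp : Periodic w) (hwi : IntegrableOn w (cube d))
    {F : Sp d × Sp d → ℂ} (hF : Measurable F) {M : ℝ≥0} (hM : ∀ q, ‖F q‖ₑ ≤ M) {ε : ℝ}
    (hε : 0 < ε) :
    Integrable ((offDiag d ε).indicator fun q => F q * (w q.1 - w q.2) * (κ q.1 q.2 : ℂ))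
      (pairMeasure d) := by
  have hκm : Measurable fun q : Sp d × Sp d => (κ q.1 q.2 : ℂ) :=
    Complex.measurable_ofReal.comp hκ.meas
  have hm : Measurable fun q : Sp d × Sp d => F q * (w q.1 - w q.2) * (κ q.1 q.2 : ℂ) := by
    fun_prop
  have hmi := hm.indicator (measurableSet_offDiag d ε)
  refine ⟨hmi.aestronglyMeasurable, ?_⟩
  rw [hasFiniteIntegral_iff_enorm, lintegral_pairMeasure hmi.enorm]
  set B : Set (Sp d) := {h | ε < ‖h‖}
  have hB : MeasurableSet B := measurableSet_lt measurable_const measurable_norm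
  have hwe : Periodic fun y => ‖w y‖ₑ := fun k y => by simp only [hwp k y]
  have hwf : ∫⁻ y in cube d, ‖w y‖ₑ < ⊤ := hwi.2
  calc _ ≤ ∫⁻ h, B.indicator (fun h => ‖h‖ₑ ^ (-(d + (a + b)))) h *
        (M * A * (2 * ∫⁻ y in cube d, ‖w y‖ₑ)) := by
        refine lintegral_mono fun h => ?_
        by_cases hh : h ∈ B
        · rw [indicator_of_mem hh]
          calc _ ≤ ∫⁻ y in cube d, ‖h‖ₑ ^ (-(d + (a + b))) * (M * A * (‖w y‖ₑ + ‖w (y + h)‖ₑ)) := by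
                refine lintegral_mono fun y => ?_
                rw [enorm_indicator_eq_indicator_enorm]
                refine (indicator_le_self _ _ _).trans ?_
                simp only [enorm_mul]
                have h1 := hκ.bound y (y + h)
                rw [sub_add_cancel_left, enorm_neg] at h1
                have h2 : ‖(κ y (y + h) : ℂ)‖ₑ = ‖κ y (y + h)‖ₑ := by
                  rw [← ofReal_norm, Complex.norm_real, ofReal_norm]
                rw [h2]
                calc _ ≤ M * (‖w y‖ₑ + ‖w (y + h)‖ₑ) * (A * ‖h‖ₑ ^ (-(d + (a + b)))) := by
                      gcongr
                      · exact hM _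
                      · exact enorm_sub_le
                  _ = _ := by ring
            _ = _ := by
                rw [lintegral_const_mul _ (by fun_prop), lintegral_const_mul _ (by fun_prop),
                  lintegral_add_left (by fun_prop), setLIntegral_cube_add hwe h, two_mul]
        · rw [indicator_of_notMem hh, zero_mul]
          refine le_of_eq (lintegral_eq_zero_of_ae_eq_zero (.of_forall fun y => ?_))
          have : (y, y + h) ∉ offDiag d ε := fun h1 => hh (by
            have h2 : ε < ‖y - (y + h)‖ := h1
            rwa [sub_add_cancel_left, norm_neg] at h2)
          simp [indicator_of_notMem this]
    _ < ⊤ := by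
        rw [lintegral_mul_const' _ _ (by finiteness), lintegral_indicator hB]
        exact ENNReal.mul_lt_top (setLIntegral_enorm_rpow_ne_top d ha ha' hb hb' hε).lt_top
          (by finiteness)

/-- The pairing of the truncated operator with `f` is half the truncated form. -/
theorem IsSingularKernel.truncated_eq {a b : ℝ} (ha : 0 < a) (ha' : a < 1) (hb : 0 < b)
    (hb' : b < 1) {A : ℝ≥0} {κ : Sp d → Sp d → ℝ} (hκ : IsSingularKernel (d + (a + b)) A κ)
    {w : Sp d → ℂ} (hw : Measurable w) (hwp : Periodic w) (hwi : IntegrableOn w (cube d))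
    (f : Test d) {ε : ℝ} (hε : 0 < ε) :
    ∫ y in cube d, ∫ z in {z : Sp d | ε < ‖y - z‖},
      (f : Sp d → ℂ) y * (w y - w z) * (κ y z : ℂ) =
    1 / 2 * ∫ q, (offDiag d ε).indicator (formIntegrand κ w f) q ∂pairMeasure d := by
  have hfm : Measurable (f : Sp d → ℂ) := (Test.continuous f).measurable
  obtain ⟨M, hM0, hM⟩ := f.2.2.exists_norm_le (Test.continuous f)
  lift M to ℝ≥0 using hM0
  set H : Sp d × Sp d → ℂ := (offDiag d ε).indicator
    fun q => (f : Sp d → ℂ) q.1 * (w q.1 - w q.2) * (κ q.1 q.2 : ℂ) with hH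
  set H' : Sp d × Sp d → ℂ := (offDiag d ε).indicator
    fun q => (f : Sp d → ℂ) q.2 * (w q.1 - w q.2) * (κ q.1 q.2 : ℂ) with hH'
  have hi : Integrable H (pairMeasure d) := hκ.integrable_indicator ha ha' hb hb' hw hwp hwi
    (F := fun q => (f : Sp d → ℂ) q.1) (by fun_prop) (fun q => enorm_le_coe.2 (hM q.1)) hε
  have hi' : Integrable H' (pairMeasure d) := hκ.integrable_indicator ha ha' hb hb' hw hwp hwi
    (F := fun q => (f : Sp d → ℂ) q.2) (by fun_prop) (fun q => enorm_le_coe.2 (hM q.2)) hε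
  have hswap : ∀ q, H q.swap = -H' q := fun q => by
    have : q.swap ∈ offDiag d ε ↔ q ∈ offDiag d ε := by
      simp only [offDiag, mem_ofPred_eq, Prod.fst_swap, Prod.snd_swap, norm_sub_rev q.2]
    by_cases hq : q ∈ offDiag d ε
    · rw [hH, hH', indicator_of_mem hq, indicator_of_mem (this.2 hq)]
      simp only [Prod.fst_swap, Prod.snd_swap, hκ.symm q.2 q.1]
      ring
    · rw [hH, hH', indicator_of_notMem hq, indicator_of_notMem (mt this.1 hq), neg_zero]
  have hHd : ∀ (k : Fin d → ℤ) y z, H (y + lat k, z + lat k) = H (y, z) := fun k y z => by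
    have : (y + lat k, z + lat k) ∈ offDiag d ε ↔ (y, z) ∈ offDiag d ε := by
      simp only [offDiag, mem_ofPred_eq, add_sub_add_right_eq_sub]
    by_cases hq : (y, z) ∈ offDiag d ε
    · rw [hH, indicator_of_mem hq, indicator_of_mem (this.2 hq)]
      simp only [f.2.2 k y, hwp k y, hwp k z, hκ.diag k y z]
    · rw [hH, indicator_of_notMem hq, indicator_of_notMem (mt this.1 hq)]
  have hpm : pairMeasure d = (volume.prod volume).restrict (cube d ×ˢ (univ : Set (Sp d))) := by
    rw [pairMeasure, ← Measure.prod_restrict, Measure.restrict_univ]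
  have e1 : ∫ q, H' q ∂pairMeasure d = -∫ q, H q ∂pairMeasure d := by
    rw [hpm, ← setIntegral_cube_prod_swap hHd]
    simp only [hswap]
    rw [integral_neg, neg_neg]
  have e2 : ∫ y in cube d, ∫ z in {z : Sp d | ε < ‖y - z‖},
      (f : Sp d → ℂ) y * (w y - w z) * (κ y z : ℂ) = ∫ q, H q ∂pairMeasure d := by
    rw [pairMeasure, integral_prod _ hi]
    refine integral_congr_ae (.of_forall fun y => ?_)
    have hS : MeasurableSet {z : Sp d | ε < ‖y - z‖} :=
      measurableSet_lt measurable_const (by fun_prop)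
    simp only
    rw [← integral_indicator hS]
    rfl
  have e3 : (offDiag d ε).indicator (formIntegrand κ w f) = fun q => H q - H' q := by
    ext q
    by_cases hq : q ∈ offDiag d ε
    · rw [hH, hH', indicator_of_mem hq, indicator_of_mem hq, indicator_of_mem hq, formIntegrand]
      ring
    · rw [hH, hH', indicator_of_notMem hq, indicator_of_notMem hq, indicator_of_notMem hq, sub_zero]
  rw [e2, e3, integral_sub hi hi', e1]
  ring

theorem IsSingularKernel.tendsto_truncated {a b : ℝ} (ha : 0 < a) (ha' : a < 1) (hb : 0 < b)
    (hb' : b < 1) {A : ℝ≥0} {κ : Sp d → Sp d → ℝ} (hκ : IsSingularKernel (d + (a + b)) A κ)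
    {w : Sp d → ℂ} (hw : Measurable w) (hwp : Periodic w) (hwi : IntegrableOn w (cube d))
    (f : Test d) (hf : absForm (d + (a + b)) w f ≠ ⊤) :
    Tendsto (fun ε => ∫ y in cube d, ∫ z in {z : Sp d | ε < ‖y - z‖},
      (f : Sp d → ℂ) y * (w y - w z) * (κ y z : ℂ)) (𝓝[>] 0) (𝓝 (1 / 2 * form κ w f)) := by
  have hfm : Measurable (f : Sp d → ℂ) := (Test.continuous f).measurable
  have hm := hκ.measurable_formIntegrand hw hfm
  have hi := hκ.integrable_formIntegrand hw hfm hf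
  have h1 : Tendsto (fun ε => 1 / 2 *
      ∫ q, (offDiag d ε).indicator (formIntegrand κ w f) q ∂pairMeasure d) (𝓝[>] 0)
      (𝓝 (1 / 2 * form κ w f)) := by
    refine Tendsto.const_mul _ ?_
    refine tendsto_integral_filter_of_dominated_convergence
      (fun q => ‖formIntegrand κ w f q‖) (.of_forall fun ε => ?_)
      (.of_forall fun ε => .of_forall fun q => ?_) hi.norm (.of_forall fun q => ?_)
    · exact (hm.indicator (measurableSet_offDiag d ε)).aestronglyMeasurable
    · exact norm_indicator_le_norm_self _ _
    · by_cases hq : q.1 = q.2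
      · have h0 : formIntegrand κ w f q = 0 := by simp [formIntegrand, hq]
        rw [h0]
        refine tendsto_const_nhds.congr fun ε => ?_
        by_cases hε : q ∈ offDiag d ε
        · rw [indicator_of_mem hε, h0]
        · rw [indicator_of_notMem hε]
      · refine tendsto_const_nhds.congr' ?_
        have hpos : 0 < ‖q.1 - q.2‖ := norm_pos_iff.2 (sub_ne_zero.2 hq)
        filter_upwards [mem_nhdsWithin_of_mem_nhds (Iio_mem_nhds hpos)] with ε hε
        rw [indicator_of_mem (show q ∈ offDiag d ε from hε)]
  refine h1.congr' ?_
  filter_upwards [self_mem_nhdsWithin] with ε hε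
  exact (hκ.truncated_eq ha ha' hb hb' hw hwp hwi f hε).symm

end Truncation

section Determinant

/-! ### Trace and determinant -/

variable {d : ℕ}

theorem trace_eq_sum (A : Sp d →L[ℝ] Sp d) :
    LinearMap.trace ℝ (Sp d) (A : Sp d →ₗ[ℝ] Sp d) =
      ∑ i, A (EuclideanSpace.single i (1 : ℝ)) i := by
  rw [LinearMap.trace_eq_matrix_trace ℝ (EuclideanSpace.basisFun (Fin d) ℝ).toBasis, Matrix.trace]
  refine Finset.sum_congr rfl fun i _ => ?_
  rw [Matrix.diag_apply, LinearMap.toMatrix_apply]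
  simp

theorem det_eq_matrix_det (A : Sp d →L[ℝ] Sp d) : A.det =
    (LinearMap.toMatrix (EuclideanSpace.basisFun (Fin d) ℝ).toBasis
      (EuclideanSpace.basisFun (Fin d) ℝ).toBasis (A : Sp d →ₗ[ℝ] Sp d)).det :=
  (LinearMap.det_toMatrix _ _).symm

theorem differentiable_det : Differentiable ℝ fun A : Sp d →L[ℝ] Sp d => A.det := by
  simp only [det_eq_matrix_det, Matrix.det_apply, LinearMap.toMatrix_apply]
  simp only [ContinuousLinearMap.coe_coe, OrthonormalBasis.coe_toBasis, EuclideanSpace.basisFun_apply,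
    OrthonormalBasis.coe_toBasis_repr_apply, EuclideanSpace.basisFun_repr]
  fun_prop

/-- The derivative of the determinant at the identity is the trace. -/
theorem fderiv_det_one (A : Sp d →L[ℝ] Sp d) :
    fderiv ℝ (fun A : Sp d →L[ℝ] Sp d => A.det) 1 A =
      LinearMap.trace ℝ (Sp d) (A : Sp d →ₗ[ℝ] Sp d) := by
  have h1 : HasDerivAt (fun s : ℝ => (1 + s • A).det)
      (fderiv ℝ (fun A : Sp d →L[ℝ] Sp d => A.det) 1 A) 0 := by
    have h2 : HasDerivAt (fun s : ℝ => 1 + s • A) A 0 := by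
      simpa using ((hasDerivAt_id (0 : ℝ)).smul_const A).const_add (1 : Sp d →L[ℝ] Sp d)
    have h3 : HasFDerivAt (fun A : Sp d →L[ℝ] Sp d => A.det)
        (fderiv ℝ (fun A : Sp d →L[ℝ] Sp d => A.det) 1) (1 + (0 : ℝ) • A) := by
      have h0 : 1 + (0 : ℝ) • A = 1 := by
        rw [show (0 : ℝ) • A = 0 from zero_smul ℝ A, add_zero]
      rw [h0]
      exact (differentiable_det 1).hasFDerivAt
    exact h3.comp_hasDerivAt (0 : ℝ) h2
  set b := (EuclideanSpace.basisFun (Fin d) ℝ).toBasis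
  set M := LinearMap.toMatrix b b (A : Sp d →ₗ[ℝ] Sp d) with hM
  have h4 : ∀ s : ℝ, (1 + s • A).det = 1 + M.trace * s + Polynomial.eval s
      (1 + (Polynomial.X : Polynomial ℝ) • M.map Polynomial.C).det.divX.divX * s ^ 2 := fun s => by
    rw [← Matrix.det_one_add_smul, det_eq_matrix_det]
    congr 1
    simp [hM, b, LinearMap.toMatrix_one]
  have h5 : HasDerivAt (fun s : ℝ => (1 + s • A).det) M.trace 0 := by
    simp only [h4]
    have := (((hasDerivAt_id (0 : ℝ)).const_mul M.trace).const_add 1).add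
      ((Polynomial.hasDerivAt (1 + (Polynomial.X : Polynomial ℝ) •
        M.map Polynomial.C).det.divX.divX (0 : ℝ)).mul ((hasDerivAt_id (0 : ℝ)).pow 2))
    exact this.congr_deriv (by simp)
  rw [h1.unique h5, LinearMap.trace_eq_matrix_trace ℝ b]

/-- The determinant at `1 + A` is `1 + tr A + o(‖A‖)`. -/
theorem exists_le_abs_det_one_add (d : ℕ) {ε : ℝ} (hε : 0 < ε) : ∃ δ > 0, ∀ A : Sp d →L[ℝ] Sp d,
    ‖A‖ ≤ δ → LinearMap.trace ℝ (Sp d) (A : Sp d →ₗ[ℝ] Sp d) = 0 →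
      1 - ε * ‖A‖ ≤ |(1 + A).det| := by
  have h := hasFDerivAt_iff_isLittleO_nhds_zero.1 (differentiable_det (1 : Sp d →L[ℝ] Sp d)).hasFDerivAt
  obtain ⟨δ, hδ, h'⟩ := Metric.eventually_nhds_iff.1 (h.def hε)
  refine ⟨δ / 2, by positivity, fun A hA ht => ?_⟩
  have h1 := h' (y := A) (by rw [dist_zero_right]; linarith)
  have h2 : (1 : Sp d →L[ℝ] Sp d).det = 1 := LinearMap.det_id
  rw [fderiv_det_one, ht, sub_zero, Real.norm_eq_abs, h2] at h1
  have := neg_abs_le ((1 + A).det - 1)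
  exact (by linarith : 1 - ε * ‖A‖ ≤ (1 + A).det).trans (le_abs_self _)

/-- A perturbation of the identity by a divergence-free field of small Lipschitz constant does not
decrease volumes by much. -/
theorem exists_volume_le_of_trace_eq_zero (d : ℕ) {ε : ℝ} (hε : 0 < ε) : ∃ δ > 0, ∀ (u : Sp d → Sp d)
    (l : ℝ≥0), (l : ℝ) ≤ δ → LipschitzWith l u →
    (∀ᵐ x, LinearMap.trace ℝ (Sp d) (fderiv ℝ u x : Sp d →ₗ[ℝ] Sp d) = 0) →
    Function.Injective (fun x => x + u x) → ∀ B : Set (Sp d), MeasurableSet B →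
    ENNReal.ofReal (1 - ε * l) * volume ((fun x => x + u x) ⁻¹' B) ≤ volume B := by
  obtain ⟨δ, hδ, h⟩ := exists_le_abs_det_one_add d hε
  refine ⟨δ, hδ, fun u l hl hu htr hinj B hB => ?_⟩
  set E : Sp d → Sp d := fun x => x + u x with hE
  have hEc : Continuous E := continuous_id.add hu.continuous
  have hgood : ∀ᵐ x, DifferentiableAt ℝ u x ∧
      LinearMap.trace ℝ (Sp d) (fderiv ℝ u x : Sp d →ₗ[ℝ] Sp d) = 0 :=
    hu.ae_differentiableAt.and htr
  obtain ⟨N, hN1, hN2, hN3⟩ := exists_measurable_superset_of_null (ae_iff.1 hgood)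
  have hg : ∀ x ∉ N, DifferentiableAt ℝ u x ∧
      LinearMap.trace ℝ (Sp d) (fderiv ℝ u x : Sp d →ₗ[ℝ] Sp d) = 0 := fun x hx => by
    by_contra h0
    exact hx (hN1 h0)
  set A := E ⁻¹' B \ N with hA
  have hAm : MeasurableSet A := (hEc.measurable hB).diff hN2
  have hder : ∀ x ∈ A, HasFDerivWithinAt E (1 + fderiv ℝ u x) A x := fun x hx =>
    ((hasFDerivAt_id x).add (hg x hx.2).1.hasFDerivAt).hasFDerivWithinAt
  have h1 := lintegral_abs_det_fderiv_eq_addHaar_image volume hAm hder hinj.injOn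
  calc ENNReal.ofReal (1 - ε * l) * volume (E ⁻¹' B)
      = ∫⁻ _ in A, ENNReal.ofReal (1 - ε * l) := by
        rw [setLIntegral_const, hA, measure_sdiff_null hN3]
    _ ≤ ∫⁻ x in A, ENNReal.ofReal |(1 + fderiv ℝ u x).det| := by
        refine setLIntegral_mono' hAm fun x hx => ENNReal.ofReal_le_ofReal ?_
        have hn : ‖fderiv ℝ u x‖ ≤ l := norm_fderiv_le_of_lipschitz ℝ hu
        refine le_trans ?_ (h _ (hn.trans hl) (hg x hx.2).2)
        have := mul_le_mul_of_nonneg_left hn hε.le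
        linarith
    _ = volume (E '' A) := h1
    _ ≤ volume B := measure_mono (by rintro _ ⟨x, hx, rfl⟩; exact hx.1)

end Determinant

section RegularField

/-! ### Regular representatives of velocity fields -/

variable {d : ℕ}

/-- A divergence-free field of class `L^1(W^{1,∞})` with uniform control: `ℓ τ` bounds the field
and its Lipschitz constant at every time. -/
structure IsRegularField (v : ℝ → Sp d → Sp d) (ℓ : ℝ → ℝ≥0) : Prop where
  periodic : ∀ τ, Periodic (v τ)
  meas : ∀ x, Measurable fun τ => v τ x
  lip : ∀ τ, LipschitzWith (ℓ τ) (v τ)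
  bound : ∀ τ x, ‖v τ x‖ ≤ ℓ τ
  meas_bound : Measurable ℓ
  integrable : ∫⁻ τ, ℓ τ < ⊤
  div_free : ∀ τ, ∀ᵐ x : Sp d, LinearMap.trace ℝ (Sp d) (fderiv ℝ (v τ) x : Sp d →ₗ[ℝ] Sp d) = 0

theorem edist_le_wOneInf (f : Sp d → Sp d) (x y : Sp d) :
    edist (f x) (f y) ≤ wOneInf f * edist x y := by
  by_cases hxy : x = y
  · simp [hxy]
  rw [← ENNReal.div_le_iff (by simpa using hxy) (edist_ne_top _ _)]
  exact (le_iSup₂ (f := fun x y => edist (f x) (f y) / edist x y) x y).trans le_add_self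

/-- A velocity field agrees at almost every time with a regular one. The bound `ℓ` is the norm
computed on a countable dense set, which makes it measurable. -/
theorem IsVelocity.exists_isRegularField {T : ℝ} {v : ℝ → Sp d → Sp d} (hv : IsVelocity T v) :
    ∃ (u : ℝ → Sp d → Sp d) (ℓ : ℝ → ℝ≥0), IsRegularField u ℓ ∧
      ∀ᵐ τ ∂(volume.restrict (Ioc 0 T)), u τ = v τ := by
  classical
  set D := TopologicalSpace.denseSeq (Sp d) with hD
  have hDd : DenseRange D := TopologicalSpace.denseRange_denseSeq _
  have hmk : ∀ᵐ τ ∂(volume.restrict (Ioc 0 T)), ∀ n, v τ (D n) = (hv.meas (D n)).mk _ τ :=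
    ae_all_iff.2 fun n => (hv.meas (D n)).ae_eq_mk
  have hall := (hmk.and (hv.lip.and hv.div_free)).and (ae_restrict_mem measurableSet_Ioc)
  obtain ⟨N, hN1, hN2, hN3⟩ := exists_measurable_superset_of_null (ae_iff.1 hall)
  have hg : ∀ τ ∈ Nᶜ, ((∀ n, v τ (D n) = (hv.meas (D n)).mk _ τ) ∧ (wOneInf (v τ) < ⊤ ∧
      ∀ᵐ x : Sp d, LinearMap.trace ℝ (Sp d) (fderiv ℝ (v τ) x : Sp d →ₗ[ℝ] Sp d) = 0)) ∧
      τ ∈ Ioc 0 T := fun τ hτ => by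
    by_contra h0
    exact hτ (hN1 h0)
  set u : ℝ → Sp d → Sp d := Nᶜ.indicator v with hu
  have huin : ∀ τ ∈ Nᶜ, u τ = v τ := fun τ h => indicator_of_mem h v
  have huout : ∀ τ ∉ Nᶜ, u τ = 0 := fun τ h => indicator_of_notMem h v
  set m : ℝ → ℝ≥0∞ := fun τ => (⨆ n, ‖u τ (D n)‖ₑ) +
    ⨆ n, ⨆ k, edist (u τ (D n)) (u τ (D k)) / edist (D n) (D k) with hm
  have hmle : ∀ τ, m τ ≤ wOneInf (u τ) := fun τ =>
    add_le_add (iSup_le fun n => le_iSup (fun x => ‖u τ x‖ₑ) (D n))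
      (iSup_le fun n => iSup_le fun k =>
        le_iSup₂ (f := fun x y => edist (u τ x) (u τ y) / edist x y) (D n) (D k))
  have hw0 : wOneInf (0 : Sp d → Sp d) = 0 := by simp [wOneInf]
  have hwlt : ∀ τ, wOneInf (u τ) < ⊤ := fun τ => by
    by_cases hτ : τ ∈ Nᶜ
    · rw [huin τ hτ]; exact (hg τ hτ).1.2.1
    · rw [huout τ hτ, hw0]; exact ENNReal.zero_lt_top
  have hmlt : ∀ τ, m τ ≠ ⊤ := fun τ => ((hmle τ).trans_lt (hwlt τ)).ne
  have hucont : ∀ τ, Continuous (u τ) := fun τ => by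
    have : LipschitzWith (wOneInf (u τ)).toNNReal (u τ) := fun x y => by
      rw [ENNReal.coe_toNNReal (hwlt τ).ne]
      exact edist_le_wOneInf _ _ _
    exact this.continuous
  have humD : ∀ n, Measurable fun τ => u τ (D n) := fun n => by
    have : (fun τ => u τ (D n)) = Nᶜ.indicator ((hv.meas (D n)).mk _) := by
      ext1 τ
      by_cases hτ : τ ∈ Nᶜ
      · rw [huin τ hτ, indicator_of_mem hτ, (hg τ hτ).1.1 n]
      · rw [huout τ hτ, indicator_of_notMem hτ, Pi.zero_apply]
    rw [this]
    exact (hv.meas (D n)).stronglyMeasurable_mk.measurable.indicator hN2.compl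
  have humeas : ∀ x, Measurable fun τ => u τ x := fun x => by
    obtain ⟨s, hs, hsx⟩ := mem_closure_iff_seq_limit.1 (hDd x)
    choose n hn using hs
    refine measurable_of_tendsto_metrizable (fun k => humD (n k)) (tendsto_pi_nhds.2 fun τ => ?_)
    have : (fun k => u τ (D (n k))) = fun k => u τ (s k) := by simp only [hn]
    rw [this]
    exact ((hucont τ).tendsto x).comp hsx
  have hmm : Measurable m := by
    refine (Measurable.iSup fun n => (humD n).enorm).add
      (Measurable.iSup fun n => Measurable.iSup fun k => ?_)
    exact ((humD n).edist (humD k)).div_const _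
  refine ⟨u, fun τ => (m τ).toNNReal, ⟨fun τ => ?_, humeas, fun τ => ?_, fun τ x => ?_,
    hmm.ennreal_toNNReal, ?_, fun τ => ?_⟩, ?_⟩
  · by_cases hτ : τ ∈ Nᶜ
    · rw [huin τ hτ]; exact hv.periodic τ
    · rw [huout τ hτ]; exact fun _ _ => rfl
  · rw [← lipschitzOnWith_univ, ← hDd.closure_eq, lipschitzOnWith_closure_iff (hucont τ).continuousOn]
    rintro _ ⟨n, rfl⟩ _ ⟨k, rfl⟩
    rw [ENNReal.coe_toNNReal (hmlt τ)]
    by_cases hnk : D n = D k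
    · simp [hnk]
    rw [← ENNReal.div_le_iff (by simpa using hnk) (edist_ne_top _ _)]
    exact (le_iSup₂ (f := fun n k => edist (u τ (D n)) (u τ (D k)) / edist (D n) (D k)) n k).trans
      le_add_self
  · have hcl : IsClosed {x | ‖u τ x‖ ≤ (m τ).toNNReal} :=
      isClosed_le (hucont τ).norm continuous_const
    have hsub : closure (range D) ⊆ {x | ‖u τ x‖ ≤ (m τ).toNNReal} := by
      refine hcl.closure_subset_iff.2 ?_
      rintro _ ⟨n, rfl⟩
      have : ‖u τ (D n)‖ₑ ≤ ((m τ).toNNReal : ℝ≥0∞) := by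
        rw [ENNReal.coe_toNNReal (hmlt τ)]
        exact (le_iSup (fun n => ‖u τ (D n)‖ₑ) n).trans le_self_add
      exact enorm_le_coe.1 this
    exact hsub (hDd x)
  · simp only [ENNReal.coe_toNNReal (hmlt _)]
    refine lt_of_le_of_lt ?_ hv.integrable
    rw [lOneWOneInf, ← lintegral_indicator measurableSet_Ioc]
    refine lintegral_mono fun τ => ?_
    by_cases hτ : τ ∈ Nᶜ
    · rw [indicator_of_mem (hg τ hτ).2, ← huin τ hτ]
      exact hmle τ
    · refine (hmle τ).trans ?_
      rw [huout τ hτ, hw0]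
      exact zero_le
  · by_cases hτ : τ ∈ Nᶜ
    · rw [huin τ hτ]; exact (hg τ hτ).1.2.2
    · rw [huout τ hτ]
      refine .of_forall fun x => ?_
      rw [show fderiv ℝ (0 : Sp d → Sp d) x = 0 from fderiv_const_apply 0]
      simp
  · have : ∀ᵐ τ ∂(volume.restrict (Ioc 0 T)), τ ∉ N := measure_eq_zero_iff_ae_notMem.1 hN3
    filter_upwards [this] with τ hτ
    exact huin τ hτ

end RegularField

section Euler

/-! ### Approximation of flows by the Euler scheme -/

variable {d : ℕ} {u : ℝ → Sp d → Sp d} {ℓ : ℝ → ℝ≥0}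

theorem tendsto_natCast_smul_sub {f : Sp d → Sp d} {x : Sp d} (hf : DifferentiableAt ℝ f x)
    (e : Sp d) : Tendsto (fun n : ℕ => (n : ℝ) • (f (x + (n : ℝ)⁻¹ • e) - f x)) atTop
      (𝓝 (fderiv ℝ f x e)) :=
  hf.hasFDerivAt.lim e (tendsto_norm_atTop_atTop.comp tendsto_natCast_atTop_atTop)

namespace IsRegularField

theorem integrable_bound (hu : IsRegularField u ℓ) : Integrable fun τ => (ℓ τ : ℝ) := by
  refine ⟨hu.meas_bound.coe_nnreal_real.aestronglyMeasurable, ?_⟩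
  have := hu.integrable
  simpa [hasFiniteIntegral_iff_enorm] using this

theorem measurable_uncurry (hu : IsRegularField u ℓ) :
    Measurable fun q : Sp d × ℝ => u q.2 q.1 :=
  measurable_uncurry_of_continuous_of_measurable (u := fun x τ => u τ x)
    (fun τ => (hu.lip τ).continuous) hu.meas

theorem integrableOn_comp (hu : IsRegularField u ℓ) {S : Set ℝ} {Y : ℝ → Sp d}
    (hY : AEMeasurable Y (volume.restrict S)) : IntegrableOn (fun τ => u τ (Y τ)) S :=
  hu.integrable_bound.integrableOn.mono'
    (hu.measurable_uncurry.comp_aemeasurable (hY.prodMk aemeasurable_id)).aestronglyMeasurable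
    (.of_forall fun τ => hu.bound τ _)

theorem norm_setIntegral_le (hu : IsRegularField u ℓ) (S : Set ℝ) (Y : ℝ → Sp d) :
    ‖∫ τ in S, u τ (Y τ)‖ ≤ ∫ τ in S, (ℓ τ : ℝ) :=
  norm_integral_le_of_norm_le hu.integrable_bound.integrableOn (.of_forall fun τ => hu.bound τ _)

theorem norm_setIntegral_sub_le (hu : IsRegularField u ℓ) {S : Set ℝ} (hS : MeasurableSet S)
    {Y Z : ℝ → Sp d} (hY : AEMeasurable Y (volume.restrict S))
    (hZ : AEMeasurable Z (volume.restrict S)) {e : ℝ} (he : ∀ τ ∈ S, ‖Y τ - Z τ‖ ≤ e) :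
    ‖(∫ τ in S, u τ (Y τ)) - ∫ τ in S, u τ (Z τ)‖ ≤ (∫ τ in S, (ℓ τ : ℝ)) * e := by
  rw [← integral_sub (hu.integrableOn_comp hY) (hu.integrableOn_comp hZ), ← integral_mul_const]
  refine norm_integral_le_of_norm_le (hu.integrable_bound.integrableOn.mul_const e) ?_
  filter_upwards [ae_restrict_mem hS] with τ hτ
  have := (hu.lip τ).norm_sub_le (Y τ) (Z τ)
  exact this.trans (mul_le_mul_of_nonneg_left (he τ hτ) (ℓ τ).2)

theorem lipschitzWith_setIntegral (hu : IsRegularField u ℓ) {S : Set ℝ} (hS : MeasurableSet S)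
    {l : ℝ≥0} (hl : (l : ℝ) = ∫ τ in S, (ℓ τ : ℝ)) :
    LipschitzWith l fun x => ∫ τ in S, u τ x :=
  LipschitzWith.of_dist_le_mul fun x y => by
    rw [dist_eq_norm, dist_eq_norm, hl]
    exact hu.norm_setIntegral_sub_le hS aemeasurable_const aemeasurable_const fun _ _ => le_rfl

/-- The time average of a divergence-free field is divergence free. The divergences are computed
as limits of difference quotients, which are measurable in `(x, τ)`. -/
theorem trace_fderiv_setIntegral (hu : IsRegularField u ℓ) {S : Set ℝ} (hS : MeasurableSet S) :
    ∀ᵐ x : Sp d, LinearMap.trace ℝ (Sp d)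
      (fderiv ℝ (fun x => ∫ τ in S, u τ x) x : Sp d →ₗ[ℝ] Sp d) = 0 := by
  let e : Fin d → Sp d := fun i => EuclideanSpace.single i (1 : ℝ)
  let Q : ℕ → Sp d × ℝ → ℝ := fun n q =>
    ∑ i, ((n : ℝ) • (u q.2 (q.1 + (n : ℝ)⁻¹ • e i) - u q.2 q.1)) i
  have hum := hu.measurable_uncurry
  have hQm : ∀ n, Measurable (Q n) := fun n => by
    refine Finset.measurable_sum _ fun i _ => ?_
    have h1 : Measurable fun q : Sp d × ℝ => u q.2 (q.1 + (n : ℝ)⁻¹ • e i) :=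
      hum.comp ((measurable_fst.add_const _).prodMk measurable_snd)
    exact (EuclideanSpace.proj i : Sp d →L[ℝ] ℝ).measurable.comp
      ((h1.sub hum).const_smul (n : ℝ))
  have hset : MeasurableSet {q : Sp d × ℝ | Tendsto (fun n => Q n q) atTop (𝓝 0)} :=
    measurableSet_tendsto (𝓝 0) hQm
  have hlim : ∀ (f : Sp d → Sp d) (x : Sp d), DifferentiableAt ℝ f x → Tendsto (fun n : ℕ =>
      ∑ i, ((n : ℝ) • (f (x + (n : ℝ)⁻¹ • e i) - f x)) i) atTop
      (𝓝 (LinearMap.trace ℝ (Sp d) (fderiv ℝ f x : Sp d →ₗ[ℝ] Sp d))) := fun f x hf => by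
    rw [trace_eq_sum]
    refine tendsto_finsetSum _ fun i _ => ?_
    exact ((EuclideanSpace.proj i : Sp d →L[ℝ] ℝ).continuous.tendsto _).comp
      (tendsto_natCast_smul_sub hf (e i))
  have h1 : ∀ᵐ τ ∂(volume.restrict S), ∀ᵐ x : Sp d, Tendsto (fun n => Q n (x, τ)) atTop (𝓝 0) := by
    refine .of_forall fun τ => ?_
    filter_upwards [hu.div_free τ, (hu.lip τ).ae_differentiableAt] with x hx1 hx2
    have := hlim (u τ) x hx2
    rwa [hx1] at this
  have h2 : ∀ᵐ x : Sp d, ∀ᵐ τ ∂(volume.restrict S), Tendsto (fun n => Q n (x, τ)) atTop (𝓝 0) :=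
    (Measure.ae_ae_comm (p := fun x τ => Tendsto (fun n => Q n (x, τ)) atTop (𝓝 0)) hset).2 h1
  have hl : (0 : ℝ) ≤ ∫ τ in S, (ℓ τ : ℝ) := integral_nonneg fun τ => (ℓ τ).2
  have h3 := (hu.lipschitzWith_setIntegral hS (l := ⟨_, hl⟩) rfl).ae_differentiableAt
    (μ := (volume : Measure (Sp d)))
  filter_upwards [h2, h3] with x hx1 hx2
  refine tendsto_nhds_unique (hlim _ x hx2) ?_
  have hint : ∀ z, IntegrableOn (fun τ => u τ z) S := fun z =>
    hu.integrableOn_comp aemeasurable_const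
  have hQint : ∀ n : ℕ, ∑ i, ((n : ℝ) • ((∫ τ in S, u τ (x + (n : ℝ)⁻¹ • e i)) -
      ∫ τ in S, u τ x)) i = ∫ τ in S, Q n (x, τ) := fun n => by
    simp only [Q]
    rw [integral_finsetSum]
    · refine Finset.sum_congr rfl fun i _ => ?_
      rw [← integral_sub (hint _) (hint _), ← integral_smul]
      exact ((EuclideanSpace.proj i : Sp d →L[ℝ] ℝ).integral_comp_comm
        (((hint _).sub (hint _)).smul (n : ℝ))).symm
    · intro i _
      exact (EuclideanSpace.proj i : Sp d →L[ℝ] ℝ).integrable_comp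
        (((hint _).sub (hint _)).smul (n : ℝ))
  simp only [hQint]
  rw [show (0 : ℝ) = ∫ τ in S, (0 : ℝ) by simp]
  refine tendsto_integral_of_dominated_convergence (fun τ => (d : ℝ) * ℓ τ)
    (fun n => ((hQm n).comp measurable_prodMk_left).aestronglyMeasurable)
    (hu.integrable_bound.integrableOn.const_mul _) (fun n => .of_forall fun τ => ?_) hx1
  calc ‖Q n (x, τ)‖ ≤ ∑ i : Fin d, (ℓ τ : ℝ) := by
        refine norm_sum_le_of_le _ fun i _ => (PiLp.norm_apply_le _ i).trans ?_
        rw [norm_smul]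
        refine (mul_le_mul_of_nonneg_left ((hu.lip τ).norm_sub_le _ _) (norm_nonneg _)).trans ?_
        rw [add_sub_cancel_left, norm_smul, norm_inv]
        simp only [e, PiLp.norm_single, norm_one, mul_one]
        by_cases hn : ‖(n : ℝ)‖ = 0
        · rw [hn, zero_mul]; exact (ℓ τ).2
        · rw [mul_left_comm, mul_inv_cancel₀ hn, mul_one]
    _ = d * ℓ τ := by simp

end IsRegularField

/-- The properties of a flow of a regular field that are used. -/
structure IsRegularFlow (T : ℝ) (u X : ℝ → Sp d → Sp d) : Prop where
  cont : ∀ y, ContinuousOn (fun τ => X τ y) (Icc 0 T)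
  zero : ∀ y, X 0 y = y
  step : ∀ y, ∀ s ∈ Icc 0 T, ∀ t ∈ Icc 0 T, s ≤ t → X t y = X s y + ∫ τ in Ioc s t, u τ (X τ y)

theorem aemeasurable_of_continuousOn {T : ℝ} {Y : ℝ → Sp d} (hY : ContinuousOn Y (Icc 0 T)) {s t : ℝ}
    (hs : 0 ≤ s) (ht : t ≤ T) : AEMeasurable Y (volume.restrict (Ioc s t)) :=
  (hY.mono fun _ h => ⟨hs.trans h.1.le, h.2.trans ht⟩).aemeasurable measurableSet_Ioc

theorem IsFlow.isRegularFlow {T : ℝ} {v X : ℝ → Sp d → Sp d} (hX : IsFlow T v X)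
    (hu : IsRegularField u ℓ) (hae : ∀ᵐ τ ∂(volume.restrict (Ioc 0 T)), u τ = v τ) (hT : 0 ≤ T) :
    IsRegularFlow T u X := by
  have h0 : ∀ y, ∀ t ∈ Icc 0 T, X t y = y + ∫ τ in Ioc 0 t, u τ (X τ y) := fun y t ht => by
    rw [(hX y).2 t ht, intervalIntegral.integral_of_le ht.1]
    congr 1
    refine integral_congr_ae ?_
    filter_upwards [ae_restrict_of_ae_restrict_of_subset (Ioc_subset_Ioc_right ht.2) hae] with τ hτ
    rw [hτ]
  refine ⟨fun y => (hX y).1, fun y => ?_, fun y s hs t ht hst => ?_⟩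
  · rw [h0 y 0 ⟨le_rfl, hT⟩]; simp
  · rw [h0 y t ht, h0 y s hs, add_assoc, ← Ioc_union_Ioc_eq_Ioc hs.1 hst,
      setIntegral_union (Ioc_disjoint_Ioc_of_le le_rfl) measurableSet_Ioc]
    · exact hu.integrableOn_comp (aemeasurable_of_continuousOn (hX y).1 le_rfl hs.2)
    · exact hu.integrableOn_comp (aemeasurable_of_continuousOn (hX y).1 hs.1 ht.2)

/-- One step of the Euler scheme. -/
theorem IsRegularField.exists_homeomorph (hu : IsRegularField u ℓ) {S : Set ℝ}
    (hS : MeasurableSet S) (hl : ∫ τ in S, (ℓ τ : ℝ) < 1) :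
    ∃ E : Sp d ≃ₜ Sp d, ∀ x, E x = x + ∫ τ in S, u τ x := by
  have hl0 : (0 : ℝ) ≤ ∫ τ in S, (ℓ τ : ℝ) := integral_nonneg fun τ => (ℓ τ).2
  set l : ℝ≥0 := ⟨_, hl0⟩ with hldef
  have hL := hu.lipschitzWith_setIntegral hS (l := l) rfl
  have happ : ApproximatesLinearOn (fun x => x + ∫ τ in S, u τ x)
      ((ContinuousLinearEquiv.refl ℝ (Sp d) : Sp d ≃L[ℝ] Sp d) : Sp d →L[ℝ] Sp d) univ l := by
    intro x _ y _
    have := hL.norm_sub_le x y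
    rw [show x + (∫ τ in S, u τ x) - (y + ∫ τ in S, u τ y) -
      ((ContinuousLinearEquiv.refl ℝ (Sp d) : Sp d ≃L[ℝ] Sp d) : Sp d →L[ℝ] Sp d) (x - y) =
      (∫ τ in S, u τ x) - ∫ τ in S, u τ y by simp; abel]
    exact this
  refine ⟨happ.toHomeomorph _ ?_, fun x => rfl⟩
  rcases subsingleton_or_nontrivial (Sp d) with h | h
  · exact Or.inl h
  · refine Or.inr ?_
    have h1 : ‖((ContinuousLinearEquiv.refl ℝ (Sp d)).symm : Sp d →L[ℝ] Sp d)‖₊ = 1 :=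
      NNReal.eq ContinuousLinearMap.norm_id
    rw [h1, inv_one]
    exact_mod_cast hl

theorem exp_neg_two_mul_le {x : ℝ} (h0 : 0 ≤ x) (h1 : x ≤ 1 / 2) :
    Real.exp (-(2 * x)) ≤ 1 - x := by
  rw [Real.exp_neg, inv_le_comm₀ (Real.exp_pos _) (by linarith)]
  refine le_trans ?_ (Real.add_one_le_exp (2 * x))
  rw [inv_le_iff_one_le_mul₀ (by linarith)]
  nlinarith

/-- A homeomorphism that is close to the flow at time `t`; `L` stands for the integral of the
Lipschitz constants up to time `t`, `δ` for the bound of that integral over one step of the scheme,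
and `ε` measures the defect of volume preservation. -/
structure IsApproxFlow (Y : Sp d → Sp d) (δ ε L : ℝ) (H : Sp d ≃ₜ Sp d) : Prop where
  lattice : ∀ k y, H (y + lat k) = H y + lat k
  lip : ∀ y z, ‖H y - H z‖ ≤ Real.exp L * ‖y - z‖
  close : ∀ y, ‖H y - Y y‖ ≤ δ * L * Real.exp L
  vol : ∀ B, MeasurableSet B →
    ENNReal.ofReal (Real.exp (-(2 * (ε * L)))) * volume (H ⁻¹' B) ≤ volume B

/-- The Euler scheme with steps during which the integral of `ℓ` grows by at most `δ`. In a step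
over which this integral is `lam`, the Lipschitz constant is multiplied by at most `1 + lam`, the
error `e` grows to at most `(1 + lam) e + lam ^ 2`, and the volume of preimages grows by a factor
of at most `(1 - ε lam)⁻¹`. -/
theorem exists_isApproxFlow {T : ℝ} {X : ℝ → Sp d → Sp d} (hu : IsRegularField u ℓ)
    (hX : IsRegularFlow T u X) {ε : ℝ} (hε : 0 < ε)
    (hε' : ε * ∫ τ in Ioc 0 T, (ℓ τ : ℝ) ≤ 1 / 2) : ∃ δ₀ > 0, ∀ δ, 0 < δ → δ ≤ δ₀ → ∀ t ∈ Icc 0 T,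
      ∃ H, IsApproxFlow (X t) δ ε (∫ τ in Ioc 0 t, (ℓ τ : ℝ)) H := by
  obtain ⟨δ₁, hδ₁, hvol⟩ := exists_volume_le_of_trace_eq_zero d hε
  refine ⟨min δ₁ (1 / 2), by positivity, fun δ hδ hδ0 => ?_⟩
  have hδ2 : δ ≤ δ₁ := hδ0.trans (min_le_left _ _)
  have hδ3 : δ ≤ 1 / 2 := hδ0.trans (min_le_right _ _)
  set L : ℝ → ℝ := fun t => ∫ τ in Ioc 0 t, (ℓ τ : ℝ) with hL
  have hint : ∀ S : Set ℝ, IntegrableOn (fun τ => (ℓ τ : ℝ)) S := fun S =>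
    hu.integrable_bound.integrableOn
  have hadd : ∀ s t, 0 ≤ s → s ≤ t → L t = L s + ∫ τ in Ioc s t, (ℓ τ : ℝ) := fun s t hs hst => by
    rw [hL]
    simp only
    rw [← Ioc_union_Ioc_eq_Ioc hs hst,
      setIntegral_union (Ioc_disjoint_Ioc_of_le le_rfl) measurableSet_Ioc (hint _) (hint _)]
  have hpos : ∀ S : Set ℝ, 0 ≤ ∫ τ in S, (ℓ τ : ℝ) := fun S => integral_nonneg fun τ => (ℓ τ).2
  have hstep : ∀ s ∈ Icc 0 T, ∀ t ∈ Icc 0 T, s ≤ t → L t - L s ≤ δ →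
      (∃ H, IsApproxFlow (X s) δ ε (L s) H) → ∃ H, IsApproxFlow (X t) δ ε (L t) H := by
    rintro s hs t ht hst hsmall ⟨H, hH⟩
    have hS : MeasurableSet (Ioc s t) := measurableSet_Ioc
    set lam := ∫ τ in Ioc s t, (ℓ τ : ℝ) with hlam
    have hLt : L t = L s + lam := hadd s t hs.1 hst
    have hlam0 : 0 ≤ lam := hpos _
    have hlamδ : lam ≤ δ := by linarith
    obtain ⟨E, hE⟩ := hu.exists_homeomorph hS (show lam < 1 by linarith)
    have hexp : (1 + lam) * Real.exp (L s) ≤ Real.exp (L t) := by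
      rw [hLt, Real.exp_add, mul_comm]
      gcongr
      linarith [Real.add_one_le_exp lam]
    have hElip : ∀ x y, ‖E x - E y‖ ≤ (1 + lam) * ‖x - y‖ := fun x y => by
      have h := hu.norm_setIntegral_sub_le hS (Y := fun _ => x) (Z := fun _ => y)
        aemeasurable_const aemeasurable_const (e := ‖x - y‖) fun _ _ => le_rfl
      rw [hE, hE, add_sub_add_comm, add_mul, one_mul]
      exact (norm_add_le _ _).trans (by gcongr)
    refine ⟨H.trans E, ⟨fun k y => ?_, fun y z => ?_, fun y => ?_, fun B hB => ?_⟩⟩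
    · simp only [Homeomorph.trans_apply, hH.lattice, hE, hu.periodic _ k _]
      abel
    · simp only [Homeomorph.trans_apply]
      calc _ ≤ (1 + lam) * ‖H y - H z‖ := hElip _ _
        _ ≤ (1 + lam) * (Real.exp (L s) * ‖y - z‖) := by gcongr; exact hH.lip y z
        _ = (1 + lam) * Real.exp (L s) * ‖y - z‖ := by ring
        _ ≤ _ := by gcongr
    · simp only [Homeomorph.trans_apply]
      rw [hE, hX.step y s hs t ht hst, add_sub_add_comm]
      have hcl := hH.close y
      have hY : AEMeasurable (fun τ => X τ y) (volume.restrict (Ioc s t)) :=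
        aemeasurable_of_continuousOn (hX.cont y) hs.1 ht.2
      have hdiff := hu.norm_setIntegral_sub_le hS (Y := fun _ => H y) (Z := fun τ => X τ y)
        aemeasurable_const hY (e := δ * L s * Real.exp (L s) + lam) fun τ hτ => by
          have hτT : τ ∈ Icc 0 T := ⟨hs.1.trans hτ.1.le, hτ.2.trans ht.2⟩
          have h1 : ‖X s y - X τ y‖ ≤ lam := by
            rw [hX.step y s hs τ hτT hτ.1.le, sub_add_cancel_left, norm_neg]
            refine (hu.norm_setIntegral_le _ _).trans ?_
            exact setIntegral_mono_set (hint _) (.of_forall fun τ => (ℓ τ).2)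
              (Ioc_subset_Ioc_right hτ.2).eventuallyLE
          calc ‖H y - X τ y‖ = ‖(H y - X s y) + (X s y - X τ y)‖ := by rw [sub_add_sub_cancel]
            _ ≤ _ := (norm_add_le _ _).trans (add_le_add hcl h1)
      have hLs : 0 ≤ L s := hpos _
      have hE1 : 1 ≤ Real.exp (L t) := Real.one_le_exp (hpos _)
      calc _ ≤ δ * L s * Real.exp (L s) + lam * (δ * L s * Real.exp (L s) + lam) :=
            (norm_add_le _ _).trans (add_le_add hcl hdiff)
        _ = δ * L s * ((1 + lam) * Real.exp (L s)) + lam * lam := by ring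
        _ ≤ δ * L s * Real.exp (L t) + δ * lam * Real.exp (L t) := by
            refine add_le_add (by gcongr) ?_
            calc lam * lam ≤ δ * lam * 1 := by rw [mul_one]; gcongr
              _ ≤ _ := by gcongr
        _ = δ * L t * Real.exp (L t) := by rw [hLt]; ring
    · have h1 := hvol (fun x => ∫ τ in Ioc s t, u τ x) ⟨lam, hlam0⟩ (hlamδ.trans hδ2)
        (hu.lipschitzWith_setIntegral hS rfl) (hu.trace_fderiv_setIntegral hS)
        (fun x y hxy => E.injective (by rw [hE, hE]; exact hxy)) B hB
      have h2 : (fun x => x + ∫ τ in Ioc s t, u τ x) = E := funext fun x => (hE x).symm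
      rw [h2] at h1
      have h3 := hH.vol (E ⁻¹' B) (E.continuous.measurable hB)
      have h4 : Real.exp (-(2 * (ε * lam))) ≤ 1 - ε * lam := by
        refine exp_neg_two_mul_le (by positivity) (le_trans ?_ hε')
        gcongr
        exact setIntegral_mono_set (hint _) (.of_forall fun τ => (ℓ τ).2)
          (Ioc_subset_Ioc hs.1 ht.2).eventuallyLE
      have h5 : (H.trans E) ⁻¹' B = H ⁻¹' (E ⁻¹' B) := rfl
      calc _ = ENNReal.ofReal (Real.exp (-(2 * (ε * lam)))) *
            (ENNReal.ofReal (Real.exp (-(2 * (ε * L s)))) * volume (H ⁻¹' (E ⁻¹' B))) := by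
            have h6 : Real.exp (-(2 * (ε * L t))) =
                Real.exp (-(2 * (ε * lam))) * Real.exp (-(2 * (ε * L s))) := by
              rw [← Real.exp_add, hLt]
              congr 1
              ring
            rw [h5, h6, ENNReal.ofReal_mul (Real.exp_pos _).le, mul_assoc]
        _ ≤ ENNReal.ofReal (1 - ε * lam) * volume (E ⁻¹' B) := by gcongr
        _ ≤ _ := h1
  have hcont : ∀ t, 0 ≤ t → ContinuousOn L (Icc 0 t) := fun t _ =>
    intervalIntegral.continuousOn_primitive (hint _)
  have h0T : ∀ t ∈ Icc 0 T, (0 : ℝ) ∈ Icc 0 T := fun t ht => ⟨le_rfl, ht.1.trans ht.2⟩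
  have hL0 : L 0 = 0 := by simp [hL]
  have hbase : ∃ H, IsApproxFlow (X 0) δ ε (L 0) H :=
    ⟨Homeomorph.refl _, fun _ _ => rfl, by simp [hL0], by simp [hL0, hX.zero], by simp [hL0]⟩
  have hmain : ∀ n : ℕ, ∀ t ∈ Icc 0 T, L t ≤ n * δ → ∃ H, IsApproxFlow (X t) δ ε (L t) H := by
    intro n
    induction n with
    | zero =>
      intro t ht hLt
      refine hstep 0 (h0T t ht) t ht ht.1 ?_ hbase
      rw [hL0, sub_zero]
      exact hLt.trans (by simpa using hδ.le)
    | succ n ih =>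
      intro t ht hLt
      by_cases hc : L t ≤ n * δ
      · exact ih t ht hc
      · push Not at hc
        obtain ⟨s, hs, hsL⟩ := intermediate_value_Icc ht.1 (hcont t ht.1)
          (show (n : ℝ) * δ ∈ Icc (L 0) (L t) from ⟨by rw [hL0]; positivity, hc.le⟩)
        have hsT : s ∈ Icc 0 T := ⟨hs.1, hs.2.trans ht.2⟩
        refine hstep s hsT t ht hs.2 ?_ (ih s hsT hsL.le)
        push_cast at hLt
        linarith
  intro t ht
  obtain ⟨n, hn⟩ := exists_nat_ge (L t / δ)
  exact hmain n t ht (by rwa [div_le_iff₀ hδ] at hn)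

end Euler

section Flow

/-! ### The bi-Lipschitz bound for flows of divergence-free fields -/

variable {d : ℕ} {u : ℝ → Sp d → Sp d} {ℓ : ℝ → ℝ≥0}

theorem IsRegularFlow.exists_homeomorph {T : ℝ} {X : ℝ → Sp d → Sp d} (hu : IsRegularField u ℓ)
    (hX : IsRegularFlow T u X) {t : ℝ} (ht : t ∈ Icc 0 T) {η : ℝ} (hη : 0 < η) :
    ∃ H : Sp d ≃ₜ Sp d, (∀ k y, H (y + lat k) = H y + lat k) ∧
      (∀ y z, ‖H y - H z‖ ≤ Real.exp (∫ τ in Ioc 0 t, (ℓ τ : ℝ)) * ‖y - z‖) ∧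
      (∀ y, ‖H y - X t y‖ ≤ η) ∧ ∀ B, MeasurableSet B → volume (H ⁻¹' B) ≤ 2 * volume B := by
  set LT := ∫ τ in Ioc 0 T, (ℓ τ : ℝ) with hLT
  set L := ∫ τ in Ioc 0 t, (ℓ τ : ℝ) with hL
  have hL0 : 0 ≤ L := integral_nonneg fun τ => (ℓ τ).2
  have hLLT : L ≤ LT := setIntegral_mono_set hu.integrable_bound.integrableOn
    (.of_forall fun τ => (ℓ τ).2) (Ioc_subset_Ioc_right ht.2).eventuallyLE
  have hLT0 : 0 ≤ LT := hL0.trans hLLT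
  set ε := 1 / (4 * (LT + 1)) with hε
  have hε0 : 0 < ε := by positivity
  have hεL : ε * LT ≤ 1 / 4 := by
    rw [hε, one_div, inv_mul_le_iff₀ (by positivity)]
    linarith
  obtain ⟨δ₀, hδ₀, h⟩ := exists_isApproxFlow hu hX hε0 (hεL.trans (by norm_num))
  obtain ⟨H, hH⟩ := h (min δ₀ (η / ((L + 1) * Real.exp L))) (lt_min hδ₀ (by positivity))
    (min_le_left _ _) t ht
  refine ⟨H, hH.lattice, hH.lip, fun y => (hH.close y).trans ?_, fun B hB => ?_⟩
  · calc _ ≤ η / ((L + 1) * Real.exp L) * (L + 1) * Real.exp L := by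
          gcongr
          · exact min_le_right _ _
          · linarith
      _ = η := by rw [mul_assoc, div_mul_cancel₀ _ (by positivity)]
  · have h1 : (1 / 2 : ℝ) ≤ Real.exp (-(2 * (ε * L))) := by
      have h2 := Real.add_one_le_exp (-(2 * (ε * L)))
      have h3 : ε * L ≤ ε * LT := by gcongr
      linarith
    have h4 : ENNReal.ofReal (1 / 2) * volume (H ⁻¹' B) ≤ volume B :=
      (mul_le_mul' (ENNReal.ofReal_le_ofReal h1) le_rfl).trans (hH.vol B hB)
    calc volume (H ⁻¹' B) = 2 * (ENNReal.ofReal (1 / 2) * volume (H ⁻¹' B)) := by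
          have h5 : (2 : ℝ≥0∞) * ENNReal.ofReal (1 / 2) = 1 := by
            rw [show (2 : ℝ≥0∞) = ENNReal.ofReal 2 by simp, ← ENNReal.ofReal_mul two_pos.le]
            norm_num
          rw [← mul_assoc, h5, one_mul]
      _ ≤ _ := by gcongr

theorem IsRegularFlow.add_lat {T : ℝ} {X : ℝ → Sp d → Sp d} (hu : IsRegularField u ℓ)
    (hX : IsRegularFlow T u X) {t : ℝ} (ht : t ∈ Icc 0 T) (k : Fin d → ℤ) (y : Sp d) :
    X t (y + lat k) = X t y + lat k := by
  rw [← sub_eq_zero, ← norm_le_zero_iff]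
  refine le_of_forall_pos_le_add fun η hη => ?_
  obtain ⟨H, h1, -, h3, -⟩ := hX.exists_homeomorph hu ht (half_pos hη)
  calc ‖X t (y + lat k) - (X t y + lat k)‖
      = ‖(H y - X t y) - (H (y + lat k) - X t (y + lat k))‖ := by rw [h1]; congr 1; abel
    _ ≤ η / 2 + η / 2 := (norm_sub_le _ _).trans (add_le_add (h3 _) (h3 _))
    _ = _ := by ring

theorem IsRegularFlow.lipschitzWith {T : ℝ} {X : ℝ → Sp d → Sp d} (hu : IsRegularField u ℓ)
    (hX : IsRegularFlow T u X) {t : ℝ} (ht : t ∈ Icc 0 T) : ∃ K, LipschitzWith K (X t) := by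
  refine ⟨(Real.exp (∫ τ in Ioc 0 t, (ℓ τ : ℝ))).toNNReal,
    LipschitzWith.of_dist_le_mul fun y z => ?_⟩
  rw [dist_eq_norm, dist_eq_norm, Real.coe_toNNReal _ (Real.exp_pos _).le]
  refine le_of_forall_pos_le_add fun η hη => ?_
  obtain ⟨H, -, h2, h3, -⟩ := hX.exists_homeomorph hu ht (half_pos hη)
  calc ‖X t y - X t z‖ = ‖(H y - H z) - (H y - X t y) + (H z - X t z)‖ := by congr 1; abel
    _ ≤ ‖H y - H z‖ + η / 2 + η / 2 :=
        (norm_add_le _ _).trans (add_le_add ((norm_sub_le _ _).trans (add_le_add le_rfl (h3 _)))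
          (h3 _))
    _ ≤ _ := by
        linarith [h2 y z]

/-- A Lipschitz map `Y` that is a uniform limit of homeomorphisms that almost preserve volumes is
bi-Lipschitz. The preimage under such a homeomorphism `H` of the segment from `H y` to `H z` is a
curve from `y` to `z`, which meets about `‖y - z‖ / r` disjoint balls of radius `r / 2`; these
balls are mapped into a ball of radius comparable to `r` if `r` is comparable to `‖Y y - Y z‖`. -/
theorem norm_sub_le_of_volume {Y : Sp d → Sp d} {L : ℝ} (hL : 1 ≤ L)
    (hY : ∀ y z, ‖Y y - Y z‖ ≤ L * ‖y - z‖)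
    (happ : ∀ η > 0, ∃ H : Sp d ≃ₜ Sp d, (∀ y, ‖H y - Y y‖ ≤ η) ∧
      ∀ B, MeasurableSet B → volume (H ⁻¹' B) ≤ 2 * volume B) (y z : Sp d) :
    ‖y - z‖ ≤ 2 ^ (d + 2) * L ^ d * ‖Y y - Y z‖ := by
  set ρ := ‖Y y - Y z‖ with hρ
  set c : ℝ := 2 ^ (d + 2) * L ^ d with hc
  have hL0 : 0 < L := by linarith
  have hc0 : 0 < c := by positivity
  refine le_of_forall_pos_le_add fun η' hη' => ?_
  set η := η' / (4 * c) with hη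
  have hη0 : 0 < η := by positivity
  suffices h : ‖y - z‖ ≤ c * (ρ + 4 * η) by
    rw [mul_add, hη] at h
    have : c * (4 * (η' / (4 * c))) = η' := by field_simp
    linarith
  obtain ⟨H, hH, hvol⟩ := happ η hη0
  have hρ0 : 0 ≤ ρ := norm_nonneg _
  set ρ' := ρ + 4 * η with hρ'
  have hρ'0 : 0 < ρ' := by positivity
  set r := 2 * ρ' with hr
  have hr0 : 0 < r := by positivity
  set R := ‖y - z‖ with hR
  set γ : ℝ → Sp d := fun s => H.symm (H y + s • (H z - H y)) with hγ
  have hγc : Continuous γ := H.symm.continuous.comp (by fun_prop)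
  -- By the intermediate value theorem, the curve contains a point at each distance `i r ≤ ‖y - z‖`
  -- from `y`.
  have hivt := intermediate_value_Icc (zero_le_one (α := ℝ))
    (f := fun s => ‖γ s - y‖) (by fun_prop)
  have hγ0 : ‖γ 0 - y‖ = 0 := by simp [hγ]
  have hγ1 : ‖γ 1 - y‖ = R := by simp [hγ, hR, norm_sub_rev z]
  simp only [hγ0, hγ1] at hivt
  set N := ⌊R / r⌋₊ + 1 with hN
  have hNR : R ≤ N * r := by
    rw [← div_le_iff₀ hr0]
    exact (Nat.lt_floor_add_one _).le.trans (by rw [hN]; push_cast; exact le_rfl)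
  have hex : ∀ i : Fin N, ∃ s ∈ Icc (0 : ℝ) 1, ‖γ s - y‖ = i * r := fun i => by
    refine hivt ⟨by positivity, ?_⟩
    rw [← le_div_iff₀ hr0]
    exact (Nat.cast_le.2 (Nat.lt_succ_iff.1 i.2)).trans (Nat.floor_le (by positivity))
  choose s hs hsr using hex
  have hdisj : Pairwise (Function.onFun Disjoint fun i => Metric.ball (γ (s i)) (r / 2)) := by
    intro i j hij
    refine Metric.ball_disjoint_ball ?_
    rw [add_halves, dist_eq_norm]
    have h1 : (1 : ℝ) ≤ |((i : ℕ) : ℝ) - ((j : ℕ) : ℝ)| := by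
      have : ((i : ℕ) : ℤ) - ((j : ℕ) : ℤ) ≠ 0 := fun h => hij (Fin.ext (by omega))
      exact_mod_cast Int.one_le_abs this
    have h2 := abs_norm_sub_norm_le (γ (s i) - y) (γ (s j) - y)
    rw [hsr, hsr, ← sub_mul, abs_mul, abs_of_pos hr0, sub_sub_sub_cancel_right] at h2
    calc r = 1 * r := (one_mul r).symm
      _ ≤ _ := by gcongr
      _ ≤ _ := h2
  have hsub : (⋃ i, Metric.ball (γ (s i)) (r / 2)) ⊆ H ⁻¹' Metric.ball (H y) (L * r) := by
    refine iUnion_subset fun i q hq => ?_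
    rw [mem_preimage, mem_ball_iff_norm]
    rw [mem_ball_iff_norm] at hq
    set p := γ (s i) with hp
    have e1 : ‖H p - H y‖ ≤ ρ + 2 * η := by
      have : H p - H y = s i • (H z - H y) := by simp [hp, hγ]
      rw [this, norm_smul, Real.norm_of_nonneg (hs i).1]
      have h5 : ‖H z - H y‖ ≤ ρ + 2 * η := by
        calc ‖H z - H y‖ = ‖(H z - Y z) - (H y - Y y) - (Y y - Y z)‖ := by congr 1; abel
          _ ≤ η + η + ρ := (norm_sub_le _ _).trans
              (add_le_add ((norm_sub_le _ _).trans (add_le_add (hH z) (hH y))) le_rfl)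
          _ = _ := by ring
      calc s i * ‖H z - H y‖ ≤ 1 * ‖H z - H y‖ := by gcongr; exact (hs i).2
        _ ≤ _ := by rwa [one_mul]
    have e2 : ‖H q - H p‖ ≤ 2 * η + L * ‖q - p‖ := by
      calc ‖H q - H p‖ = ‖(H q - Y q) - (H p - Y p) + (Y q - Y p)‖ := by congr 1; abel
        _ ≤ η + η + L * ‖q - p‖ := (norm_add_le _ _).trans
            (add_le_add ((norm_sub_le _ _).trans (add_le_add (hH q) (hH p))) (hY q p))
        _ = _ := by ring
    have e3 : L * ‖q - p‖ < L * ρ' := by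
      gcongr
      linarith
    calc ‖H q - H y‖ ≤ ‖H q - H p‖ + ‖H p - H y‖ := norm_sub_le_norm_sub_add_norm_sub _ _ _
      _ < ρ' + L * ρ' := by linarith
      _ ≤ L * ρ' + L * ρ' := by nlinarith
      _ = L * r := by rw [hr]; ring
  -- Comparison of volumes bounds the number `N` of the balls.
  have hmeas : (N : ℝ≥0∞) * volume (Metric.ball (0 : Sp d) (r / 2)) ≤
      2 * volume (Metric.ball (0 : Sp d) (L * r)) := by
    calc (N : ℝ≥0∞) * volume (Metric.ball (0 : Sp d) (r / 2))
        = volume (⋃ i, Metric.ball (γ (s i)) (r / 2)) := by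
          rw [measure_iUnion hdisj fun i => measurableSet_ball, tsum_fintype]
          simp [Measure.addHaar_ball_center]
      _ ≤ volume (H ⁻¹' Metric.ball (H y) (L * r)) := measure_mono hsub
      _ ≤ 2 * volume (Metric.ball (H y) (L * r)) := hvol _ measurableSet_ball
      _ = _ := by rw [Measure.addHaar_ball_center]
  have hω0 : volume (Metric.ball (0 : Sp d) 1) ≠ 0 := (Metric.measure_ball_pos _ _ one_pos).ne'
  have hω : volume (Metric.ball (0 : Sp d) 1) ≠ ⊤ := measure_ball_lt_top.ne
  have hball : ∀ a : ℝ, 0 < a → volume (Metric.ball (0 : Sp d) a) =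
      ENNReal.ofReal (a ^ d) * volume (Metric.ball (0 : Sp d) 1) := fun a ha => by
    rw [Measure.addHaar_ball_of_pos _ _ ha, finrank_euclideanSpace_fin]
  rw [hball _ (by positivity), hball (L * r) (by positivity), ← mul_assoc, ← mul_assoc,
    ENNReal.mul_le_mul_iff_left hω0 hω, ← ENNReal.ofReal_natCast,
    ← ENNReal.ofReal_mul (by positivity), show (2 : ℝ≥0∞) = ENNReal.ofReal 2 by simp,
    ← ENNReal.ofReal_mul (by positivity), ENNReal.ofReal_le_ofReal_iff (by positivity)] at hmeas
  have hN' : (N : ℝ) ≤ 2 ^ (d + 1) * L ^ d := by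
    rw [div_pow r 2 d, mul_pow L r d, ← mul_div_assoc, div_le_iff₀ (by positivity)] at hmeas
    have hrd : 0 < r ^ d := by positivity
    refine le_of_mul_le_mul_right (hmeas.trans (le_of_eq ?_)) hrd
    ring
  calc R ≤ N * r := hNR
    _ ≤ 2 ^ (d + 1) * L ^ d * r := by gcongr
    _ = _ := by rw [hr, hc]; ring

theorem IsRegularFlow.norm_sub_le {T : ℝ} {X : ℝ → Sp d → Sp d} (hu : IsRegularField u ℓ)
    (hX : IsRegularFlow T u X) {t : ℝ} (ht : t ∈ Icc 0 T) {L : ℝ} (hL : 1 ≤ L)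
    (hXL : ∀ y z, ‖X t y - X t z‖ ≤ L * ‖y - z‖) (y z : Sp d) :
    ‖y - z‖ ≤ 2 ^ (d + 2) * L ^ d * ‖X t y - X t z‖ :=
  norm_sub_le_of_volume hL hXL (fun _ hη =>
    let ⟨H, _, _, h3, h4⟩ := hX.exists_homeomorph hu ht hη
    ⟨H, h3, h4⟩) y z

end Flow

section Lipschitz

/-! ### Lipschitz bounds by Besov norms of the gradient -/

variable {d : ℕ} {φ : Sp d → ℝ}

theorem fderiv_block (hφ : IsCutoff φ) (j : ℤ) (c : (Fin d → ℤ) → ℂ) (i : Fin d) (x : Sp d) :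
    fderiv ℝ (block φ j c) x (EuclideanSpace.single i 1) =
      block φ j (fun k => 2 * Real.pi * Complex.I * (k i : ℂ) * c k) x := by
  let F : Test d := ⟨block φ j c, contDiff_block hφ j c, periodic_block j c⟩
  refine congrFun (eq_of_funCoeff_eq (f := (partialDeriv i F : Sp d → ℂ))
    (Test.continuous _) (continuous_block hφ j _) (partialDeriv i F).2.2 (periodic_block j _)
    fun k => ?_) x
  rw [funCoeff_partialDeriv, block_eq_ser, funCoeff_ser (hφ.finite_support j _)]
  have : funCoeff (F : Sp d → ℂ) k = dyadic φ j k * c k := by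
    simp only [F, block_eq_ser]
    rw [funCoeff_ser (hφ.finite_support j _)]
  rw [this]
  ring

theorem norm_le_sum_single (A : Sp d →L[ℝ] ℂ) :
    ‖A‖ ≤ ∑ i, ‖A (EuclideanSpace.single i (1 : ℝ))‖ := by
  refine A.opNorm_le_bound (Finset.sum_nonneg fun _ _ => norm_nonneg _) fun x => ?_
  have hx : x = ∑ i, x i • (EuclideanSpace.single i (1 : ℝ) : Sp d) := by
    have := (EuclideanSpace.basisFun (Fin d) ℝ).sum_repr x
    simpa using this.symm
  calc ‖A x‖ = ‖∑ i, x i • A (EuclideanSpace.single i (1 : ℝ))‖ := by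
        conv_lhs => rw [hx]
        simp only [map_sum, map_smul]
    _ ≤ ∑ i, ‖x‖ * ‖A (EuclideanSpace.single i (1 : ℝ))‖ := by
        refine norm_sum_le_of_le _ fun i _ => ?_
        rw [norm_smul]
        gcongr
        exact PiLp.norm_apply_le x i
    _ = _ := by rw [← Finset.mul_sum, mul_comm]

theorem besov_one (φ : Sp d → ℝ) (s : ℝ) (p : ℝ≥0∞) (c : (Fin d → ℤ) → ℂ) : besov φ s p 1 c =
    ∑' j : ℤ, (2 : ℝ≥0∞) ^ ((j : ℝ) * s) * eLpNorm (block φ j c) p (volume.restrict (cube d)) := by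
  simp [besov]

/-- A scalar Lipschitz function is controlled by the norms of its partial derivatives in the
Besov spaces that embed into bounded functions. -/
theorem exists_edist_le_sum_besov (hφ : IsCutoff φ) : ∃ C : ℝ≥0, 1 ≤ C ∧ ∀ q : ℝ, 1 ≤ q →
    ∀ (F : Sp d → ℂ), Continuous F → Periodic F → ∀ G : ℝ≥0∞,
    (∀ i : Fin d, besov φ (d / q) (ENNReal.ofReal q) 1
      (fun k => 2 * Real.pi * Complex.I * (k i : ℂ) * funCoeff F k) ≤ G) →
    ∀ y z, edist (F y) (F z) ≤ C * G * edist y z := by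
  obtain ⟨C, hC⟩ := exists_bernstein hφ
  refine ⟨C * d + 1, le_add_self, fun q hq F hF hFp G hG => ?_⟩
  by_cases hGt : G = ⊤
  · intro y z
    by_cases hyz : y = z
    · simp [hyz]
    rw [hGt, ENNReal.mul_top (by simp), ENNReal.top_mul (by simpa using hyz)]
    exact le_top
  set c := funCoeff F with hc
  set c' : Fin d → (Fin d → ℤ) → ℂ := fun i k => 2 * Real.pi * Complex.I * (k i : ℂ) * c k with hc'
  set M : ℤ → ℝ≥0∞ := fun j => ∑ i, C * (2 ^ ((j : ℝ) * (d / q)) *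
    eLpNorm (block φ j (c' i)) (ENNReal.ofReal q) (volume.restrict (cube d))) with hM
  have hMs : ∑' j, M j ≤ C * d * G := by
    rw [hM, Summable.tsum_finsetSum fun _ _ => ENNReal.summable]
    calc _ ≤ ∑ i : Fin d, C * G := by
          refine Finset.sum_le_sum fun i _ => ?_
          rw [ENNReal.tsum_mul_left, ← besov_one]
          gcongr
          exact hG i
      _ = _ := by simp; ring
  have hMst : ∑' j, M j ≠ ⊤ := ne_top_of_le_ne_top (by finiteness) hMs
  have hMt : ∀ j, M j ≠ ⊤ := fun j => ne_top_of_le_ne_top hMst (ENNReal.le_tsum j)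
  have hlip : ∀ j, LipschitzWith (M j).toNNReal (block φ j c) := fun j => by
    refine lipschitzWith_of_nnnorm_fderiv_le
      ((contDiff_block hφ j c (n := 1)).differentiable (by simp)) fun x => ?_
    rw [← ENNReal.coe_le_coe, ENNReal.coe_toNNReal (hMt j)]
    have h1 : ‖fderiv ℝ (block φ j c) x‖ₑ ≤
        ∑ i, ‖fderiv ℝ (block φ j c) x (EuclideanSpace.single i (1 : ℝ))‖ₑ := by
      simp only [← ofReal_norm]
      rw [← ENNReal.ofReal_sum_of_nonneg fun _ _ => norm_nonneg _]
      exact ENNReal.ofReal_le_ofReal (norm_le_sum_single _)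
    refine h1.trans (Finset.sum_le_sum fun i _ => ?_)
    rw [fderiv_block hφ]
    exact hC q hq j _ x
  have hblock : ∀ j y z, ‖block φ j c y - block φ j c z‖ₑ ≤ M j * edist y z := fun j y z => by
    have := hlip j y z
    rwa [edist_eq_enorm_sub, ENNReal.coe_toNNReal (hMt j)] at this
  obtain ⟨R, hR⟩ := exists_norm_le_of_mem_cube d
  have hs : ∑' j, ∫⁻ x in cube d, ‖block φ j c x - block φ j c 0‖ₑ ≠ ⊤ := by
    refine ne_top_of_le_ne_top (b := (∑' j, M j) * ENNReal.ofReal R) (by finiteness) ?_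
    rw [← ENNReal.tsum_mul_right]
    refine ENNReal.tsum_le_tsum fun j => ?_
    calc _ ≤ ∫⁻ _ in cube d, M j * ENNReal.ofReal R := by
          refine setLIntegral_mono' measurableSet_cube fun x hx => (hblock j x 0).trans ?_
          gcongr
          rw [edist_zero_right, ← ofReal_norm]
          exact ENNReal.ofReal_le_ofReal (hR x hx)
      _ = _ := by rw [setLIntegral_const, volume_cube, mul_one]
  obtain ⟨b, hb⟩ := exists_ae_eq_const_add_tsum_block hφ hFp (integrableOn_cube_of_continuous hF)
    (fun j => block φ j c 0) hs
  have hsum : ∀ y, Summable fun j => block φ j c y - block φ j c 0 := fun y => by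
    refine Summable.of_norm ?_
    have h1 : ∑' j, ‖block φ j c y - block φ j c 0‖ₑ ≠ ⊤ := by
      refine ne_top_of_le_ne_top (b := (∑' j, M j) * edist y 0)
        (ENNReal.mul_ne_top hMst (edist_ne_top _ _)) ?_
      rw [← ENNReal.tsum_mul_right]
      exact ENNReal.tsum_le_tsum fun j => hblock j y 0
    exact (ENNReal.summable_toReal h1).congr fun j => by simp
  set D := {x | F x = b + ∑' j, (block φ j c x - block φ j c 0)} with hD
  have hDd : Dense D := Measure.dense_of_ae hb
  have hDlip : LipschitzOnWith (∑' j, M j).toNNReal F D := fun y hy z hz => by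
    rw [edist_eq_enorm_sub, hy, hz, add_sub_add_left_eq_sub, ← (hsum y).tsum_sub (hsum z),
      ENNReal.coe_toNNReal hMst, ← ENNReal.tsum_mul_right]
    refine enorm_tsum_le_tsum_enorm.trans (ENNReal.tsum_le_tsum fun j => ?_)
    rw [sub_sub_sub_cancel_right]
    exact hblock j y z
  have hall := (lipschitzOnWith_closure_iff hF.continuousOn).2 hDlip
  rw [hDd.closure_eq] at hall
  intro y z
  refine (hall (mem_univ y) (mem_univ z)).trans ?_
  rw [ENNReal.coe_toNNReal hMst]
  gcongr
  refine hMs.trans ?_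
  push_cast
  gcongr
  exact le_self_add

/-- A Lipschitz field is controlled by the norms of its gradient in the Besov spaces that embed
into bounded functions, uniformly in the integrability exponent. -/
theorem exists_edist_le_gradBesov (hφ : IsCutoff φ) : ∃ C : ℝ≥0, 1 ≤ C ∧ ∀ q : ℝ, 1 ≤ q →
    ∀ (V : Sp d → Sp d) (K : ℝ≥0), LipschitzWith K V → Periodic V → ∀ y z,
    edist (V y) (V z) ≤ C * gradBesov φ (d / q) (ENNReal.ofReal q) 1 V * edist y z := by
  obtain ⟨C, hC1, hC⟩ := exists_edist_le_sum_besov hφ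
  refine ⟨C * (d + 1), one_le_mul hC1 le_add_self, fun q hq V K hV hVp y z => ?_⟩
  set G := gradBesov φ (d / q) (ENNReal.ofReal q) 1 V with hG
  let P : Fin d → Sp d →L[ℝ] ℂ := fun l =>
    Complex.ofRealCLM.comp (EuclideanSpace.proj l : Sp d →L[ℝ] ℝ)
  have hP : ∀ l x, P l x = ((x l : ℝ) : ℂ) := fun l x => rfl
  have hcomp : ∀ l, edist (P l (V y)) (P l (V z)) ≤ C * G * edist y z := fun l => by
    have hL : LipschitzWith (‖P l‖₊ * K) fun x => P l (V x) := (P l).lipschitz.comp hV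
    have hper : Periodic fun x => P l (V x) := fun k x => by simp only [hVp k x]
    refine hC q hq (fun x => P l (V x)) hL.continuous hper G (fun i => ?_) y z
    have h1 : ∀ᵐ x, Tendsto (fun n : ℕ => ((n : ℂ) + 1) *
        (P l (V (x + EuclideanSpace.single i (1 / ((n : ℝ) + 1)))) - P l (V x))) atTop
        (𝓝 ((fderiv ℝ V x (EuclideanSpace.single i (1 : ℝ)) l : ℝ) : ℂ)) := by
      filter_upwards [hV.ae_differentiableAt] with x hx
      have h2 := tendsto_differenceQuotient (f := fun x => P l (V x))
        ((P l).differentiableAt.comp x hx) i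
      have h3 : fderiv ℝ (fun x => P l (V x)) x = (P l).comp (fderiv ℝ V x) :=
        ((P l).hasFDerivAt.comp x hx.hasFDerivAt).fderiv
      rw [h3] at h2
      exact h2
    have h4 : (fun k => 2 * Real.pi * Complex.I * (k i : ℂ) * funCoeff (fun x => P l (V x)) k) =
        funCoeff fun x => ((fderiv ℝ V x (EuclideanSpace.single i (1 : ℝ)) l : ℝ) : ℂ) :=
      funext fun k => (funCoeff_of_tendsto_differenceQuotient hL hper i h1 k).symm
    rw [h4]
    exact le_iSup₂ (f := fun i l => besov φ (d / q) (ENNReal.ofReal q) 1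
      (funCoeff fun x => ((fderiv ℝ V x (EuclideanSpace.single i (1 : ℝ)) l : ℝ) : ℂ))) i l
  have hsum : edist (V y) (V z) ≤ ∑ l, edist (P l (V y)) (P l (V z)) := by
    have h1 : ‖V y - V z‖ ≤ ∑ l, ‖P l (V y) - P l (V z)‖ := by
      have hx : V y - V z = ∑ i, (V y - V z) i • (EuclideanSpace.single i (1 : ℝ) : Sp d) := by
        have := (EuclideanSpace.basisFun (Fin d) ℝ).sum_repr (V y - V z)
        simpa using this.symm
      rw [hx]
      refine norm_sum_le_of_le _ fun i _ => ?_
      rw [norm_smul, PiLp.norm_single, norm_one, mul_one, ← map_sub, hP, Complex.norm_real]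
    simp only [edist_eq_enorm_sub, ← ofReal_norm]
    rw [← ENNReal.ofReal_sum_of_nonneg fun _ _ => norm_nonneg _]
    exact ENNReal.ofReal_le_ofReal h1
  calc edist (V y) (V z) ≤ ∑ _l : Fin d, C * G * edist y z :=
        hsum.trans (Finset.sum_le_sum fun l _ => hcomp l)
    _ = d * (C * G * edist y z) := by simp
    _ ≤ (d + 1) * (C * G * edist y z) := by gcongr; exact le_self_add
    _ = _ := by push_cast; ring

end Lipschitz

section FlowLipschitz

/-! ### Lipschitz bounds for flows -/

variable {d : ℕ} {φ : Sp d → ℝ} {T t : ℝ}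

theorem IsVelocity.exists_isRegularFlow {v X : ℝ → Sp d → Sp d} (hv : IsVelocity T v)
    (hX : IsFlow T v X) (hT : 0 ≤ T) : ∃ (u : ℝ → Sp d → Sp d) (ℓ : ℝ → ℝ≥0),
      IsRegularField u ℓ ∧ IsRegularFlow T u X ∧
      ∀ᵐ τ ∂(volume.restrict (Ioc 0 T)), u τ = v τ := by
  obtain ⟨u, ℓ, hu, hae⟩ := hv.exists_isRegularField
  exact ⟨u, ℓ, hu, hX.isRegularFlow hu hae hT, hae⟩

theorem IsRegularFlow.integrableOn {u X : ℝ → Sp d → Sp d} {ℓ : ℝ → ℝ≥0}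
    (hu : IsRegularField u ℓ) (hX : IsRegularFlow T u X) (ht : t ∈ Icc 0 T) (y : Sp d) :
    IntegrableOn (fun τ => u τ (X τ y)) (Ioc 0 t) :=
  hu.integrableOn_comp (aemeasurable_of_continuousOn (hX.cont y) le_rfl ht.2)

theorem IsRegularFlow.eq_add {u X : ℝ → Sp d → Sp d} (hX : IsRegularFlow T u X)
    (ht : t ∈ Icc 0 T) (y : Sp d) : X t y = y + ∫ τ in Ioc 0 t, u τ (X τ y) := by
  have := hX.step y 0 ⟨le_rfl, ht.1.trans ht.2⟩ t ht ht.1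
  rwa [hX.zero] at this

/-- Under the smallness condition, the Lipschitz constant of the flow is bounded by a constant that
depends on the dimension and the cutoff only. -/
theorem exists_edist_flow_le (hφ : IsCutoff φ) : ∃ C : ℝ≥0, 1 ≤ C ∧ ∀ (T t : ℝ), t ∈ Icc 0 T →
    ∀ v X : ℝ → Sp d → Sp d, IsVelocity T v → IsFlow T v X → IsSmall φ t (lagr v X) →
    ∀ y z, edist (X t y) (X t z) ≤ C * edist y z := by
  obtain ⟨C, hC1, hC⟩ := exists_edist_le_gradBesov hφ
  refine ⟨1 + C, le_self_add, fun T t ht v X hv hX hs y z => ?_⟩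
  obtain ⟨u, ℓ, hu, hXu, hae⟩ := hv.exists_isRegularFlow hX (ht.1.trans ht.2)
  obtain ⟨q, hq, hsmall⟩ := hs
  have hae' := ae_restrict_of_ae_restrict_of_subset (Ioc_subset_Ioc_right ht.2) hae
  have hXK : ∀ τ ∈ Ioc 0 t, ∃ K, LipschitzWith K (X τ) := fun τ hτ =>
    hXu.lipschitzWith hu ⟨hτ.1.le, hτ.2.trans ht.2⟩
  have hint : ‖(∫ τ in Ioc 0 t, u τ (X τ y)) - ∫ τ in Ioc 0 t, u τ (X τ z)‖ₑ ≤
      C * edist y z := by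
    rw [← integral_sub (hXu.integrableOn hu ht y) (hXu.integrableOn hu ht z)]
    calc _ ≤ ∫⁻ τ in Ioc 0 t, ‖u τ (X τ y) - u τ (X τ z)‖ₑ := enorm_integral_le_lintegral_enorm _
      _ ≤ ∫⁻ τ in Ioc 0 t, C * edist y z *
          gradBesov φ (d / q) (ENNReal.ofReal q) 1 (lagr v X τ) := by
          refine lintegral_mono_ae ?_
          filter_upwards [hae', ae_restrict_mem measurableSet_Ioc] with τ hτ hτt
          obtain ⟨K, hK⟩ := hXK τ hτt
          have hτT : τ ∈ Icc 0 T := ⟨hτt.1.le, hτt.2.trans ht.2⟩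
          have hL : LipschitzWith (ℓ τ * K) (lagr v X τ) := by
            have := (hu.lip τ).comp hK
            rwa [hτ] at this
          have hper : Periodic (lagr v X τ) := fun k x => by
            rw [lagr, hXu.add_lat hu hτT, ← hτ, hu.periodic τ k, hτ]
            rfl
          have := hC q hq _ _ hL hper y z
          rw [← edist_eq_enorm_sub, hτ, mul_right_comm]
          exact this
      _ ≤ C * edist y z * 1 := by
          rw [lintegral_const_mul' _ _ (ENNReal.mul_ne_top (by simp) (edist_ne_top _ _))]
          gcongr
          exact hsmall.trans (ENNReal.div_le_of_le_mul (by norm_num))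
      _ = _ := mul_one _
  rw [hXu.eq_add ht y, hXu.eq_add ht z, edist_eq_enorm_sub, add_sub_add_comm]
  calc _ ≤ ‖y - z‖ₑ + C * edist y z := (enorm_add_le _ _).trans (add_le_add le_rfl hint)
    _ = _ := by rw [← edist_eq_enorm_sub]; push_cast; ring

/-- The Lipschitz constant of the difference of two flows is bounded by the norm of the difference
of the velocities in Lagrangian coordinates. -/
theorem enorm_flow_sub_sub_le {v₁ X₁ v₂ X₂ : ℝ → Sp d → Sp d} (hv₁ : IsVelocity T v₁)
    (hX₁ : IsFlow T v₁ X₁) (hv₂ : IsVelocity T v₂) (hX₂ : IsFlow T v₂ X₂) (ht : t ∈ Icc 0 T)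
    (y z : Sp d) : ‖(X₁ t y - X₁ t z) - (X₂ t y - X₂ t z)‖ₑ ≤
      lOneWOneInf T (fun τ y => lagr v₁ X₁ τ y - lagr v₂ X₂ τ y) * edist y z := by
  obtain ⟨u₁, ℓ₁, hu₁, hXu₁, hae₁⟩ := hv₁.exists_isRegularFlow hX₁ (ht.1.trans ht.2)
  obtain ⟨u₂, ℓ₂, hu₂, hXu₂, hae₂⟩ := hv₂.exists_isRegularFlow hX₂ (ht.1.trans ht.2)
  have h1 := ae_restrict_of_ae_restrict_of_subset (Ioc_subset_Ioc_right ht.2) hae₁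
  have h2 := ae_restrict_of_ae_restrict_of_subset (Ioc_subset_Ioc_right ht.2) hae₂
  have i₁ := hXu₁.integrableOn hu₁ ht
  have i₂ := hXu₂.integrableOn hu₂ ht
  have heq : (X₁ t y - X₁ t z) - (X₂ t y - X₂ t z) = ∫ τ in Ioc 0 t,
      ((u₁ τ (X₁ τ y) - u₂ τ (X₂ τ y)) - (u₁ τ (X₁ τ z) - u₂ τ (X₂ τ z))) := by
    have j : ∀ x, IntegrableOn (fun τ => u₁ τ (X₁ τ x) - u₂ τ (X₂ τ x)) (Ioc 0 t) := fun x =>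
      (i₁ x).sub (i₂ x)
    rw [integral_sub (j y) (j z), integral_sub (i₁ y) (i₂ y),
      integral_sub (i₁ z) (i₂ z), hXu₁.eq_add ht y, hXu₁.eq_add ht z, hXu₂.eq_add ht y,
      hXu₂.eq_add ht z]
    abel
  rw [heq]
  calc _ ≤ ∫⁻ τ in Ioc 0 t,
        ‖(u₁ τ (X₁ τ y) - u₂ τ (X₂ τ y)) - (u₁ τ (X₁ τ z) - u₂ τ (X₂ τ z))‖ₑ :=
        enorm_integral_le_lintegral_enorm _
    _ ≤ ∫⁻ τ in Ioc 0 t, wOneInf (fun y => lagr v₁ X₁ τ y - lagr v₂ X₂ τ y) * edist y z := by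
        refine lintegral_mono_ae ?_
        filter_upwards [h1, h2] with τ e1 e2
        rw [e1, e2, ← edist_eq_enorm_sub]
        exact edist_le_wOneInf (fun y => lagr v₁ X₁ τ y - lagr v₂ X₂ τ y) y z
    _ ≤ _ := by
        rw [lintegral_mul_const' _ _ (edist_ne_top _ _), lOneWOneInf]
        gcongr
        exact ht.2

end FlowLipschitz

section Kernel

/-! ### The kernel of the fractional Laplacian in Lagrangian coordinates -/

variable {d : ℕ}

/-- The constant of the kernel of the fractional Laplacian. -/
def kernelConst (d : ℕ) (s : ℝ) : ℝ :=
  2 ^ s * Real.Gamma ((d + s) / 2) / (Real.pi ^ ((d : ℝ) / 2) * |Real.Gamma (-s / 2)|)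

theorem kernel_eq {s : ℝ} (z : Sp d) :
    kernel d s z = kernelConst d s * ‖z‖ ^ (-((d : ℝ) + s)) := by
  rw [kernel, kernelConst, Real.rpow_neg (norm_nonneg _), div_eq_mul_inv]

theorem measurable_kernel (d : ℕ) (s : ℝ) : Measurable (kernel d s) := by
  rw [funext (kernel_eq (d := d) (s := s))]
  fun_prop

theorem kernel_neg (d : ℕ) (s : ℝ) (z : Sp d) : kernel d s (-z) = kernel d s z := by
  rw [kernel, kernel, norm_neg]

/-- Lifts to `ℝ^d` of maps of the torus whose inverse is Lipschitz with constant `m`. -/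
structure IsExpanding (m : ℝ) (X : Sp d → Sp d) : Prop where
  cont : Continuous X
  lattice : ∀ k y, X (y + lat k) = X y + lat k
  expand : ∀ y z, ‖y - z‖ ≤ m * ‖X y - X z‖

theorem IsExpanding.measurable_kernel {m : ℝ} {X : Sp d → Sp d} (hX : IsExpanding m X) (s : ℝ) :
    Measurable (Function.uncurry fun y z => kernel d s (X y - X z)) := by
  have := hX.cont.measurable
  exact (LagFrac.measurable_kernel d s).comp
    ((this.comp measurable_fst).sub (this.comp measurable_snd))

theorem IsExpanding.kernel_symm {m : ℝ} {X : Sp d → Sp d} (_ : IsExpanding m X) (s : ℝ) (y z : Sp d) :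
    kernel d s (X y - X z) = kernel d s (X z - X y) := by
  rw [← neg_sub, kernel_neg]

theorem IsExpanding.kernel_diag {m : ℝ} {X : Sp d → Sp d} (hX : IsExpanding m X) (s : ℝ)
    (k : Fin d → ℤ) (y z : Sp d) :
    kernel d s (X (y + lat k) - X (z + lat k)) = kernel d s (X y - X z) := by
  rw [hX.lattice, hX.lattice, add_sub_add_right_eq_sub]

theorem enorm_le_mul_rpow_neg {σ : ℝ} {a : ℝ} {A : ℝ≥0} {x : Sp d} (hx : x ≠ 0)
    (h : |a| ≤ A * ‖x‖ ^ (-σ)) : ‖a‖ₑ ≤ A * ‖x‖ₑ ^ (-σ) := by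
  rw [← ofReal_norm, ← ofReal_norm, ENNReal.ofReal_rpow_of_pos (norm_pos_iff.2 hx),
    ← ENNReal.ofReal_coe_nnreal, ← ENNReal.ofReal_mul A.coe_nonneg]
  exact ENNReal.ofReal_le_ofReal h

theorem IsExpanding.inv_mul_norm_le {m : ℝ} (hm : 0 < m) {X : Sp d → Sp d} (hX : IsExpanding m X)
    (y z : Sp d) : m⁻¹ * ‖y - z‖ ≤ ‖X y - X z‖ := by
  rw [inv_mul_le_iff₀ hm]
  exact hX.expand y z

theorem IsExpanding.isSingularKernel {m : ℝ≥0} (hm : 0 < m) {X : Sp d → Sp d}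
    (hX : IsExpanding m X) {s : ℝ} (hs : 0 < s) : IsSingularKernel (d + s)
      (‖kernelConst d s‖₊ * m ^ ((d : ℝ) + s)) fun y z => kernel d s (X y - X z) := by
  have hσ : (0 : ℝ) < d + s := by positivity
  refine ⟨hX.measurable_kernel s, hX.kernel_symm s, hX.kernel_diag s, fun y z => ?_⟩
  by_cases hyz : y - z = 0
  · rw [sub_eq_zero.1 hyz, sub_self, kernel_eq, norm_zero, Real.zero_rpow (neg_ne_zero.2 hσ.ne')]
    simp
  have hpos : 0 < ‖y - z‖ := norm_pos_iff.2 hyz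
  have hm' : (0 : ℝ) < m := hm
  refine enorm_le_mul_rpow_neg hyz ?_
  rw [kernel_eq, abs_mul, abs_of_nonneg (Real.rpow_nonneg (norm_nonneg _) _)]
  push_cast
  rw [mul_assoc, Real.norm_eq_abs]
  gcongr
  calc ‖X y - X z‖ ^ (-((d : ℝ) + s)) ≤ ((m : ℝ)⁻¹ * ‖y - z‖) ^ (-((d : ℝ) + s)) :=
        Real.rpow_le_rpow_of_nonpos (by positivity) (hX.inv_mul_norm_le hm' y z) (by linarith)
    _ = _ := by
        rw [Real.mul_rpow (by positivity) hpos.le, Real.inv_rpow hm'.le, Real.rpow_neg hm'.le,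
          inv_inv]

/-- The mean value inequality for `x ↦ x ^ (-σ)` on `[e, ∞)`. -/
theorem abs_rpow_neg_sub_le {σ e a b : ℝ} (hσ : 0 < σ) (he : 0 < e) (ha : e ≤ a) (hb : e ≤ b) :
    |a ^ (-σ) - b ^ (-σ)| ≤ σ * e ^ (-σ - 1) * |a - b| := by
  refine (convex_Ici e).norm_image_sub_le_of_norm_hasDerivWithin_le
    (f := fun x => x ^ (-σ)) (f' := fun x => -σ * x ^ (-σ - 1)) (fun x hx => ?_) (fun x hx => ?_)
    hb ha
  · have hx0 : 0 < x := he.trans_le hx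
    exact (Real.hasDerivAt_rpow_const (Or.inl hx0.ne')).hasDerivWithinAt
  · have hx0 : 0 < x := he.trans_le hx
    rw [norm_mul, norm_neg, Real.norm_of_nonneg hσ.le, Real.norm_of_nonneg (by positivity)]
    exact mul_le_mul_of_nonneg_left (Real.rpow_le_rpow_of_nonpos he hx (by linarith)) hσ.le

theorem IsExpanding.isSingularKernel_sub {m : ℝ≥0} (hm : 0 < m) {X₁ X₂ : Sp d → Sp d}
    (h₁ : IsExpanding m X₁) (h₂ : IsExpanding m X₂) {D : ℝ≥0}
    (hD : ∀ y z, ‖(X₁ y - X₁ z) - (X₂ y - X₂ z)‖ ≤ D * ‖y - z‖) {s : ℝ} (hs : 0 < s) :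
    IsSingularKernel (d + s)
      (‖kernelConst d s‖₊ * ((d + s).toNNReal * m ^ ((d : ℝ) + s + 1)) * D)
      fun y z => kernel d s (X₁ y - X₁ z) - kernel d s (X₂ y - X₂ z) := by
  have hσ : (0 : ℝ) < d + s := by positivity
  refine ⟨(h₁.measurable_kernel s).sub (h₂.measurable_kernel s), fun y z => ?_, fun k y z => ?_,
    fun y z => ?_⟩
  · rw [h₁.kernel_symm, h₂.kernel_symm]
  · rw [h₁.kernel_diag, h₂.kernel_diag]
  by_cases hyz : y - z = 0
  · rw [sub_eq_zero.1 hyz]; simp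
  have hpos : 0 < ‖y - z‖ := norm_pos_iff.2 hyz
  have hm' : (0 : ℝ) < m := hm
  refine enorm_le_mul_rpow_neg hyz ?_
  rw [kernel_eq, kernel_eq, ← mul_sub, abs_mul]
  push_cast
  rw [Real.norm_eq_abs, Real.coe_toNNReal _ hσ.le, mul_assoc, mul_assoc]
  gcongr
  have hab : |‖X₁ y - X₁ z‖ - ‖X₂ y - X₂ z‖| ≤ D * ‖y - z‖ :=
    (abs_norm_sub_norm_le _ _).trans (hD y z)
  calc _ ≤ (d + s) * ((m : ℝ)⁻¹ * ‖y - z‖) ^ (-((d : ℝ) + s) - 1) *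
        |‖X₁ y - X₁ z‖ - ‖X₂ y - X₂ z‖| :=
        abs_rpow_neg_sub_le hσ (by positivity) (h₁.inv_mul_norm_le hm' y z)
          (h₂.inv_mul_norm_le hm' y z)
    _ ≤ (d + s) * ((m : ℝ)⁻¹ * ‖y - z‖) ^ (-((d : ℝ) + s) - 1) * (D * ‖y - z‖) := by gcongr
    _ = (d + s) * (m : ℝ) ^ ((d : ℝ) + s + 1) * D *
        (‖y - z‖ ^ (-((d : ℝ) + s) - 1) * ‖y - z‖) := by
        rw [show -((d : ℝ) + s) - 1 = -((d : ℝ) + s + 1) by ring,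
          Real.mul_rpow (by positivity) hpos.le, Real.inv_rpow hm'.le, Real.rpow_neg hm'.le, inv_inv]
        ring
    _ = _ := by
        rw [← Real.rpow_add_one hpos.ne', sub_add_cancel]
        ring

/-- The flow at a time at which the smallness condition holds is expanding, with a constant that
depends on the dimension and the cutoff only, and so are the differences of two flows. -/
theorem exists_isExpanding {φ : Sp d → ℝ} (hφ : IsCutoff φ) : ∃ L m : ℝ≥0, 0 < m ∧
    ∀ (T t : ℝ), t ∈ Icc 0 T → ∀ v X : ℝ → Sp d → Sp d, IsVelocity T v → IsFlow T v X →
    IsSmall φ t (lagr v X) → LipschitzWith L (X t) ∧ IsExpanding m (X t) := by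
  obtain ⟨L, hL1, hL⟩ := exists_edist_flow_le hφ
  refine ⟨L, 2 ^ (d + 2) * L ^ d, by positivity, fun T t ht v X hv hX hs => ?_⟩
  have hlip : LipschitzWith L (X t) := hL T t ht v X hv hX hs
  obtain ⟨u, ℓ, hu, hXu, -⟩ := hv.exists_isRegularFlow hX (ht.1.trans ht.2)
  refine ⟨hlip, hlip.continuous, fun k y => hXu.add_lat hu ht k y, fun y z => ?_⟩
  push_cast
  exact hXu.norm_sub_le hu ht (by exact_mod_cast hL1) hlip.norm_sub_le y z

end Kernel

/-! ### The fractional Laplacian of a flow -/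

section Main

variable {d : ℕ}

/-- The fractional Laplacian in the coordinates of an expanding map, as a distribution. -/
theorem IsExpanding.exists_isFracLap {φ : Sp d → ℝ} (hφ : IsCutoff φ) {a b : ℝ} (ha : 0 < a)
    (ha' : a < 1) (hb : 0 < b) (hb' : b < 1) {p r : ℝ≥0∞} (hp : 1 ≤ p) (hr : 1 ≤ r) {w : Distr d}
    (hw : besov φ b p r (coeff w) < ⊤) {m : ℝ≥0} (hm : 0 < m) {X : Sp d → Sp d}
    (hX : IsExpanding m X) : ∃ g : Distr d, IsFracLap X (a + b) w g ∧ ∀ f : Test d, g.1 f =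
      1 / 2 * form (fun y z => kernel d (a + b) (X y - X z)) (blockSum φ (coeff w)) f := by
  have hκ := hX.isSingularKernel hm (s := a + b) (by positivity)
  obtain ⟨g, hg⟩ := hκ.exists_distr hφ ha ha' hb hb' hp hr hw
  have hrep := represents_of_tsum_block hφ w (tsum_lintegral_block_ne_top hφ hb hp hr hw)
  refine ⟨g, ⟨blockSum φ (coeff w), hrep, fun f => ?_⟩, hg⟩
  rw [hg f]
  exact hκ.tendsto_truncated ha ha' hb hb' (measurable_blockSum hφ _) (periodic_blockSum φ _)
    hrep.2.1 f (absForm_blockSum_test_ne_top hφ ha ha' hb hb' hp hr hw f)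

end Main

end LagFrac

end

theorem lemma3p4 {d : ℕ} (hd : 2 ≤ d) (φ : LagFrac.Sp d → ℝ) (hφ : LagFrac.IsCutoff φ)
    (s₁ s₂ : ℝ) (hs₁ : 0 < s₁) (hs₁' : s₁ < 1) (hs₂ : s₁ < s₂) (hs₂' : s₂ < 1 + s₁)
    (p r : ℝ≥0∞) (hp : 1 ≤ p) (hr : 1 ≤ r) :
    ∃ C : ℝ≥0, ∀ (T t : ℝ), 0 < T → t ∈ Set.Icc 0 T →
      ∀ w : LagFrac.Distr d, LagFrac.besov φ (s₂ - s₁) p r (LagFrac.coeff w) < ⊤ →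
        (∀ v X : ℝ → LagFrac.Sp d → LagFrac.Sp d,
          LagFrac.IsVelocity T v → LagFrac.IsFlow T v X →
          LagFrac.IsSmall φ t (LagFrac.lagr v X) →
          ∃ g : LagFrac.Distr d, LagFrac.IsFracLap (X t) s₂ w g ∧ LagFrac.coeff g 0 = 0 ∧
            LagFrac.besov φ (-s₁) p r (LagFrac.coeff g) ≤
              C * LagFrac.besov φ (s₂ - s₁) p r (LagFrac.coeff w)) ∧
        (∀ v₁ X₁ v₂ X₂ : ℝ → LagFrac.Sp d → LagFrac.Sp d,
          LagFrac.IsVelocity T v₁ → LagFrac.IsFlow T v₁ X₁ →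
          LagFrac.IsSmall φ t (LagFrac.lagr v₁ X₁) →
          LagFrac.IsVelocity T v₂ → LagFrac.IsFlow T v₂ X₂ →
          LagFrac.IsSmall φ t (LagFrac.lagr v₂ X₂) →
          ∃ g₁ g₂ : LagFrac.Distr d,
            LagFrac.IsFracLap (X₁ t) s₂ w g₁ ∧ LagFrac.IsFracLap (X₂ t) s₂ w g₂ ∧
            LagFrac.coeff (g₁ - g₂) 0 = 0 ∧
            LagFrac.besov φ (-s₁) p r (LagFrac.coeff (g₁ - g₂)) ≤
              C * LagFrac.besov φ (s₂ - s₁) p r (LagFrac.coeff w) *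
                LagFrac.lOneWOneInf T
                  (fun τ y => LagFrac.lagr v₁ X₁ τ y - LagFrac.lagr v₂ X₂ τ y)) := by
  open LagFrac in
  obtain ⟨b, rfl⟩ : ∃ b, s₂ = s₁ + b := ⟨s₂ - s₁, by ring⟩
  have hb : 0 < b := by linarith
  have hb' : b < 1 := by linarith
  rw [add_sub_cancel_left]
  obtain ⟨L, m, hm, hflow⟩ := exists_isExpanding hφ
  obtain ⟨Q, hQ⟩ := exists_besov_le_of_form hφ hs₁ hs₁' hb hb'
  have hs : 0 < s₁ + b := by positivity
  set κ₀ := ‖kernelConst d (s₁ + b)‖₊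
  set B₁ : ℝ≥0 := κ₀ * m ^ ((d : ℝ) + (s₁ + b))
  set B₂ : ℝ≥0 := κ₀ * ((d + (s₁ + b)).toNNReal * m ^ ((d : ℝ) + (s₁ + b) + 1))
  refine ⟨Q * B₁ + Q * B₂, fun T t hT ht w hw => ⟨fun v X hv hX hsm => ?_,
    fun v₁ X₁ v₂ X₂ hv₁ hX₁ hsm₁ hv₂ hX₂ hsm₂ => ?_⟩⟩
  · obtain ⟨-, hE⟩ := hflow T t ht v X hv hX hsm
    obtain ⟨g, hg, hgf⟩ := hE.exists_isFracLap hφ hs₁ hs₁' hb hb' hp hr hw hm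
    refine ⟨g, hg, coeff_zero_of_form hgf, ?_⟩
    refine (hQ p r hp hr _ hw _ _ (hE.isSingularKernel hm hs) g hgf).trans ?_
    gcongr
    push_cast
    exact le_self_add
  · obtain ⟨hL₁, hE₁⟩ := hflow T t ht v₁ X₁ hv₁ hX₁ hsm₁
    obtain ⟨hL₂, hE₂⟩ := hflow T t ht v₂ X₂ hv₂ hX₂ hsm₂
    obtain ⟨g₁, hg₁, hgf₁⟩ := hE₁.exists_isFracLap hφ hs₁ hs₁' hb hb' hp hr hw hm
    obtain ⟨g₂, hg₂, hgf₂⟩ := hE₂.exists_isFracLap hφ hs₁ hs₁' hb hb' hp hr hw hm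
    set D := lOneWOneInf T (fun τ y => lagr v₁ X₁ τ y - lagr v₂ X₂ τ y)
    -- the flows are Lipschitz in any case, so that the Lipschitz constant of their difference is
    -- finite even if `D` is not
    set D' : ℝ≥0 := (min (2 * L : ℝ≥0∞) D).toNNReal
    have hD'c : (D' : ℝ≥0∞) = min (2 * L : ℝ≥0∞) D :=
      ENNReal.coe_toNNReal (ne_top_of_le_ne_top (by finiteness) (min_le_left _ _))
    have hD' : ∀ y z, ‖(X₁ t y - X₁ t z) - (X₂ t y - X₂ t z)‖ ≤ D' * ‖y - z‖ := fun y z => by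
      have h1 : ‖(X₁ t y - X₁ t z) - (X₂ t y - X₂ t z)‖ₑ ≤ 2 * L * ‖y - z‖ₑ := by
        have e1 := hL₁ y z
        have e2 := hL₂ y z
        rw [edist_eq_enorm_sub, edist_eq_enorm_sub] at e1 e2
        exact enorm_sub_le.trans ((add_le_add e1 e2).trans (le_of_eq (by ring)))
      have h2 := enorm_flow_sub_sub_le hv₁ hX₁ hv₂ hX₂ ht y z
      rw [edist_eq_enorm_sub] at h2
      have h3 : ‖(X₁ t y - X₁ t z) - (X₂ t y - X₂ t z)‖ₑ ≤ D' * ‖y - z‖ₑ := by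
        rw [hD'c]
        rcases min_choice (2 * L : ℝ≥0∞) D with e | e <;> rw [e]
        exacts [h1, h2]
      rw [← ofReal_norm, ← ofReal_norm, ← ENNReal.ofReal_coe_nnreal,
        ← ENNReal.ofReal_mul D'.coe_nonneg, ENNReal.ofReal_le_ofReal_iff (by positivity)] at h3
      exact h3
    have hκ := hE₁.isSingularKernel_sub hm hE₂ hD' hs
    have hg : ∀ f : Test d, (g₁ - g₂).1 f = 1 / 2 * form (fun y z =>
        kernel d (s₁ + b) (X₁ t y - X₁ t z) - kernel d (s₁ + b) (X₂ t y - X₂ t z))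
        (blockSum φ (coeff w)) f := fun f => by
      rw [form_kernel_sub (hE₁.isSingularKernel hm hs) (hE₂.isSingularKernel hm hs)
        (measurable_blockSum hφ _) (Test.continuous f).measurable
        (absForm_blockSum_test_ne_top hφ hs₁ hs₁' hb hb' hp hr hw f), mul_sub, ← hgf₁, ← hgf₂]
      rfl
    refine ⟨g₁, g₂, hg₁, hg₂, coeff_zero_of_form hg, ?_⟩
    refine (hQ p r hp hr _ hw _ _ hκ _ hg).trans ?_
    calc _ = Q * ((B₂ * D' : ℝ≥0) : ℝ≥0∞) * besov φ b p r (coeff w) := rfl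
      _ = Q * B₂ * besov φ b p r (coeff w) * D' := by rw [ENNReal.coe_mul]; ring
      _ ≤ _ := by
        gcongr
        · push_cast
          exact le_add_self
        · rw [hD'c]
          exact min_le_right _ _
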